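/- **Setup.** Let $N\ge 1$, let $t^{1/2},q\in\mathbb{C}^\times$, $V=\mathbb{C}|{\uparrow}\rangle\oplus\mathbb{C}|{\downarrow}\rangle$ and $\mathcal H=V^{\otimes N}$. All operators below act on $\mathcal H\otimes\mathbb{C}(z_1,\dots,z_N)$. For $w\in\mathfrak S_N$ put $(s_wF)(z_1,\dots,z_N)=F(z_{w(1)},\dots,z_{w(N)})$, and $s_i=s_{(i,i+1)}$. Let $\hat q_i$ be the substitution $z_i\mapsto q\,z_i$, $\hat q_J=\prod_{j\in J}\hat q_j$, and $(\pi F)(z_1,\dots,z_N)=F(q\,z_N,z_1,\dots,z_{N-1})$. For $1\le i\le N-1$ let $$T_i^{\mathrm{pol}}=-t^{-1/2}(t\,z_i-z_{i+1})\,(z_i-z_{i+1})^{-1}(1-s_i)+t^{1/2},$$ and for $1\le i\le N$ let $$Y_i=T_i^{\mathrm{pol}}\cdots T_{N-1}^{\mathrm{pol}}\,\pi\,(T_1^{\mathrm{pol}})^{-1}\cdots (T_{i-1}^{\mathrm{pol}})^{-1}.$$ With respect to the basis $|{\uparrow\uparrow}\rangle,|{\uparrow\downarrow}\rangle,|{\downarrow\uparrow}\rangle,|{\downarrow\downarrow}\rangle$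 of $V\otimes V$ let $$T^{\mathrm{sp}}=\begin{pmatrix}t^{1/2}&0&0&0\\0&t^{1/2}-t^{-1/2}&1&0\\0&1&0&0\\0&0&0&t^{1/2}\end{pmatrix},\qquad \check R(u)=\begin{pmatrix}1&0&0&0\\0&u\,g(u)&f(u)&0\\0&f(u)&g(u)&0\\0&0&0&1\end{pmatrix},$$ $$f(u)=\frac{u-1}{t^{1/2}u-t^{-1/2}},\qquad g(u)=\frac{t^{1/2}-t^{-1/2}}{t^{1/2}u-t^{-1/2}},$$ and let $T_i^{\mathrm{sp}}$, $\check R_{i,i+1}(u)$ denote these matrices acting on the spins at sites $i,i+1$. The *physical space* $\widetilde{\mathcal H}$ is the space of all $\Psi\in\mathcal H\otimes\mathbb{C}[z_1,\dots,z_N]$ such that $T_i^{\mathrm{sp}}\Psi=T_i^{\mathrm{pol}}\Psi$ for all $1\le i\le N-1$. For $0\le r\le N$ define the *spin-Macdonald operators* $$\widetilde D_r=e_r(Y_1,\dots,Y_N)=\sum_{i_1<\cdots<i_r}Y_{i_1}\cdots Y_{i_r},\qquad \widetilde D_{-r}=\sum_{i_1<\cdots<i_r}Y_{i_1}^{-1}\cdots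 Y_{i_r}^{-1}.$$ Let $s_i^{\mathrm{tot}}=s_i\,\check R_{i,i+1}(z_i/z_{i+1})$; for $w\in\mathfrak S_N$ with a chosen reduced decomposition $w=s_{i_1}\cdots s_{i_k}$ let $s_w^{\mathrm{tot}}=s_{i_1}^{\mathrm{tot}}\cdots s_{i_k}^{\mathrm{tot}}$, and let $\check R_w=s_{w^{-1}}\,s_w^{\mathrm{tot}}$. For $J=\{j_1<\dots<j_r\}$ let $\{j_1,\dots,j_r\}\in\mathfrak S_N$ be the Grassmannian permutation, i.e. the shortest permutation with $m\mapsto j_m$ for $1\le m\le r$; and for $I=\{i_1<\dots<i_r\}$ let $w_I$ be the shortest permutation with $N-r+m\mapsto i_m$ for $1\le m\le r$. Finally let $$a_{ij}=t^{-1/2}\,\frac{t\,z_i-z_j}{z_i-z_j},\qquad A_J=\prod_{j\in J,\ k\notin J}a_{jk},\qquad A_{-I}=\prod_{i\in I,\ k\notin I}a_{ki}.$$ **Theorem.** (1) $w\mapsto s_w^{\mathrm{tot}}$ is a representation of $\mathfrak S_N$ (in particular it does not depend on the chosen reduced decompositions), and $s_w^{\mathrm{tot}}=\check R_{w^{-1}}^{-1}\,s_w=s_w\,\check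 R_w$ for all $w\in\mathfrak S_N$. (2) The operators $\widetilde D_r$, $-N\le r\le N$, preserve $\widetilde{\mathcal H}$ and commute with each other on $\widetilde{\mathcal H}$. (3) On $\widetilde{\mathcal H}$, for all $0\le r\le N$, $$\widetilde D_r=\sum_{\#J=r}A_J\ \check R_{\{j_1,\dots,j_r\}^{-1}}^{-1}\ \hat q_J\ \check R_{\{j_1,\dots,j_r\}^{-1}} .$$ (4) On $\widetilde{\mathcal H}$, $\widetilde D_{N-r}=\hat q_1\cdots\hat q_N\,\widetilde D_{-r}=\widetilde D_{-r}\,\hat q_1\cdots\hat q_N$ for all $0\le r\le N$; in particular this holds for $\widetilde D_{N-1}$ and $\widetilde D_{-1}$. Moreover $$\widetilde D_{-1}=\sum_{i=1}^N A_{-\{i\}}\ \check R_{(N,N-1,\dots,i)}^{-1}\ \hat q_i^{-1}\ \check R_{(N,N-1,\dots,i)} ,$$ and, more generally, for $0\le r\le N$, $$\widetilde D_{-r}=\sum_{\#I=r}A_{-I}\ \check R_{w_I^{-1}}^{-1}\ \hat q_I^{-1}\ \check R_{w_I^{-1}} .$$ -/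

import Mathlib

/-!
Conventions. There are `N = n + 1 ≥ 1` particles, labelled by `Fin (n + 1)`; the simple
transpositions `s_i = (i, i+1)` and the Hecke generators are labelled by `i : Fin n`, the two sites
being `i.castSucc` and `i.succ`.  The deformation parameter is `κ = t^{1/2}` (so `t = κ ^ 2`), and
`q` is the shift parameter; both are arbitrary nonzero complex numbers.
-/

noncomputable section

namespace SpinRuijsenaars

/-- The polynomial ring `ℂ[z₁, …, z_N]`. -/
abbrev Poly (n : ℕ) : Type := MvPolynomial (Fin (n + 1)) ℂ

/-- The field `ℂ(z₁, …, z_N)` of rational functions. -/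
abbrev RatFn (n : ℕ) : Type := FractionRing (Poly n)

/-- The coordinate `z_i` as a rational function. -/
def z {n : ℕ} (i : Fin (n + 1)) : RatFn n := algebraMap (Poly n) (RatFn n) (MvPolynomial.X i)

/-- A complex number as a constant rational function. -/
def cst (n : ℕ) (c : ℂ) : RatFn n := algebraMap ℂ (RatFn n) c

/-- The space `(ℂ²)^{⊗N} ⊗ ℂ(z₁, …, z_N)`, in coordinates: a vector `Ψ` is given by its components
`Ψ σ` along the basis kets `|σ₁ ⋯ σ_N⟩`, where the values `0, 1` of a spin stand for `↑, ↓`. -/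
abbrev Vec (n : ℕ) : Type := (Fin (n + 1) → Fin 2) → RatFn n

/-- Invertible operators on `Vec n`, a group under composition. -/
abbrev GLVec (n : ℕ) : Type := Vec n ≃ₗ[ℂ] Vec n

/-- An invertible operator viewed as an endomorphism. -/
def GLVec.toEnd {n : ℕ} (g : GLVec n) : Module.End ℂ (Vec n) := g.toLinearMap

/-- The space of polynomial vectors `(ℂ²)^{⊗N} ⊗ ℂ[z₁, …, z_N]`. -/
def polyVec (n : ℕ) : Submodule ℂ (Vec n) where
  carrier := {Ψ | ∀ σ, ∃ p : Poly n, algebraMap (Poly n) (RatFn n) p = Ψ σ}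
  zero_mem' σ := ⟨0, map_zero _⟩
  add_mem' {Ψ Φ} hΨ hΦ σ := by
    obtain ⟨p, hp⟩ := hΨ σ
    obtain ⟨r, hr⟩ := hΦ σ
    exact ⟨p + r, by rw [map_add, hp, hr, Pi.add_apply]⟩
  smul_mem' c Ψ hΨ σ := by
    obtain ⟨p, hp⟩ := hΨ σ
    refine ⟨c • p, ?_⟩
    rw [Pi.smul_apply, ← hp, Algebra.smul_def, Algebra.smul_def, map_mul,
      ← IsScalarTower.algebraMap_apply]

/-! ### Substitutions of the coordinates -/

/-- The substitution `F(z) ↦ F(c₁ z_{w(1)}, …, c_N z_{w(N)})` on polynomials. -/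
def substPoly {n : ℕ} (w : Equiv.Perm (Fin (n + 1))) (c : Fin (n + 1) → ℂˣ) : Poly n ≃ₐ[ℂ] Poly n :=
  AlgEquiv.ofAlgHom
    (MvPolynomial.aeval fun i => MvPolynomial.C (c i : ℂ) * MvPolynomial.X (w i))
    (MvPolynomial.aeval fun i =>
      MvPolynomial.C (((c (w⁻¹ i))⁻¹ : ℂˣ) : ℂ) * MvPolynomial.X (w⁻¹ i))
    (by
      ext i
      simp [MvPolynomial.algHom_C, MvPolynomial.algebraMap_eq, ← mul_assoc, ← MvPolynomial.C_mul])
    (by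
      ext i
      simp [MvPolynomial.algHom_C, MvPolynomial.algebraMap_eq, ← mul_assoc, ← MvPolynomial.C_mul])

/-- The same substitution on rational functions. -/
def substRat {n : ℕ} (w : Equiv.Perm (Fin (n + 1))) (c : Fin (n + 1) → ℂˣ) : RatFn n ≃ₐ[ℂ] RatFn n :=
  IsFractionRing.fieldEquivOfAlgEquiv ℂ (RatFn n) (RatFn n) (substPoly w c)

/-- The same substitution on vectors, acting trivially on the spins. -/
def subst {n : ℕ} (w : Equiv.Perm (Fin (n + 1))) (c : Fin (n + 1) → ℂˣ) : GLVec n :=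
  LinearEquiv.piCongrRight fun _ => (substRat w c).toLinearEquiv

/-- The permutation `(s_w F)(z₁, …, z_N) = F(z_{w(1)}, …, z_{w(N)})` of the coordinates. -/
def perm {n : ℕ} (w : Equiv.Perm (Fin (n + 1))) : GLVec n := subst w 1

/-- The shift `q̂_J = ∏_{j ∈ J} q̂_j`, that is `z_j ↦ q z_j` for all `j ∈ J`. -/
def qShift {n : ℕ} (q : ℂˣ) (J : Finset (Fin (n + 1))) : GLVec n :=
  subst 1 fun j => if j ∈ J then q else 1

/-- The twisted cyclic shift `(π F)(z₁, …, z_N) = F(q z_N, z₁, …, z_{N-1})`. -/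
def piOp {n : ℕ} (q : ℂˣ) : GLVec n :=
  subst (finRotate (n + 1))⁻¹ fun j => if j = 0 then q else 1

/-- The simple transposition `s_i = (i, i+1)`. -/
def simple {n : ℕ} (i : Fin n) : Equiv.Perm (Fin (n + 1)) := Equiv.swap i.castSucc i.succ

/-- Multiplication by a rational function. -/
def mulOp {n : ℕ} (c : RatFn n) : Module.End ℂ (Vec n) := Algebra.lsmul ℂ ℂ (Vec n) c

/-! ### Auxiliary facts on coordinates -/

theorem z_ne_zero {n : ℕ} (i : Fin (n + 1)) : z i ≠ 0 := by
  simp [z]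

/-- For distinct `i, j` no nonzero multiple of `z_i` is a multiple of `z_j`. -/
theorem lin_ne_zero {n : ℕ} (c d : ℂ) (hd : d ≠ 0) {i j : Fin (n + 1)} (h : i ≠ j) :
    cst n c * z i - cst n d * z j ≠ 0 := by
  have key : (MvPolynomial.C c * MvPolynomial.X i - MvPolynomial.C d * MvPolynomial.X j : Poly n)
      ≠ 0 := by
    intro h0
    have := congrArg (MvPolynomial.eval fun k => if k = j then (1 : ℂ) else 0) h0
    simp [h, hd] at this
  intro h0
  apply key
  apply IsFractionRing.injective (Poly n) (RatFn n)
  rw [map_zero, ← h0, map_sub, map_mul, map_mul]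
  simp only [cst, z, IsScalarTower.algebraMap_apply ℂ (Poly n) (RatFn n),
    MvPolynomial.algebraMap_eq]

theorem cst_ne_zero {n : ℕ} {c : ℂ} (hc : c ≠ 0) : cst n c ≠ 0 := by
  simpa [cst] using hc

/-! ### The polynomial action of the affine Hecke algebra -/

/-- The divided difference `∂_i = (z_i - z_{i+1})⁻¹ (1 - s_i)`. -/
def divDiff {n : ℕ} (i : Fin n) : Module.End ℂ (Vec n) :=
  mulOp (z i.castSucc - z i.succ)⁻¹ * (1 - (perm (simple i)).toEnd)

/-- The Demazure–Lusztig operator `-t^{-1/2} (t z_i - z_{i+1}) ∂_i + t^{1/2}`. -/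
def TPolEnd {n : ℕ} (κ : ℂˣ) (i : Fin n) : Module.End ℂ (Vec n) :=
  -(mulOp (cst n ((κ : ℂ)⁻¹) * (cst n ((κ : ℂ) ^ 2) * z i.castSucc - z i.succ)) * divDiff i)
    + (κ : ℂ) • 1


theorem substRat_z {n : ℕ} (w : Equiv.Perm (Fin (n + 1))) (c : Fin (n + 1) → ℂˣ)
    (i : Fin (n + 1)) : substRat w c (z i) = cst n (c i) * z (w i) := by
  rw [substRat, z, IsFractionRing.fieldEquivOfAlgEquiv_algebraMap]
  have h : substPoly w c (MvPolynomial.X i) = MvPolynomial.C (c i : ℂ) * MvPolynomial.X (w i) :=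
    MvPolynomial.aeval_X _ i
  rw [h, map_mul, cst, z, IsScalarTower.algebraMap_apply ℂ (Poly n) (RatFn n),
    MvPolynomial.algebraMap_eq]

theorem substRat_cst {n : ℕ} (w : Equiv.Perm (Fin (n + 1))) (c : Fin (n + 1) → ℂˣ)
    (a : ℂ) : substRat w c (cst n a) = cst n a := by
  rw [cst]
  exact (substRat w c).commutes a

theorem TPolEnd_apply {n : ℕ} (κ : ℂˣ) (i : Fin n) (Ψ : Vec n) (σ : Fin (n + 1) → Fin 2) :
    TPolEnd κ i Ψ σ =
      -(cst n ((κ : ℂ)⁻¹) * (cst n ((κ : ℂ) ^ 2) * z i.castSucc - z i.succ) *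
        ((z i.castSucc - z i.succ)⁻¹ * (Ψ σ - substRat (simple i) 1 (Ψ σ))))
        + cst n κ * Ψ σ := by
  have h : TPolEnd κ i Ψ σ =
      -(cst n ((κ : ℂ)⁻¹) * (cst n ((κ : ℂ) ^ 2) * z i.castSucc - z i.succ) *
        ((z i.castSucc - z i.succ)⁻¹ * (Ψ σ - substRat (simple i) 1 (Ψ σ))))
        + (κ : ℂ) • Ψ σ := rfl
  rw [h, Algebra.smul_def]
  rfl

theorem substRat_simple_twice {n : ℕ} (i : Fin n) (F : RatFn n) :
    substRat (simple i) 1 (substRat (simple i) 1 F) = F := by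
  have h : (substPoly (simple i) 1).trans (substPoly (simple i) 1) = AlgEquiv.refl := by
    apply AlgEquiv.coe_toAlgHom_injective
    ext j
    simp [substPoly, simple]
  have := IsFractionRing.fieldEquivOfAlgEquiv_trans ℂ (RatFn n) (RatFn n) (RatFn n)
    (substPoly (simple i) 1) (substPoly (simple i) 1)
  rw [h, IsFractionRing.fieldEquivOfAlgEquiv_refl] at this
  exact (DFunLike.congr_fun this F).symm

/-- The Hecke condition `(T_i - t^{1/2}) (T_i + t^{-1/2}) = 0`. -/
theorem TPolEnd_hecke {n : ℕ} (κ : ℂˣ) (i : Fin n) :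
    TPolEnd κ i * TPolEnd κ i = ((κ : ℂ) - (κ : ℂ)⁻¹) • TPolEnd κ i + 1 := by
  refine LinearMap.ext fun Ψ => funext fun σ => ?_
  have hd : z i.castSucc - z i.succ ≠ (0 : RatFn n) := by
    simpa [cst] using lin_ne_zero (n := n) 1 1 one_ne_zero (Fin.castSucc_lt_succ (i := i)).ne
  have hd' : z i.succ - z i.castSucc ≠ (0 : RatFn n) := by
    rw [← neg_sub]; exact neg_ne_zero.mpr hd
  have hk : cst n κ ≠ 0 := cst_ne_zero κ.ne_zero
  have e1 : cst n ((κ : ℂ)⁻¹) = (cst n κ)⁻¹ := by simp [cst]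
  have e2 : cst n ((κ : ℂ) ^ 2) = (cst n κ) ^ 2 := by simp [cst]
  have e3 : cst n ((κ : ℂ) - (κ : ℂ)⁻¹) = cst n κ - (cst n κ)⁻¹ := by simp [cst]
  have s1 : substRat (simple i) 1 (z i.castSucc) = z i.succ := by
    rw [substRat_z]; simp [cst, simple]
  have s2 : substRat (simple i) 1 (z i.succ) = z i.castSucc := by
    rw [substRat_z]; simp [cst, simple]
  have s3 := substRat_simple_twice i (Ψ σ)
  have s4 := substRat_cst (simple i) 1 (κ : ℂ)
  have rhs : ((((κ : ℂ) - (κ : ℂ)⁻¹) • TPolEnd κ i + 1 : Module.End ℂ (Vec n)) Ψ) σ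
      = (cst n κ - (cst n κ)⁻¹) * TPolEnd κ i Ψ σ + Ψ σ := by
    rw [← e3, cst, ← Algebra.smul_def]
    rfl
  rw [rhs, Module.End.mul_apply, TPolEnd_apply, TPolEnd_apply, e1, e2]
  simp only [map_add, map_sub, map_mul, map_neg, map_inv₀, map_pow, s1, s2, s3, s4]
  generalize substRat (simple i) 1 (Ψ σ) = G
  generalize Ψ σ = F
  generalize cst n (κ : ℂ) = k at *
  generalize (z i.castSucc : RatFn n) = x at *
  generalize (z i.succ : RatFn n) = y at *
  have hxy : y - x = -(x - y) := by ring
  rw [hxy]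
  field_simp
  ring

/-- The generator `T_i^pol` of the polynomial Hecke action; its inverse is
`T_i - (t^{1/2} - t^{-1/2})`. -/
def TPol {n : ℕ} (κ : ℂˣ) (i : Fin n) : GLVec n :=
  LinearEquiv.ofLinearMap (TPolEnd κ i) (TPolEnd κ i - ((κ : ℂ) - (κ : ℂ)⁻¹) • 1)
    (by
      change TPolEnd κ i * (TPolEnd κ i - ((κ : ℂ) - (κ : ℂ)⁻¹) • 1) = 1
      rw [mul_sub, TPolEnd_hecke]; simp)
    (by
      change (TPolEnd κ i - ((κ : ℂ) - (κ : ℂ)⁻¹) • 1) * TPolEnd κ i = 1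
      rw [sub_mul, TPolEnd_hecke]; simp)

/-- The `q`-deformed Dunkl operator
`Y_i = T_i ⋯ T_{N-1} π T_1⁻¹ ⋯ T_{i-1}⁻¹` (with `T = T^pol`). -/
def Y {n : ℕ} (κ q : ℂˣ) (i : Fin (n + 1)) : GLVec n :=
  (((List.finRange n).filter fun k => i ≤ k.castSucc).map (TPol κ)).prod * piOp q *
    (((List.finRange n).filter fun k => k.castSucc < i).map fun k => (TPol κ k)⁻¹).prod

/-- The operator `e_r(Y) = ∑_{i₁ < ⋯ < i_r} Y_{i₁} ⋯ Y_{i_r}`, for a family of invertible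
operators. -/
def elemSymm {n : ℕ} (X : Fin (n + 1) → GLVec n) (r : ℕ) : Module.End ℂ (Vec n) :=
  ∑ J ∈ Finset.powersetCard r Finset.univ, ((J.sort (· ≤ ·)).map X).prod.toEnd

/-- The operators `D̃_r = e_r(Y₁, …, Y_N)` and `D̃_{-r} = e_r(Y₁⁻¹, …, Y_N⁻¹)` for `r ≥ 0`. -/
def spinMacdonald {n : ℕ} (κ q : ℂˣ) : ℤ → Module.End ℂ (Vec n)
  | Int.ofNat r => elemSymm (Y κ q) r
  | Int.negSucc r => elemSymm (fun i => (Y κ q i)⁻¹) (r + 1)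

/-! ### The spin side -/

/-- The ordering `↑↑, ↑↓, ↓↑, ↓↓` of the standard basis of `ℂ² ⊗ ℂ²`. -/
def pairIdx : Fin 2 × Fin 2 ≃ Fin 4 := finProdFinEquiv

/-- The operator `id^{⊗(i-1)} ⊗ M ⊗ id^{⊗(N-i-1)}`, where the `4 × 4` matrix `M` (whose entries may be
rational functions) acts on the spins at the sites `i, i+1`. -/
def pairOp {n : ℕ} (i : Fin n) (M : Matrix (Fin 4) (Fin 4) (RatFn n)) : Module.End ℂ (Vec n) where
  toFun Ψ σ := ∑ τ : Fin 2 × Fin 2, M (pairIdx (σ i.castSucc, σ i.succ)) (pairIdx τ) *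
    Ψ (Function.update (Function.update σ i.castSucc τ.1) i.succ τ.2)
  map_add' Ψ Φ := by
    funext σ
    simp [mul_add, Finset.sum_add_distrib]
  map_smul' c Ψ := by
    funext σ
    simp [Finset.smul_sum]

/-- The generator `T_i^sp` of the spin representation of the Hecke algebra. -/
def TSp {n : ℕ} (κ : ℂˣ) (i : Fin n) : Module.End ℂ (Vec n) :=
  pairOp i
    !![cst n κ, 0, 0, 0;
       0, cst n κ - (cst n κ)⁻¹, 1, 0;
       0, 1, 0, 0;
       0, 0, 0, cst n κ]

/-- The physical space: the polynomial vectors on which the spin and the polynomial actions of all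
the Hecke generators coincide. -/
def physical {n : ℕ} (κ : ℂˣ) : Submodule ℂ (Vec n) :=
  polyVec n ⊓ ⨅ i : Fin n, LinearMap.ker (TSp κ i - (TPol κ i).toEnd)

/-- `f(u) = (u - 1) / (t^{1/2} u - t^{-1/2})`. -/
def fFun {n : ℕ} (κ : ℂˣ) (u : RatFn n) : RatFn n := (u - 1) / (cst n κ * u - (cst n κ)⁻¹)

/-- `g(u) = (t^{1/2} - t^{-1/2}) / (t^{1/2} u - t^{-1/2})`. -/
def gFun {n : ℕ} (κ : ℂˣ) (u : RatFn n) : RatFn n :=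
  (cst n κ - (cst n κ)⁻¹) / (cst n κ * u - (cst n κ)⁻¹)

/-- The `R`-matrix `Ř(u)`. -/
def RMat {n : ℕ} (κ : ℂˣ) (u : RatFn n) : Matrix (Fin 4) (Fin 4) (RatFn n) :=
  !![1, 0, 0, 0;
     0, u * gFun κ u, fFun κ u, 0;
     0, fFun κ u, gFun κ u, 0;
     0, 0, 0, 1]

theorem pairOp_one {n : ℕ} (i : Fin n) : pairOp i (1 : Matrix (Fin 4) (Fin 4) (RatFn n)) = 1 := by
  refine LinearMap.ext fun Ψ => funext fun σ => ?_
  simp [pairOp, Matrix.one_apply]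

theorem pairOp_mul {n : ℕ} (i : Fin n) (A B : Matrix (Fin 4) (Fin 4) (RatFn n)) :
    pairOp i (A * B) = pairOp i A * pairOp i B := by
  have hne : i.castSucc ≠ i.succ := (Fin.castSucc_lt_succ (i := i)).ne
  refine LinearMap.ext fun Ψ => funext fun σ => ?_
  have upd : ∀ a b c d, Function.update (Function.update (Function.update (Function.update σ
      i.castSucc a) i.succ b) i.castSucc c) i.succ d
      = Function.update (Function.update σ i.castSucc c) i.succ d := by
    intro a b c d
    funext k
    by_cases h1 : k = i.succ
    · subst h1; simp
    · by_cases h2 : k = i.castSucc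
      · subst h2; simp [hne]
      · simp [h1, h2]
  simp only [pairOp, Module.End.mul_apply, LinearMap.coe_mk, AddHom.coe_mk, upd,
    Function.update_self, Function.update_of_ne hne, Matrix.mul_apply, Finset.sum_mul,
    Finset.mul_sum]
  rw [Finset.sum_comm]
  rw [← Equiv.sum_comp pairIdx]
  simp only [mul_assoc]

theorem RMat_unitarity {n : ℕ} (κ : ℂˣ) {i j : Fin (n + 1)} (h : i ≠ j) :
    RMat κ (z i / z j : RatFn n) * RMat κ (z j / z i) = 1 := by
  have hk : cst n κ ≠ 0 := cst_ne_zero κ.ne_zero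
  have hi : (z i : RatFn n) ≠ 0 := z_ne_zero i
  have hj : (z j : RatFn n) ≠ 0 := z_ne_zero j
  have e2 : cst n ((κ : ℂ) ^ 2) = (cst n κ) ^ 2 := by simp [cst]
  have e1 : cst n 1 = 1 := by simp [cst]
  have h1 : cst n κ ^ 2 * z i - z j ≠ 0 := by
    have := lin_ne_zero (n := n) ((κ : ℂ) ^ 2) 1 one_ne_zero h
    rwa [e2, e1, one_mul] at this
  have h2 : cst n κ ^ 2 * z j - z i ≠ 0 := by
    have := lin_ne_zero (n := n) ((κ : ℂ) ^ 2) 1 one_ne_zero h.symm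
    rwa [e2, e1, one_mul] at this
  have d1 : cst n κ * (z i / z j) - (cst n κ)⁻¹ = (cst n κ ^ 2 * z i - z j) / (cst n κ * z j) := by
    field_simp
  have d2 : cst n κ * (z j / z i) - (cst n κ)⁻¹ = (cst n κ ^ 2 * z j - z i) / (cst n κ * z i) := by
    field_simp
  unfold RMat fFun gFun
  rw [d1, d2]
  generalize cst n (κ : ℂ) = k at *
  generalize (z i : RatFn n) = x at *
  generalize (z j : RatFn n) = y at *
  clear d1 d2
  rw [mul_comm] at h1 h2
  ext a b
  fin_cases a <;> fin_cases b <;>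
    simp [Matrix.mul_apply, Fin.sum_univ_four] <;> field_simp <;> ring

/-- The operator `Ř_{i,i+1}(z_i / z_{i+1})`; its inverse is `Ř_{i,i+1}(z_{i+1} / z_i)`. -/
def RGen {n : ℕ} (κ : ℂˣ) (i : Fin n) : GLVec n :=
  LinearEquiv.ofLinearMap (pairOp i (RMat κ (z i.castSucc / z i.succ)))
    (pairOp i (RMat κ (z i.succ / z i.castSucc)))
    (by
      change pairOp i _ * pairOp i _ = 1
      rw [← pairOp_mul, RMat_unitarity κ (Fin.castSucc_lt_succ (i := i)).ne, pairOp_one])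
    (by
      change pairOp i _ * pairOp i _ = 1
      rw [← pairOp_mul, RMat_unitarity κ (Fin.castSucc_lt_succ (i := i)).ne', pairOp_one])

/-- `s_i^tot = s_i Ř_{i,i+1}(z_i / z_{i+1})`. -/
def sTotGen {n : ℕ} (κ : ℂˣ) (i : Fin n) : GLVec n := perm (simple i) * RGen κ i

/-- `l = [i₁, …, i_k]` is a reduced decomposition `w = s_{i₁} ⋯ s_{i_k}`. -/
def IsReducedWord {n : ℕ} (w : Equiv.Perm (Fin (n + 1))) (l : List (Fin n)) : Prop :=
  (l.map simple).prod = w ∧ ∀ l' : List (Fin n), (l'.map simple).prod = w → l.length ≤ l'.length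

theorem exists_isReducedWord {n : ℕ} (w : Equiv.Perm (Fin (n + 1))) :
    ∃ l : List (Fin n), IsReducedWord w l := by
  have h : ∃ l : List (Fin n), (l.map simple).prod = w := by
    have hw : w ∈ Submonoid.closure
        (Set.range fun i : Fin n => Equiv.swap i.castSucc i.succ) := by
      rw [Equiv.Perm.mclosure_swap_castSucc_succ]; trivial
    induction hw using Submonoid.closure_induction with
    | mem x hx => obtain ⟨i, rfl⟩ := hx; exact ⟨[i], by simp [simple]⟩
    | one => exact ⟨[], rfl⟩
    | mul x y _ _ hx hy =>
      obtain ⟨l, hl⟩ := hx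
      obtain ⟨m, hm⟩ := hy
      exact ⟨l ++ m, by simp [hl, hm]⟩
  exact exists_minimalFor_of_wellFoundedLT _ List.length h |>.imp fun l hl =>
    ⟨hl.prop, fun l' hl' => by
      by_contra! hlt
      exact absurd (hl.le_of_le hl' hlt.le) (not_le.mpr hlt)⟩

/-- A reduced decomposition of `w`. -/
def reducedWord {n : ℕ} (w : Equiv.Perm (Fin (n + 1))) : List (Fin n) :=
  (exists_isReducedWord w).choose

/-- The operator `s^tot_w = s^tot_{i₁} ⋯ s^tot_{i_k}` for a reduced decomposition
`w = s_{i₁} ⋯ s_{i_k}`. -/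
def sTot {n : ℕ} (κ : ℂˣ) (w : Equiv.Perm (Fin (n + 1))) : GLVec n :=
  ((reducedWord w).map (sTotGen κ)).prod

/-- `Ř_w = s_{w⁻¹} s^tot_w`. -/
def RCheck {n : ℕ} (κ : ℂˣ) (w : Equiv.Perm (Fin (n + 1))) : GLVec n := perm (w⁻¹) * sTot κ w

/-! ### The ingredients of the explicit formulas -/

/-- `a_{ij} = a(z_i / z_j)` with `a(u) = t^{-1/2} (t u - 1) / (u - 1)`. -/
def aCoeff {n : ℕ} (κ : ℂˣ) (i j : Fin (n + 1)) : RatFn n :=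
  (cst n κ)⁻¹ * (cst n κ ^ 2 * (z i / z j) - 1) / (z i / z j - 1)

/-- `A_J = ∏_{j ∈ J, k ∉ J} a_{jk}`. -/
def ACoeff {n : ℕ} (κ : ℂˣ) (J : Finset (Fin (n + 1))) : RatFn n :=
  ∏ j ∈ J, ∏ k ∈ Jᶜ, aCoeff κ j k

/-- `A_{-I} = ∏_{i ∈ I, k ∉ I} a_{ki}`. -/
def ACoeffNeg {n : ℕ} (κ : ℂˣ) (I : Finset (Fin (n + 1))) : RatFn n :=
  ∏ i ∈ I, ∏ k ∈ Iᶜ, aCoeff κ k i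

/-- The descending cycle `(j, j-1, …, i)` for `i ≤ j`, mapping `i ↦ j` and `k ↦ k - 1` for
`i < k ≤ j`. -/
def descCycle {n : ℕ} (j i : Fin (n + 1)) : Equiv.Perm (Fin (n + 1)) := (Fin.cycleIcc i j)⁻¹

/-- For `J = {j₁ < ⋯ < j_r}` the Grassmannian permutation
`{j₁, …, j_r} = (j₁, j₁-1, …, 1) ⋯ (j_r, j_r-1, …, r)`, which is the shortest permutation with
`m ↦ j_m` for `1 ≤ m ≤ r`. -/
def grass {n : ℕ} (J : Finset (Fin (n + 1))) : Equiv.Perm (Fin (n + 1)) :=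
  (List.ofFn fun m : Fin J.card =>
    descCycle (J.orderEmbOfFin rfl m) (m.castLE (by simpa using J.card_le_univ))).prod

/-- For `I = {i₁ < ⋯ < i_r}` the permutation
`(i_r, i_r+1, …, N) ⋯ (i₁, i₁+1, …, N-r+1)`, which is the shortest permutation with
`N - r + m ↦ i_m` for `1 ≤ m ≤ r`. -/
def grassNeg {n : ℕ} (I : Finset (Fin (n + 1))) : Equiv.Perm (Fin (n + 1)) :=
  (List.ofFn fun m : Fin I.card =>
    Fin.cycleIcc (I.orderEmbOfFin rfl m) ⟨n + 1 - I.card + m, by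
      have := I.card_le_univ; simp at this; omega⟩).reverse.prod

end SpinRuijsenaars

end

open SpinRuijsenaars

/-! The argument is carried out for all rational vectors satisfying the Hecke condition
(`IsInvariant`), not only polynomial ones, because the independence argument tests on
symmetrizations of arbitrary rational vectors. Since T_i^pol - T_i^sp = a_{i,i+1} (s_i - Ř_{i,i+1})
with a_{i,i+1} ≠ 0 (`TPol_sub_TSp`), the Hecke condition says exactly that s_i^tot fixes Ψ. The
s_i^tot are involutions satisfying the braid relations (the Yang–Baxter equation and commutation at
a distance), so the Coxeter presentation (`prod_eq_of_simple`) makes them a representation of the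
symmetric group.

The T_i^pol and π satisfy the affine braid relations (`isAffineBraid`), from which commutativity of
the Y_i is formal (`IsAffineBraid.commute_dunkl`). Symmetric functions of the Y_i commute with
T_i^pol, by Y_i = T_i Y_{i+1} T_i and the quadratic relation, and with T_i^sp, because operators on
the spins commute with operators on the coordinates. So they preserve invariance; they preserve
polynomials because z_i - z_{i+1} divides p - s_i p.

For the explicit formula, put D_I = s^tot_w q̂_{1,…,r} (s^tot_w)⁻¹ for any w carrying {1,…,r} to I.
This depends only on I (`dressedShift_eq`), is the Ř-conjugate of q̂_I (`RCheck_conj`), and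
satisfies s^tot_v D_I Ψ = D_{vI} Ψ on invariant Ψ. Hence combinations ∑ C_I D_I Ψ, with C_I linear
over the rational functions, are stable under T_i^pol (`TPol_evalC`), and π^r Ψ is one such term, at
the set of the last r labels. The braid relations bring Y_{j_1} ⋯ Y_{j_r} to the form (word in T)
π^r (product of T^{±1}) (`IsAffineBraid.prod_dunkl`); the right factor acts on Ψ as a spin operator
(`exists_isSpin`) and can be moved to the front. A letter lowers the sum of the labels of I by at
most one. Counting letters shows that {1,…,r} is reached only by Y_1 ⋯ Y_r, and there only through
the leading terms a s_i of all letters, whose product gives A_{1,…,r} (`rows_leading`).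

The other coefficients follow by symmetry. The D_I are independent by Dedekind's theorem on
characters (`coeffs_eq_zero`), and e_r(Y) preserves invariance, so the coefficients are equivariant
(`coeffs_smul`) and C_J = A_J. Independence requires q ≠ 1, but the coefficients do not involve q,
so they may be computed at a single convenient value.

Negative degrees reduce to positive ones: e_{N-r}(Y) = Y_1 ⋯ Y_N e_r(Y⁻¹), where Y_1 ⋯ Y_N = π^N =
q̂_1 ⋯ q̂_N commutes with everything relevant, and passing from J to its complement turns A_J into
A_{-I}. -/

noncomputable section

namespace SpinRuijsenaars

/-! ### Words in braid groups -/

section Braid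

variable {G : Type*} [Group G]

/-- The product `T_a T_{a+1} ⋯ T_{a+k-1}`. -/
def seg (T : ℕ → G) (a k : ℕ) : G := ((List.range' a k).map T).prod

/-- The braid relations among `T_0, …, T_{n-1}`. -/
structure IsBraid (T : ℕ → G) (n : ℕ) : Prop where
  braid : ∀ i, i + 1 < n → T i * T (i + 1) * T i = T (i + 1) * T i * T (i + 1)
  comm : ∀ i j, i + 2 ≤ j → j < n → Commute (T i) (T j)

@[simp] theorem seg_zero (T : ℕ → G) (a : ℕ) : seg T a 0 = 1 := rfl

theorem seg_succ (T : ℕ → G) (a k : ℕ) : seg T a (k + 1) = T a * seg T (a + 1) k := by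
  simp [seg, List.range'_succ]

theorem seg_succ' (T : ℕ → G) (a k : ℕ) : seg T a (k + 1) = seg T a k * T (a + k) := by
  simp [seg, List.range'_1_concat]

theorem seg_add (T : ℕ → G) (a k l : ℕ) : seg T a (k + l) = seg T a k * seg T (a + k) l := by
  induction l with
  | zero => simp
  | succ l ih => rw [← add_assoc, seg_succ', ih, seg_succ', mul_assoc, add_assoc]

theorem commute_seg {T : ℕ → G} {x : G} {a k : ℕ}
    (h : ∀ j, a ≤ j → j < a + k → Commute x (T j)) : Commute x (seg T a k) := by
  apply Commute.list_prod_right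
  intro y hy
  obtain ⟨j, hj, rfl⟩ := List.mem_map.mp hy
  rw [List.mem_range'_1] at hj
  exact h j hj.1 hj.2

/-- Conjugation by `x` shifting the letters shifts the segment. -/
theorem seg_conj {T : ℕ → G} {x : G} {a b k : ℕ} (h : ∀ j < k, x * T (a + j) = T (b + j) * x) :
    x * seg T a k = seg T b k * x := by
  induction k with
  | zero => simp
  | succ k ih =>
    rw [seg_succ', seg_succ', ← mul_assoc, ih fun j hj => h j (by omega), mul_assoc,
      h k (by omega), mul_assoc]

theorem seg_inv_conj {T : ℕ → G} {x : G} {a b k : ℕ}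
    (h : ∀ j < k, x * T (a + j) = T (b + j) * x) :
    x * seg (fun j => (T j)⁻¹) a k = seg (fun j => (T j)⁻¹) b k * x := by
  apply seg_conj
  intro j hj
  rw [eq_inv_mul_iff_mul_eq, ← mul_assoc, ← h j hj, mul_assoc, mul_inv_cancel, mul_one]

theorem IsBraid.comm_of_ne {T : ℕ → G} {n : ℕ} (h : IsBraid T n) {i j : ℕ} (hi : i < n)
    (hj : j < n) (hij : i + 1 ≠ j) (hji : j + 1 ≠ i) : Commute (T i) (T j) := by
  rcases lt_trichotomy i j with h1 | rfl | h1
  · exact h.comm i j (by omega) hj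
  · exact Commute.refl _
  · exact (h.comm j i (by omega) hi).symm

/-- Isolate the factors T_j T_{j+1} of the chain: T_j commutes with what lies to their right, one
braid relation turns it into T_{j+1}, and that commutes with what lies to their left. -/
theorem IsBraid.seg_shift {T : ℕ → G} {n : ℕ} (h : IsBraid T n) {a k j : ℕ} (hak : a + k ≤ n)
    (haj : a ≤ j) (hj : j + 1 < a + k) : seg T a k * T j = T (j + 1) * seg T a k := by
  obtain ⟨p, rfl⟩ := Nat.exists_eq_add_of_le haj
  obtain ⟨s, rfl⟩ : ∃ s, k = p + (s + 2) := ⟨k - p - 2, by omega⟩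
  rw [seg_add, seg_succ, seg_succ]
  have h1 : Commute (seg T (a + p + 1 + 1) s) (T (a + p)) :=
    (commute_seg fun j hj hj' => h.comm_of_ne (by omega) (by omega) (by omega) (by omega)).symm
  have h2 : Commute (T (a + p + 1)) (seg T a p) :=
    commute_seg fun j hj hj' => h.comm_of_ne (by omega) (by omega) (by omega) (by omega)
  calc _ = seg T a p * (T (a + p) * (T (a + p + 1) * (seg T (a + p + 1 + 1) s * T (a + p)))) := by
        simp only [mul_assoc]
    _ = seg T a p * ((T (a + p) * T (a + p + 1) * T (a + p)) * seg T (a + p + 1 + 1) s) := by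
        rw [h1.eq]; simp only [mul_assoc]
    _ = (seg T a p * T (a + p + 1)) * (T (a + p) * T (a + p + 1) * seg T (a + p + 1 + 1) s) := by
        rw [h.braid _ (by omega)]; simp only [mul_assoc]
    _ = _ := by rw [← h2.eq]; simp only [mul_assoc]

/-- In a quotient of the symmetric group on `0, …, m`, a word in `T_0, …, T_{m-1}` equals a chain
`T_k ⋯ T_{m-1}` followed by a word in `T_0, …, T_{m-2}`. -/
theorem IsBraid.exists_chain {T : ℕ → G} {n : ℕ} (h : IsBraid T n) (h2 : ∀ i < n, T i * T i = 1)
    {m : ℕ} (hm : m < n) (l : List ℕ) (hl : ∀ i ∈ l, i < m + 1) :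
    ∃ k ≤ m + 1, ∃ l' : List ℕ, (∀ i ∈ l', i < m) ∧
      (l.map T).prod = seg T k (m + 1 - k) * (l'.map T).prod := by
  induction l with
  | nil => exact ⟨m + 1, le_rfl, [], by simp, by simp⟩
  | cons i l ih =>
    obtain ⟨k, hk, l', hl', he⟩ := ih fun i hi => hl i (List.mem_cons_of_mem _ hi)
    have him : i < m + 1 := hl i List.mem_cons_self
    rw [List.map_cons, List.prod_cons, he, ← mul_assoc]
    -- A new letter i lengthens the chain when i + 1 = k, commutes past it when i + 1 < k, cancels
    -- its head when i = k, and for i > k passes through it as i - 1.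
    rcases lt_trichotomy i k with h1 | rfl | h1
    · by_cases h3 : i + 1 = k
      · subst h3
        refine ⟨i, by omega, l', hl', ?_⟩
        rw [show m + 1 - i = (m + 1 - (i + 1)) + 1 by omega, seg_succ]
      · refine ⟨k, hk, i :: l', ?_, ?_⟩
        · intro j hj
          rcases List.mem_cons.mp hj with rfl | hj
          · omega
          · exact hl' j hj
        · rw [List.map_cons, List.prod_cons, ← mul_assoc]
          congr 1
          exact commute_seg fun j hj hj' =>
            h.comm_of_ne (by omega) (by omega) (by omega) (by omega)
    · refine ⟨i + 1, by omega, l', hl', ?_⟩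
      rw [show m + 1 - i = (m + 1 - (i + 1)) + 1 by omega, seg_succ, ← mul_assoc (T i) (T i),
        h2 i (by omega), one_mul]
    · obtain ⟨i, rfl⟩ : ∃ j, i = j + 1 := ⟨i - 1, by omega⟩
      refine ⟨k, hk, i :: l', ?_, ?_⟩
      · intro j hj
        rcases List.mem_cons.mp hj with rfl | hj
        · omega
        · exact hl' j hj
      · rw [List.map_cons, List.prod_cons, ← mul_assoc,
          h.seg_shift (by omega) (by omega) (by omega)]

end Braid

/-! ### The affine braid group -/

section Affine

variable {G : Type*} [Group G]

/-- The relations between `T_0, …, T_{n-1}` and the rotation `p`. -/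
structure IsAffineBraid (T : ℕ → G) (p : G) (n : ℕ) : Prop extends IsBraid T n where
  shift : ∀ i, i + 1 < n → p * T (i + 1) = T i * p
  wrap : 1 ≤ n → p ^ 2 * T 0 = T (n - 1) * p ^ 2

/-- The element `T_i ⋯ T_{n-1} p T_0⁻¹ ⋯ T_{i-1}⁻¹`. -/
def dunkl (T : ℕ → G) (p : G) (n i : ℕ) : G :=
  seg T i (n - i) * p * seg (fun j => (T j)⁻¹) 0 i

variable {T : ℕ → G} {p : G} {n : ℕ}

theorem IsAffineBraid.pow_shift (h : IsAffineBraid T p n) {r i : ℕ} (hi : i + r < n) :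
    p ^ r * T (i + r) = T i * p ^ r := by
  induction r with
  | zero => simp
  | succ r ih =>
    rw [pow_succ, mul_assoc, ← add_assoc, h.shift (i + r) (by omega), ← mul_assoc, ih (by omega),
      mul_assoc]

/-- Conjugation by p rotates the affine Dynkin cycle, whose affine node has no letter here. Thus i
rotations bring T_i to T_0, two more jump over the affine node to T_{n-1}, and the remaining ones
shift down again. -/
theorem IsAffineBraid.pow_wrap (h : IsAffineBraid T p n) {r i : ℕ} (hi : i + 2 ≤ r)
    (hr : r ≤ n + 1) : p ^ r * T i = T (n + 1 + i - r) * p ^ r := by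
  obtain ⟨s, rfl⟩ := Nat.exists_eq_add_of_le hi
  have e1 := h.pow_shift (r := i) (i := 0) (by omega)
  have e2 := h.pow_shift (r := s) (i := n + 1 + i - (i + 2 + s)) (by omega)
  rw [show n + 1 + i - (i + 2 + s) + s = n - 1 by omega] at e2
  rw [zero_add] at e1
  rw [show i + 2 + s = s + 2 + i by omega, pow_add, mul_assoc, e1, pow_add,
    show s + 2 + i = i + 2 + s by omega]
  calc _ = p ^ s * (p ^ 2 * T 0) * p ^ i := by simp only [mul_assoc]
    _ = _ := by
      rw [h.wrap (by omega), ← mul_assoc, e2]; simp only [mul_assoc]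

theorem dunkl_eq (T : ℕ → G) (p : G) {n i : ℕ} (hi : i < n) :
    dunkl T p n i = T i * dunkl T p n (i + 1) * T i := by
  rw [dunkl, dunkl, show n - i = (n - (i + 1)) + 1 by omega, seg_succ, seg_succ']
  simp [mul_assoc]

/-- Moved from right to left, T_i commutes with the inverse letters, drops to T_{i-1} on crossing p,
and is raised back to T_i by the chain. -/
theorem IsAffineBraid.comm_dunkl_right (h : IsAffineBraid T p n) {i j : ℕ} (hj : j < i)
    (hi : i < n) : Commute (T i) (dunkl T p n j) := by
  obtain ⟨i, rfl⟩ : ∃ m, i = m + 1 := ⟨i - 1, by omega⟩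
  have h1 : Commute (T (i + 1)) (seg (fun j => (T j)⁻¹) 0 j) :=
    commute_seg fun m hm hm' =>
      (h.comm_of_ne (by omega) (by omega) (by omega) (by omega)).inv_right
  rw [commute_iff_eq, dunkl, mul_assoc _ _ (T (i + 1)), ← h1.eq]
  calc _ = T (i + 1) * seg T j (n - j) * p * seg (fun j => (T j)⁻¹) 0 j := by
        simp only [mul_assoc]
    _ = seg T j (n - j) * (p * T (i + 1)) * seg (fun j => (T j)⁻¹) 0 j := by
        rw [← h.seg_shift (by omega) (by omega) (by omega), h.shift i hi]; simp only [mul_assoc]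
    _ = _ := by simp only [mul_assoc]

theorem inv_seg_shift (h : IsBraid T n) {k j : ℕ} (hk : k ≤ n) (hj : j + 1 < k) :
    T (j + 1) * seg (fun j => (T j)⁻¹) 0 k = seg (fun j => (T j)⁻¹) 0 k * T j := by
  have h' : IsBraid (fun j => (T j)⁻¹) n := by
    refine ⟨fun i hi => ?_, fun i j hij hj => (h.comm i j hij hj).inv_inv⟩
    have := congrArg (·⁻¹) (h.braid i hi)
    simpa [mul_assoc] using this
  have := h'.seg_shift (a := 0) (k := k) (j := j) (by omega) (by omega) (by omega)
  rw [eq_inv_mul_iff_mul_eq, ← mul_assoc, mul_inv_eq_iff_eq_mul] at this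
  exact this

/-- Mirror image of `IsAffineBraid.comm_dunkl_right`: p raises the letter by one and the chain of
inverses lowers it again. -/
theorem IsAffineBraid.comm_dunkl_left (h : IsAffineBraid T p n) {i j : ℕ} (hj : i + 1 < j)
    (hi : j ≤ n) : Commute (T i) (dunkl T p n j) := by
  have h1 : Commute (T i) (seg T j (n - j)) :=
    commute_seg fun m hm hm' => h.comm_of_ne (by omega) (by omega) (by omega) (by omega)
  rw [commute_iff_eq, dunkl, ← mul_assoc, ← mul_assoc, h1.eq, mul_assoc _ (T i),
    ← h.shift i (by omega), ← mul_assoc, mul_assoc _ (T (i + 1)),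
    inv_seg_shift h.toIsBraid (by omega) (by omega)]
  simp only [mul_assoc]

/-- With c = T_0 ⋯ T_{n-1}, the shift property gives c (T_0 ⋯ T_{n-2}) = (T_1 ⋯ T_{n-1}) c; both
sides then reassemble into copies of c. This finite relation is the counterpart of `wrap` needed for
the last two Dunkl elements to commute. -/
theorem IsBraid.seg_sq (h : IsBraid T n) (hn : 1 ≤ n) :
    T 0 * (seg T 0 n * seg T 0 n) = seg T 0 n * seg T 0 n * T (n - 1) := by
  obtain ⟨n, rfl⟩ : ∃ m, n = m + 1 := ⟨n - 1, by omega⟩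
  have e : seg T 0 (n + 1) * seg T 0 n = seg T 1 n * seg T 0 (n + 1) := by
    apply seg_conj
    intro j hj
    rw [zero_add, h.seg_shift (by omega) (by omega) (by omega), add_comm]
  have e1 : seg T 0 (n + 1) = seg T 0 n * T n := by rw [seg_succ', zero_add]
  have e2 : seg T 0 (n + 1) = T 0 * seg T 1 n := by rw [seg_succ, zero_add]
  calc _ = T 0 * (seg T 0 (n + 1) * seg T 0 n * T n) := by rw [mul_assoc (seg T 0 _), ← e1]
    _ = _ := by rw [e, ← mul_assoc, ← mul_assoc, ← e2]; rfl

/-- Downward induction through Y_i = T_i Y_{i+1} T_i, since T_i commutes with the last element as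
long as it is not adjacent to it. The base case, the last two elements, is where `wrap` is used,
together with `IsBraid.seg_sq` for the inverse letters. -/
theorem IsAffineBraid.commute_dunkl_last (h : IsAffineBraid T p n) {i : ℕ} (hi : i < n) :
    Commute (dunkl T p n i) (dunkl T p n n) := by
  obtain ⟨n, rfl⟩ : ∃ m, n = m + 1 := ⟨n - 1, by omega⟩
  have hle : i ≤ n := by omega
  clear hi
  induction hle using Nat.decreasingInduction with
  | of_succ i hin ih =>
    rw [dunkl_eq T p (by omega)]
    have := h.comm_dunkl_left (i := i) (j := n + 1) (by omega) le_rfl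
    exact (this.mul_left ih).mul_left this
  | self =>
    set S := fun j => (T j)⁻¹ with hS
    have hB : IsBraid S (n + 1) := by
      refine ⟨fun i hi => ?_, fun i j hij hj => (h.comm i j hij hj).inv_inv⟩
      have := congrArg (·⁻¹) (h.braid i hi)
      simpa [mul_assoc] using this
    have hw := h.pow_wrap (r := 2) (i := 0) (by omega) (by omega)
    rw [show n + 1 + 1 + 0 - 2 = n by omega] at hw
    have hsq := hB.seg_sq (by omega)
    rw [Nat.add_sub_cancel] at hsq
    have hp : seg S 0 n * p = p * seg S 1 n := by
      symm
      apply seg_inv_conj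
      intro j hj
      rw [add_comm 1 j, zero_add, h.shift j (by omega)]
    have e2 : seg S 0 (n + 1) = S 0 * seg S 1 n := by rw [seg_succ, zero_add]
    have e1 : seg S 0 (n + 1) = seg S 0 n * S n := by rw [seg_succ', zero_add]
    have hST : S n * T n = 1 := by simp [hS]
    have hST0 : S 0 * T 0 = 1 := by simp [hS]
    have d1 : dunkl T p (n + 1) n = T n * p * seg S 0 n := by
      rw [dunkl, show n + 1 - n = 1 by omega, seg_succ, seg_zero, mul_one]
    have d2 : dunkl T p (n + 1) (n + 1) = p * seg S 0 (n + 1) := by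
      rw [dunkl, Nat.sub_self, seg_zero, one_mul]
    have e3 : seg S 1 n = T 0 * seg S 0 (n + 1) := by rw [e2]; simp [hS]
    have e4 : seg S 0 n = seg S 0 (n + 1) * T n := by rw [e1]; simp [hS]
    rw [d1, d2, commute_iff_eq]
    calc T n * p * seg S 0 n * (p * seg S 0 (n + 1))
        = T n * p * (seg S 0 n * p) * seg S 0 (n + 1) := by simp only [mul_assoc]
      _ = T n * p ^ 2 * (seg S 1 n * seg S 0 (n + 1)) := by
          rw [hp, pow_two]; simp only [mul_assoc]
      _ = p ^ 2 * T 0 * (T 0 * (seg S 0 (n + 1) * seg S 0 (n + 1))) := by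
          rw [hw, e3]; simp only [mul_assoc]
      _ = p ^ 2 * T 0 * (T 0 * (S 0 * (seg S 0 (n + 1) * seg S 0 (n + 1)) * T n)) := by
          rw [hsq, mul_assoc _ (S n), hST, mul_one]
      _ = p ^ 2 * (T 0 * seg S 0 (n + 1)) * (seg S 0 (n + 1) * T n) := by
          simp [hS, mul_assoc]
      _ = p * (seg S 0 n * p) * seg S 0 n := by
          rw [hp, ← e3, ← e4, pow_two]; simp only [mul_assoc]
      _ = p * seg S 0 (n + 1) * (T n * p * seg S 0 n) := by
          rw [e4]; simp only [mul_assoc]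

/-- A second downward induction, now on the larger index: for i < j both T_j and Y_{j+1} commute
with Y_i, hence so does Y_j = T_j Y_{j+1} T_j. -/
theorem IsAffineBraid.commute_dunkl (h : IsAffineBraid T p n) {i j : ℕ} (hi : i ≤ n)
    (hj : j ≤ n) : Commute (dunkl T p n i) (dunkl T p n j) := by
  have key : ∀ j ≤ n, ∀ i < j, Commute (dunkl T p n i) (dunkl T p n j) := by
    intro j hj
    induction hj using Nat.decreasingInduction with
    | self => exact fun i hi => h.commute_dunkl_last hi
    | of_succ j hj ih =>
      intro i hi
      rw [dunkl_eq T p hj]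
      have := (h.comm_dunkl_right (i := j) (j := i) hi hj).symm
      exact (this.mul_right (ih i (by omega))).mul_right this
  rcases lt_trichotomy i j with h1 | rfl | h1
  · exact key j hj i h1
  · exact Commute.refl _
  · exact (key i hi j h1).symm

/-! ### Ordered products of Dunkl elements. -/

/-- The word of the left factor of `Y_{j₁} ⋯ Y_{j_r}`. -/
def leftWord (n : ℕ) : List ℕ → List ℕ
  | [] => []
  | j :: l => leftWord n l ++ List.range' j (n - l.length - j)

/-- The right factor of `Y_{j₁} ⋯ Y_{j_r}`. -/
def rightFactor (T : ℕ → G) : List ℕ → G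
  | [] => 1
  | j :: l => seg T 0 l.length * seg (fun i => (T i)⁻¹) l.length j * rightFactor T l

theorem mem_leftWord {l : List ℕ} {m b : ℕ} (hb : ∀ j ∈ l, b ≤ j) (hm : m ∈ leftWord n l) :
    b ≤ m ∧ m < n := by
  induction l with
  | nil => simp [leftWord] at hm
  | cons j l ih =>
    rw [leftWord, List.mem_append, List.mem_range'_1] at hm
    rcases hm with hm | hm
    · exact ih (fun j hj => hb j (List.mem_cons_of_mem _ hj)) hm
    · have := hb j List.mem_cons_self
      omega

/-- The last r letters of the chain of Y_j wrap around through p^{r+1} and come out on the right as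
T_0 ⋯ T_{r-1}. This shortens the left word by r letters, and the exact length is what the later
weight count relies on. -/
theorem IsAffineBraid.dunkl_mul_pow (h : IsAffineBraid T p n) {j r : ℕ} (hj : j + r ≤ n) :
    dunkl T p n j * p ^ r =
      seg T j (n - r - j) * p ^ (r + 1) * (seg T 0 r * seg (fun i => (T i)⁻¹) r j) := by
  have e1 : p ^ r * seg (fun i => (T i)⁻¹) r j = seg (fun i => (T i)⁻¹) 0 j * p ^ r := by
    apply seg_inv_conj
    intro i hi
    rw [add_comm r i, zero_add, h.pow_shift (by omega)]
  have e2 : p ^ (r + 1) * seg T 0 r = seg T (n - r) r * p ^ (r + 1) := by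
    apply seg_conj
    intro i hi
    rw [zero_add, h.pow_wrap (by omega) (by omega)]
    congr 2
    omega
  rw [← mul_assoc, mul_assoc _ _ (seg T 0 r), e2, ← mul_assoc, show seg T j (n - r - j) *
    seg T (n - r) r = seg T j (n - j) by
      rw [show n - j = (n - r - j) + r by omega, seg_add]; congr 2; omega,
    dunkl, mul_assoc _ _ (p ^ r), ← e1, pow_succ']
  simp only [mul_assoc]

theorem length_add_le {n j : ℕ} {l : List ℕ} (hl : (j :: l).Pairwise (· < ·))
    (hn : ∀ i ∈ j :: l, i ≤ n) : j + l.length ≤ n := by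
  rw [List.pairwise_cons] at hl
  have hnd : l.Nodup := hl.2.imp fun h => h.ne
  have hsub : l.toFinset ⊆ Finset.Ioc j n := by
    intro x hx
    rw [List.mem_toFinset] at hx
    exact Finset.mem_Ioc.mpr ⟨hl.1 x hx, hn x (List.mem_cons_of_mem _ hx)⟩
  have := Finset.card_le_card hsub
  rw [List.toFinset_card_of_nodup hnd, Nat.card_Ioc] at this
  have := hn j List.mem_cons_self
  omega

/-- Every letter in the left word of the tail exceeds the head j, so Y_j commutes past that word and
meets the power of p, where `IsAffineBraid.dunkl_mul_pow` applies. -/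
theorem IsAffineBraid.prod_dunkl (h : IsAffineBraid T p n) (l : List ℕ)
    (hl : l.Pairwise (· < ·)) (hn : ∀ j ∈ l, j ≤ n) :
    (l.map (dunkl T p n)).prod =
      ((leftWord n l).map T).prod * p ^ l.length * rightFactor T l := by
  induction l with
  | nil => simp [leftWord, rightFactor]
  | cons j l ih =>
    have hlen := length_add_le hl hn
    rw [List.pairwise_cons] at hl
    have hc : Commute (dunkl T p n j) ((leftWord n l).map T).prod := by
      apply Commute.list_prod_right
      intro x hx
      obtain ⟨m, hm, rfl⟩ := List.mem_map.mp hx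
      have := mem_leftWord (b := j + 1) (fun i hi => hl.1 i hi) hm
      exact (h.comm_dunkl_right (by omega) this.2).symm
    rw [List.map_cons, List.prod_cons, ih hl.2 fun i hi => hn i (List.mem_cons_of_mem _ hi),
      ← mul_assoc, ← mul_assoc, hc.eq, mul_assoc _ _ (p ^ _), h.dunkl_mul_pow hlen]
    simp only [leftWord, rightFactor, List.map_append, List.prod_append, List.length_cons, seg,
      mul_assoc]

/-- The word of rows `[r-1, …, r+L-2], …, [0, …, L-1]`. -/
def rowsWord : ℕ → ℕ → List ℕ
  | 0, _ => []
  | r + 1, L => List.range' r L ++ rowsWord r L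

/-- The product of rows `(T_{r-1} ⋯ T_{r+L-2}) ⋯ (T_0 ⋯ T_{L-1})`. -/
def rows (T : ℕ → G) (r L : ℕ) : G := ((rowsWord r L).map T).prod

theorem rows_succ (T : ℕ → G) (r L : ℕ) : rows T (r + 1) L = seg T r L * rows T r L := by
  simp [rows, rowsWord, seg]

theorem mem_rowsWord {r L m : ℕ} (hm : m ∈ rowsWord r L) : m + 1 < r + L := by
  induction r with
  | zero => simp [rowsWord] at hm
  | succ r ih =>
    rw [rowsWord, List.mem_append, List.mem_range'_1] at hm
    rcases hm with hm | hm
    · omega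
    · have := ih hm; omega

theorem IsBraid.rows_shift (h : IsBraid T n) {r L j : ℕ} (hrL : r + L ≤ n) (hj : j < L) :
    rows T r (L + 1) * T j = T (j + r) * rows T r (L + 1) := by
  induction r with
  | zero => simp [rows, rowsWord]
  | succ r ih =>
    rw [rows_succ, mul_assoc, ih (by omega), ← mul_assoc, h.seg_shift (by omega) (by omega)
      (by omega), mul_assoc]
    rfl

/-- The inverse letters cancel the last letter of each row, the lowest row first; the inverse meant
for a row commutes with the already shortened rows below it. -/
theorem IsBraid.rows_col (h : IsBraid T n) {r L : ℕ} (hrL : r + L ≤ n) :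
    rows T r (L + 1) * seg (fun i => (T i)⁻¹) L r = rows T r L := by
  induction r with
  | zero => simp [rows, rowsWord]
  | succ r ih =>
    have hc : Commute (T (r + L)) (rows T r L) := by
      apply Commute.list_prod_right
      intro x hx
      obtain ⟨m, hm, rfl⟩ := List.mem_map.mp hx
      have := mem_rowsWord hm
      exact h.comm_of_ne (by omega) (by omega) (by omega) (by omega)
    rw [rows_succ, seg_succ' T r L, seg_succ' _ L r, add_comm L r]
    calc _ = seg T r L * T (r + L) * (rows T r (L + 1) * seg (fun i => (T i)⁻¹) L r)
          * (T (r + L))⁻¹ := by simp only [mul_assoc]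
      _ = seg T r L * (T (r + L) * rows T r L) * (T (r + L))⁻¹ := by
        rw [ih (by omega)]; simp only [mul_assoc]
      _ = _ := by rw [hc.eq, rows_succ]; simp [mul_assoc]

/-- For the first r labels no right factor remains. On multiplying by the next element, its chain
slides left through p^r and the old rows to become the new top row, while its inverse letters wrap
around p^{r+1} and delete the last column of the old rows. -/
theorem IsAffineBraid.prod_dunkl_range (h : IsAffineBraid T p n) {r : ℕ} (hr : r ≤ n + 1) :
    ((List.range r).map (dunkl T p n)).prod = rows T r (n + 1 - r) * p ^ r := by
  induction r with
  | zero => simp [rows, rowsWord]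
  | succ r ih =>
    have e1 : p ^ r * seg T r (n - r) = seg T 0 (n - r) * p ^ r := by
      apply seg_conj
      intro i hi
      rw [add_comm r i, zero_add, h.pow_shift (by omega)]
    have e2 : p ^ (r + 1) * seg (fun i => (T i)⁻¹) 0 r
        = seg (fun i => (T i)⁻¹) (n - r) r * p ^ (r + 1) := by
      apply seg_inv_conj
      intro i hi
      rw [zero_add, h.pow_wrap (by omega) (by omega)]
      congr 2
      omega
    have e3 : rows T r (n + 1 - r) * seg T 0 (n - r) = seg T r (n - r) * rows T r (n + 1 - r) := by
      apply seg_conj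
      intro i hi
      rw [show n + 1 - r = (n - r) + 1 by omega, zero_add,
        h.toIsBraid.rows_shift (by omega) hi, add_comm]
    have e4 := h.toIsBraid.rows_col (r := r) (L := n - r) (by omega)
    rw [List.range_succ, List.map_append, List.prod_append, ih (by omega), List.map_singleton,
      List.prod_singleton, dunkl]
    calc _ = rows T r (n + 1 - r) * (p ^ r * seg T r (n - r)) * p
          * seg (fun i => (T i)⁻¹) 0 r := by simp only [mul_assoc]
      _ = rows T r (n + 1 - r) * seg T 0 (n - r) * (p ^ (r + 1)
          * seg (fun i => (T i)⁻¹) 0 r) := by rw [e1, pow_succ]; simp only [mul_assoc]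
      _ = seg T r (n - r) * (rows T r (n - r + 1) * seg (fun i => (T i)⁻¹) (n - r) r)
          * p ^ (r + 1) := by
        rw [e2, e3, show n - r + 1 = n + 1 - r by omega]; simp only [mul_assoc]
      _ = _ := by rw [e4, ← rows_succ, show n + 1 - (r + 1) = n - r by omega]

end Affine

open scoped Pointwise

variable {n : ℕ}

/-! ### Substitutions -/

theorem ratFn_hom_ext {f g : RatFn n →ₐ[ℂ] RatFn n} (h : ∀ i, f (z i) = g (z i)) : f = g := by
  have h1 : f.comp (IsScalarTower.toAlgHom ℂ (Poly n) (RatFn n)) =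
      g.comp (IsScalarTower.toAlgHom ℂ (Poly n) (RatFn n)) := MvPolynomial.algHom_ext h
  have h2 : (f : RatFn n →+* RatFn n) = g :=
    IsLocalization.ringHom_ext (nonZeroDivisors (Poly n)) (RingHom.ext fun p => by
      simpa using DFunLike.congr_fun h1 p)
  exact AlgHom.ext fun x => RingHom.congr_fun h2 x

theorem substRat_substRat (w w' : Equiv.Perm (Fin (n + 1))) (c c' : Fin (n + 1) → ℂˣ)
    (F : RatFn n) :
    substRat w c (substRat w' c' F) = substRat (w * w') (fun i => c' i * c (w' i)) F := by
  have h := ratFn_hom_ext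
    (f := (substRat w c : RatFn n →ₐ[ℂ] RatFn n).comp (substRat w' c' : RatFn n →ₐ[ℂ] RatFn n))
    (g := (substRat (w * w') (fun i => c' i * c (w' i)) : RatFn n →ₐ[ℂ] RatFn n)) fun i => by
      simp [substRat_z, cst, mul_assoc]
  exact DFunLike.congr_fun h F

theorem substRat_one (F : RatFn n) : substRat 1 1 F = F := by
  have h := ratFn_hom_ext (f := (substRat (1 : Equiv.Perm (Fin (n + 1))) 1 : RatFn n →ₐ[ℂ] RatFn n)) (g := AlgHom.id ℂ _)
    fun i => by simp [substRat_z, cst]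
  exact DFunLike.congr_fun h F

theorem subst_apply (w : Equiv.Perm (Fin (n + 1))) (c : Fin (n + 1) → ℂˣ) (Ψ : Vec n)
    (σ : Fin (n + 1) → Fin 2) : subst w c Ψ σ = substRat w c (Ψ σ) := rfl

theorem subst_mul (w w' : Equiv.Perm (Fin (n + 1))) (c c' : Fin (n + 1) → ℂˣ) :
    subst w c * subst w' c' = subst (w * w') (fun i => c' i * c (w' i)) :=
  LinearEquiv.ext fun Ψ => funext fun σ => substRat_substRat w w' c c' (Ψ σ)

theorem subst_one : subst (1 : Equiv.Perm (Fin (n + 1))) 1 = 1 :=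
  LinearEquiv.ext fun Ψ => funext fun σ => substRat_one (Ψ σ)

theorem perm_mul (v w : Equiv.Perm (Fin (n + 1))) : perm (v * w) = perm v * perm w := by
  rw [perm, perm, perm, subst_mul]
  congr 1
  funext i
  simp

theorem perm_one : perm (1 : Equiv.Perm (Fin (n + 1))) = 1 := subst_one

theorem perm_inv (w : Equiv.Perm (Fin (n + 1))) : perm w⁻¹ = (perm w)⁻¹ := by
  rw [eq_inv_iff_mul_eq_one, ← perm_mul, inv_mul_cancel, perm_one]

/-! ### Simple transpositions and the Coxeter presentation. -/

theorem simple_castSucc (i : Fin n) : simple i i.castSucc = i.succ := Equiv.swap_apply_left _ _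

theorem simple_succ (i : Fin n) : simple i i.succ = i.castSucc := Equiv.swap_apply_right _ _

theorem simple_mul_self (i : Fin n) : simple i * simple i = 1 := Equiv.swap_mul_self _ _

theorem castSucc_ne_succ (i : Fin n) : i.castSucc ≠ i.succ := (Fin.castSucc_lt_succ (i := i)).ne

/-- A family indexed by `Fin n`, extended to `ℕ` by `1`. -/
def extendOne {G : Type*} [One G] (f : Fin n → G) (i : ℕ) : G := if h : i < n then f ⟨i, h⟩ else 1

theorem extendOne_of_lt {G : Type*} [One G] (f : Fin n → G) {i : ℕ} (h : i < n) :
    extendOne f i = f ⟨i, h⟩ := dif_pos h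

theorem extendOne_val {G : Type*} [One G] (f : Fin n → G) (i : Fin n) :
    extendOne f i = f i := dif_pos i.2

theorem isBraid_extendOne {G : Type*} [Group G] {f : Fin n → G}
    (hb : ∀ i j : Fin n, (i : ℕ) + 1 = j → f i * f j * f i = f j * f i * f j)
    (hc : ∀ i j : Fin n, (i : ℕ) + 2 ≤ j → Commute (f i) (f j)) : IsBraid (extendOne f) n where
  braid i hi := by
    rw [extendOne_of_lt f hi, extendOne_of_lt f (Nat.lt_of_succ_lt hi)]
    exact hb _ _ rfl
  comm i j hij hj := by
    rw [extendOne_of_lt f hj, extendOne_of_lt f (by omega)]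
    exact hc _ _ hij

theorem simple_braid {i j : Fin n} (h : (i : ℕ) + 1 = j) :
    simple i * simple j * simple i = simple j * simple i * simple j := by
  have e : i.succ = j.castSucc := Fin.ext (by simpa using h)
  have h1 : (i.castSucc : Fin (n + 1)) ≠ j.succ := by
    intro h'; have := congrArg Fin.val h'; simp at this; omega
  have h2 := castSucc_ne_succ i
  have h3 := castSucc_ne_succ j
  unfold simple
  rw [e] at h2 ⊢
  rw [Equiv.swap_mul_swap_mul_swap h2 h1, Equiv.swap_comm i.castSucc, Equiv.swap_comm _ j.succ,
    Equiv.swap_mul_swap_mul_swap h3.symm h1.symm, Equiv.swap_comm]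

theorem simple_comm {i j : Fin n} (h : (i : ℕ) + 2 ≤ j) : Commute (simple i) (simple j) := by
  apply Equiv.Perm.Disjoint.commute
  apply Equiv.Perm.disjoint_swap_swap
  simp [Fin.ext_iff]
  omega

theorem simple_of_ne {i : Fin n} {x : Fin (n + 1)} (h1 : x ≠ i.castSucc) (h2 : x ≠ i.succ) :
    simple i x = x := Equiv.swap_apply_of_ne_of_ne h1 h2

theorem simple_val (i : Fin n) (x : Fin (n + 1)) : ((simple i x : Fin (n + 1)) : ℕ) =
    if (x : ℕ) = i then (i : ℕ) + 1 else if (x : ℕ) = i + 1 then (i : ℕ) else x := by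
  by_cases h1 : x = i.castSucc
  · subst h1; simp [simple_castSucc]
  · by_cases h2 : x = i.succ
    · subst h2; simp [simple_succ]
    · rw [simple_of_ne h1 h2, if_neg fun h => h1 (Fin.ext (by simpa using h)),
        if_neg fun h => h2 (Fin.ext (by simpa using h))]

theorem extendOne_simple_val {i : ℕ} (hi : i < n) (x : Fin (n + 1)) :
    ((extendOne simple i x : Fin (n + 1)) : ℕ) =
    if (x : ℕ) = i then i + 1 else if (x : ℕ) = i + 1 then i else x := by
  rw [extendOne_of_lt _ hi, simple_val]

theorem isBraid_simple : IsBraid (extendOne (simple (n := n))) n :=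
  isBraid_extendOne (fun _ _ => simple_braid) fun _ _ => simple_comm

theorem seg_simple_val {a k : ℕ} (h : a + k ≤ n) (x : Fin (n + 1)) :
    ((seg (extendOne simple) a k x : Fin (n + 1)) : ℕ) =
      if (x : ℕ) = a + k then a else if a ≤ (x : ℕ) ∧ (x : ℕ) < a + k then x + 1 else x := by
  induction k generalizing a with
  | zero =>
    simp only [seg_zero, Equiv.Perm.one_apply]
    split_ifs <;> omega
  | succ k ih =>
    rw [seg_succ, Equiv.Perm.mul_apply, extendOne_simple_val (by omega), ih (by omega)]
    split_ifs <;> omega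

theorem word_simple_fix {l : List ℕ} {m : ℕ} (hl : ∀ i ∈ l, i < m)
    {x : Fin (n + 1)} (hx : m < x) : (l.map (extendOne simple)).prod x = x := by
  induction l with
  | nil => rfl
  | cons i l ih =>
    have := hl i List.mem_cons_self
    rw [List.map_cons, List.prod_cons, Equiv.Perm.mul_apply,
      ih fun i hi => hl i (List.mem_cons_of_mem _ hi)]
    apply Fin.ext
    rw [extendOne_simple_val (by omega), if_neg (by omega), if_neg (by omega)]

/-- The braid relations and the involutivity are a presentation of the symmetric group: a word with
trivial permutation has trivial product. -/
theorem prod_eq_one_of_simple {G : Type*} [Group G] {g : ℕ → G} (hg : IsBraid g n)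
    (h2 : ∀ i < n, g i * g i = 1) (m : ℕ) (hm : m ≤ n) (l : List ℕ) (hl : ∀ i ∈ l, i < m)
    (h1 : (l.map (extendOne (simple (n := n)))).prod = 1) : (l.map g).prod = 1 := by
  induction m generalizing l with
  | zero =>
    cases l with
    | nil => rfl
    | cons i l => exact absurd (hl i List.mem_cons_self) (by omega)
  | succ m ih =>
    -- The chain decomposition is applied in the product group, so that the same chain and the same
    -- shorter word serve for `G` and for the permutations.
    set Γ : ℕ → G × Equiv.Perm (Fin (n + 1)) := fun i => (g i, extendOne simple i) with hΓ
    have fst : ∀ l : List ℕ, (l.map Γ).prod.1 = (l.map g).prod := fun l => by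
      induction l with
      | nil => rfl
      | cons a l ih => rw [List.map_cons, List.map_cons, List.prod_cons, List.prod_cons, ← ih]; rfl
    have snd : ∀ l : List ℕ, (l.map Γ).prod.2 = (l.map (extendOne simple)).prod := fun l => by
      induction l with
      | nil => rfl
      | cons a l ih => rw [List.map_cons, List.map_cons, List.prod_cons, List.prod_cons, ← ih]; rfl
    have hB : IsBraid Γ n := ⟨fun i hi => Prod.ext (hg.braid i hi) (isBraid_simple.braid i hi),
      fun i j hij hj => Prod.ext (hg.comm i j hij hj).eq (isBraid_simple.comm i j hij hj).eq⟩
    have hI : ∀ i < n, Γ i * Γ i = 1 := fun i hi => Prod.ext (h2 i hi) (by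
      simp [hΓ, extendOne_of_lt _ hi, simple_mul_self])
    obtain ⟨k, hk, l', hl', he⟩ := hB.exists_chain hI (m := m) (by omega) l hl
    have he1 := congrArg Prod.fst he
    have he2 := congrArg Prod.snd he
    rw [Prod.snd_mul, seg, snd, snd, snd, h1] at he2
    rw [Prod.fst_mul, seg, fst, fst, fst] at he1
    -- The shorter word fixes m + 1 and the chain sends m + 1 to k; as the permutation is trivial,
    -- the chain is empty.
    have hkm : k = m + 1 := by
      have := congrArg (fun w : Equiv.Perm (Fin (n + 1)) => ((w ⟨m + 1, by omega⟩ : Fin _) : ℕ)) he2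
      simp only [Equiv.Perm.one_apply, Equiv.Perm.mul_apply] at this
      rw [word_simple_fix hl' (by simp)] at this
      have h3 := seg_simple_val (n := n) (a := k) (k := m + 1 - k) (by omega) ⟨m + 1, by omega⟩
      rw [seg] at h3
      rw [h3, if_pos (by simp; omega)] at this
      omega
    subst hkm
    simp only [Nat.sub_self, List.range'_zero, List.map_nil, List.prod_nil, one_mul] at he1 he2
    rw [he1]
    exact ih (by omega) l' hl' he2.symm

theorem map_extendOne_val {G : Type*} [One G] (f : Fin n → G) (l : List (Fin n)) :
    (l.map Fin.val).map (extendOne f) = l.map f := by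
  rw [List.map_map]
  exact List.map_congr_left fun i _ => extendOne_val f i

theorem exists_fin_word {l : List ℕ} (hl : ∀ i ∈ l, i < n) :
    ∃ l' : List (Fin n), l'.map Fin.val = l :=
  ⟨l.pmap Fin.mk hl, by simp [List.map_pmap]⟩

theorem prod_reverse_of_involutive {G : Type*} [Group G] {f : Fin n → G} (hf : ∀ i, f i * f i = 1)
    (l : List (Fin n)) : (l.reverse.map f).prod = ((l.map f).prod)⁻¹ := by
  rw [List.prod_inv_reverse, List.map_reverse, List.map_map]
  congr 2
  exact List.map_congr_left fun i _ => eq_inv_of_mul_eq_one_left (hf i)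

theorem prod_eq_of_simple {G : Type*} [Group G] {g : Fin n → G} (hg : IsBraid (extendOne g) n)
    (h2 : ∀ i, g i * g i = 1) {l l' : List (Fin n)}
    (h : (l.map simple).prod = (l'.map simple).prod) : (l.map g).prod = (l'.map g).prod := by
  have key := prod_eq_one_of_simple hg (fun i hi => by rw [extendOne_of_lt g hi, h2]) n le_rfl
    ((l ++ l'.reverse).map Fin.val) (fun i hi => by
      obtain ⟨j, -, rfl⟩ := List.mem_map.mp hi; exact j.2) (by
      rw [map_extendOne_val, List.map_append, List.prod_append,
        prod_reverse_of_involutive simple_mul_self, h, mul_inv_cancel])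
  rw [map_extendOne_val, List.map_append, List.prod_append, prod_reverse_of_involutive h2, mul_inv_eq_one] at key
  exact key

/-! ### The Demazure–Lusztig operators -/

theorem cst_sq (κ : ℂˣ) : cst n ((κ : ℂ) ^ 2) = cst n κ ^ 2 := by simp [cst]

theorem cst_inv (κ : ℂˣ) : cst n ((κ : ℂ)⁻¹) = (cst n κ)⁻¹ := by simp [cst]

theorem cst_unit_ne (κ : ℂˣ) : cst n κ ≠ 0 := cst_ne_zero κ.ne_zero

theorem z_sub_ne {i j : Fin (n + 1)} (h : i ≠ j) : (z i - z j : RatFn n) ≠ 0 := by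
  simpa [cst] using lin_ne_zero (n := n) 1 1 one_ne_zero h

theorem t_z_sub_ne (κ : ℂˣ) {i j : Fin (n + 1)} (h : i ≠ j) :
    (cst n κ ^ 2 * z i - z j : RatFn n) ≠ 0 := by
  have := lin_ne_zero (n := n) ((κ : ℂ) ^ 2) 1 one_ne_zero h
  simpa [cst] using this

theorem aCoeff_eq (κ : ℂˣ) {i j : Fin (n + 1)} (h : i ≠ j) :
    aCoeff κ i j = (cst n κ ^ 2 * z i - z j) / (cst n κ * (z i - z j)) := by
  have h1 := z_sub_ne h
  have h2 := z_ne_zero j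
  have h3 := cst_unit_ne (n := n) κ
  have h4 : (z i / z j - 1 : RatFn n) = (z i - z j) / z j := by field_simp
  rw [aCoeff, h4]
  field_simp

theorem aCoeff_ne (κ : ℂˣ) {i j : Fin (n + 1)} (h : i ≠ j) : aCoeff κ i j ≠ 0 := by
  rw [aCoeff_eq κ h]
  exact div_ne_zero (t_z_sub_ne κ h) (mul_ne_zero (cst_unit_ne κ) (z_sub_ne h))

theorem substRat_aCoeff (κ : ℂˣ) {w : Equiv.Perm (Fin (n + 1))} {c : Fin (n + 1) → ℂˣ}
    {i j : Fin (n + 1)} (hc : c i = c j) :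
    substRat w c (aCoeff κ i j) = aCoeff κ (w i) (w j) := by
  have h : substRat w c (z i / z j) = z (w i) / z (w j) := by
    rw [map_div₀, substRat_z, substRat_z, hc, mul_div_mul_left _ _ (cst_unit_ne _)]
  rw [aCoeff, aCoeff, map_div₀, map_sub, map_mul, map_sub, map_mul, h]
  simp [substRat_cst]

/-- Writing T_i = a s_i + (t^{1/2} - a) with a = a_{i,i+1} separates the leading term a s_i, which
moves labels, from the diagonal term; the expansion of e_r(Y) rests on this splitting. -/
theorem TPol_apply (κ : ℂˣ) (i : Fin n) (Ψ : Vec n) (σ : Fin (n + 1) → Fin 2) :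
    TPol κ i Ψ σ = aCoeff κ i.castSucc i.succ * substRat (simple i) 1 (Ψ σ)
      + (cst n κ - aCoeff κ i.castSucc i.succ) * Ψ σ := by
  change TPolEnd κ i Ψ σ = _
  have h1 := z_sub_ne (castSucc_ne_succ i)
  have h3 := cst_unit_ne (n := n) κ
  rw [TPolEnd_apply, aCoeff_eq κ (castSucc_ne_succ i), cst_sq, cst_inv]
  field_simp
  ring

/-- T_i involves only s_i and the ratio z_i / z_{i+1}, and a common scaling of the two coordinates
leaves the ratio unchanged. -/
theorem subst_mul_TPol (κ : ℂˣ) {w : Equiv.Perm (Fin (n + 1))} {c : Fin (n + 1) → ℂˣ}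
    {i j : Fin n} (h1 : w i.castSucc = j.castSucc) (h2 : w i.succ = j.succ)
    (hc : c i.castSucc = c i.succ) : subst w c * TPol κ i = TPol κ j * subst w c := by
  have hw : w * simple i = simple j * w := by
    rw [simple, simple, ← h1, ← h2, Equiv.swap_apply_apply]
    simp
  refine LinearEquiv.ext fun Ψ => funext fun σ => ?_
  simp only [LinearEquiv.mul_apply, subst_apply, TPol_apply, map_add, map_mul, map_sub,
    substRat_cst, substRat_substRat, substRat_aCoeff κ hc, h1, h2, hw]
  congr 4
  funext k
  by_cases hk : k = i.castSucc
  · subst hk; simp [simple_castSucc, hc]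
  · by_cases hk' : k = i.succ
    · subst hk'; simp [simple_succ, hc]
    · simp [simple_of_ne hk hk']

/-- The braid relation of the Demazure–Lusztig operators, for two reflections `A`, `B` acting on a
field with three variables. -/
theorem demazure_braid {K : Type*} [Field K] {A B : K →+* K} {k x y w : K} (hk : k ≠ 0)
    (hxy : x - y ≠ 0) (hyw : y - w ≠ 0) (hxw : x - w ≠ 0)
    (hAk : A k = k) (hBk : B k = k) (hAx : A x = y) (hAy : A y = x) (hAw : A w = w)
    (hBx : B x = x) (hBy : B y = w) (hBw : B w = y) (hA : ∀ F, A (A F) = F) (hB : ∀ F, B (B F) = F)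
    (hAB : ∀ F, B (A (B F)) = A (B (A F))) {S T : K → K}
    (hS : ∀ F, S F = (k ^ 2 * x - y) / (k * (x - y)) * A F
      + (k - (k ^ 2 * x - y) / (k * (x - y))) * F)
    (hT : ∀ F, T F = (k ^ 2 * y - w) / (k * (y - w)) * B F
      + (k - (k ^ 2 * y - w) / (k * (y - w))) * F) (F : K) :
    S (T (S F)) = T (S (T F)) := by
  simp only [hS, hT, map_add, map_sub, map_mul, map_div₀, map_pow, hAk, hBk, hAx, hAy, hAw, hBx,
    hBy, hBw, hA, hB, hAB]
  generalize A (B (A F)) = F₁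
  generalize A (B F) = F₂
  generalize B (A F) = F₃
  generalize A F = F₄
  generalize B F = F₅
  have e1 : y - x = -(x - y) := by ring
  have e2 : w - y = -(y - w) := by ring
  rw [e1, e2]
  field_simp
  ring

theorem substRat_simple_simple (i : Fin n) (F : RatFn n) :
    substRat (simple i) 1 (substRat (simple i) 1 F) = F := substRat_simple_twice i F

theorem substRat_mul (v w : Equiv.Perm (Fin (n + 1))) (F : RatFn n) :
    substRat (v * w) 1 F = substRat v 1 (substRat w 1 F) := by
  rw [substRat_substRat]
  congr 2
  simp [Pi.one_def]

theorem substRat_braid {i j : Fin n} (h : (i : ℕ) + 1 = j) (F : RatFn n) :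
    substRat (simple j) 1 (substRat (simple i) 1 (substRat (simple j) 1 F)) =
      substRat (simple i) 1 (substRat (simple j) 1 (substRat (simple i) 1 F)) := by
  simp only [← substRat_mul, ← mul_assoc, simple_braid h]

theorem substRat_simple_castSucc (i : Fin n) : substRat (simple i) 1 (z i.castSucc) = z i.succ := by
  simp [substRat_z, simple_castSucc, cst]

theorem substRat_simple_succ (i : Fin n) : substRat (simple i) 1 (z i.succ) = z i.castSucc := by
  simp [substRat_z, simple_succ, cst]

theorem substRat_simple_of_ne {i : Fin n} {x : Fin (n + 1)} (h1 : x ≠ i.castSucc)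
    (h2 : x ≠ i.succ) : substRat (simple i) 1 (z x) = z x := by
  simp [substRat_z, simple_of_ne h1 h2, cst]

theorem TPol_braid (κ : ℂˣ) {i j : Fin n} (h : (i : ℕ) + 1 = j) :
    TPol κ i * TPol κ j * TPol κ i = TPol κ j * TPol κ i * TPol κ j := by
  have e : j.castSucc = i.succ := Fin.ext (by simpa using h.symm)
  have h1 : (i.castSucc : Fin (n + 1)) ≠ j.succ := by
    intro h'; have := congrArg Fin.val h'; simp at this; omega
  have h2 := castSucc_ne_succ i
  have h3 := castSucc_ne_succ j
  have hj1 := substRat_simple_castSucc j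
  have hj2 := substRat_simple_succ j
  have a1 := aCoeff_eq κ h2
  have a2 := aCoeff_eq κ h3
  rw [e] at h3 hj1 hj2 a2
  refine LinearEquiv.ext fun Ψ => funext fun σ => ?_
  have key := demazure_braid (A := (substRat (simple i) 1 : RatFn n →+* RatFn n))
    (B := (substRat (simple j) 1 : RatFn n →+* RatFn n)) (k := cst n κ) (x := z i.castSucc)
    (y := z i.succ) (w := z j.succ) (cst_unit_ne κ) (z_sub_ne h2) (z_sub_ne h3) (z_sub_ne h1)
    (substRat_cst _ _ _) (substRat_cst _ _ _) (substRat_simple_castSucc i) (substRat_simple_succ i)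
    (substRat_simple_of_ne h1.symm h3.symm) (substRat_simple_of_ne (by rw [e]; exact h2) h1) hj1 hj2
    (substRat_simple_simple i) (substRat_simple_simple j) (substRat_braid h)
    (S := fun F => aCoeff κ i.castSucc i.succ * substRat (simple i) 1 F
      + (cst n κ - aCoeff κ i.castSucc i.succ) * F)
    (T := fun F => aCoeff κ i.succ j.succ * substRat (simple j) 1 F
      + (cst n κ - aCoeff κ i.succ j.succ) * F) (fun F => by rw [a1]; rfl)
    (fun F => by rw [a2]; rfl) (Ψ σ)
  simpa only [LinearEquiv.mul_apply, TPol_apply, e] using key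

theorem TPol_comm (κ : ℂˣ) {i j : Fin n} (h : (i : ℕ) + 2 ≤ j) :
    Commute (TPol κ i) (TPol κ j) := by
  have h1 : (j.castSucc : Fin (n + 1)) ≠ i.castSucc := by simp [Fin.ext_iff]; omega
  have h2 : (j.castSucc : Fin (n + 1)) ≠ i.succ := by simp [Fin.ext_iff]; omega
  have h3 : (j.succ : Fin (n + 1)) ≠ i.castSucc := by simp [Fin.ext_iff]; omega
  have h4 : (j.succ : Fin (n + 1)) ≠ i.succ := by simp [Fin.ext_iff]; omega
  have hs : ∀ F : RatFn n, substRat (simple i) 1 (substRat (simple j) 1 F) =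
      substRat (simple j) 1 (substRat (simple i) 1 F) := fun F => by
    rw [← substRat_mul, ← substRat_mul, (simple_comm h).eq]
  have ha : substRat (simple i) 1 (aCoeff κ j.castSucc j.succ) = aCoeff κ j.castSucc j.succ := by
    rw [substRat_aCoeff κ (by rfl), simple_of_ne h1 h2, simple_of_ne h3 h4]
  have hb : substRat (simple j) 1 (aCoeff κ i.castSucc i.succ) = aCoeff κ i.castSucc i.succ := by
    rw [substRat_aCoeff κ (by rfl), simple_of_ne h1.symm h3.symm, simple_of_ne h2.symm h4.symm]
  refine LinearEquiv.ext fun Ψ => funext fun σ => ?_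
  simp only [LinearEquiv.mul_apply, TPol_apply, map_add, map_mul, map_sub, hs, ha, hb, substRat_cst]
  ring

theorem isBraid_TPol (κ : ℂˣ) : IsBraid (extendOne (TPol (n := n) κ)) n :=
  isBraid_extendOne (fun _ _ => TPol_braid κ) fun _ _ => TPol_comm κ

/-! ### The twisted rotation and the affine braid relations. -/

theorem finRotate_inv_pow_val (r : ℕ) (hr : r ≤ n + 1) (x : Fin (n + 1)) :
    ((((finRotate (n + 1))⁻¹ ^ r) x : Fin (n + 1)) : ℕ) =
      if (x : ℕ) < r then (x : ℕ) + (n + 1) - r else x - r := by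
  induction r with
  | zero => simp
  | succ r ih =>
    have ih := ih (by omega)
    rw [pow_succ', Equiv.Perm.mul_apply]
    set y := ((finRotate (n + 1))⁻¹ ^ r) x
    have hy : ∀ y : Fin (n + 1), (((finRotate (n + 1))⁻¹ y : Fin (n + 1)) : ℕ) =
        if (y : ℕ) = 0 then n else y - 1 := by
      intro y
      by_cases h : (y : ℕ) = 0
      · have h' : y = finRotate (n + 1) (Fin.last n) := by
          rw [finRotate_last]; exact Fin.ext h
        rw [if_pos h, Equiv.Perm.inv_eq_iff_eq.mpr h']
        rfl
      · have h' : y = finRotate (n + 1) ⟨y - 1, by omega⟩ := by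
          rw [finRotate_apply]
          ext
          rw [Fin.val_add_one_of_lt]
          · simp; omega
          · rw [Fin.lt_def]; simp; omega
        rw [if_neg h, Equiv.Perm.inv_eq_iff_eq.mpr h']
    rw [hy, ih]
    split_ifs <;> omega

/-- The first `r` labels. -/
def initial (n r : ℕ) : Finset (Fin (n + 1)) := Finset.univ.filter fun x => (x : ℕ) < r

@[simp] theorem mem_initial {r : ℕ} {x : Fin (n + 1)} : x ∈ initial n r ↔ (x : ℕ) < r := by
  simp [initial]

theorem piOp_pow (q : ℂˣ) {r : ℕ} (hr : r ≤ n + 1) :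
    piOp (n := n) q ^ r = subst ((finRotate (n + 1))⁻¹ ^ r) fun j => if j ∈ initial n r then q else 1 := by
  induction r with
  | zero => simp only [pow_zero, mem_initial, Nat.not_lt_zero, if_false]; exact subst_one.symm
  | succ r ih =>
    rw [pow_succ', ih (by omega), piOp, subst_mul, ← pow_succ']
    congr 1
    funext i
    simp only [mem_initial, Fin.ext_iff, finRotate_inv_pow_val r (by omega : r ≤ n + 1) i,
      Fin.val_zero]
    split_ifs <;> first | omega | simp

/-- Both relations are instances of `subst_mul_TPol`. For `wrap` the square of π is essential: π
scales only the first coordinate, whereas π² scales both coordinates on which the first generator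
acts and sends them to the last two. -/
theorem isAffineBraid (κ q : ℂˣ) : IsAffineBraid (extendOne (TPol (n := n) κ)) (piOp q) n where
  toIsBraid := isBraid_TPol κ
  shift i hi := by
    rw [extendOne_of_lt _ hi, extendOne_of_lt _ (by omega : i < n), ← pow_one (piOp q),
      piOp_pow q (by omega)]
    apply subst_mul_TPol
    · ext; rw [pow_one, ← pow_one (finRotate (n + 1))⁻¹, finRotate_inv_pow_val 1 (by omega)]; simp
    · ext; rw [pow_one, ← pow_one (finRotate (n + 1))⁻¹, finRotate_inv_pow_val 1 (by omega)]; simp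
    · simp
  wrap hn := by
    rw [extendOne_of_lt _ (by omega : 0 < n), extendOne_of_lt _ (by omega : n - 1 < n),
      piOp_pow q (by omega)]
    apply subst_mul_TPol
    · ext; rw [finRotate_inv_pow_val 2 (by omega)]; simp
    · ext; rw [finRotate_inv_pow_val 2 (by omega)]; simp; omega
    · simp

theorem map_val_filter_finRange {a k : ℕ} (hk : a + k ≤ n) {P : Fin n → Prop} [DecidablePred P]
    (h : ∀ x, P x ↔ a ≤ x ∧ (x : ℕ) < a + k) :
    ((List.finRange n).filter P).map Fin.val = List.range' a k := by
  apply List.SortedLT.eq_of_mem_iff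
  · refine List.Pairwise.sortedLT (List.pairwise_map.mpr ?_)
    exact ((List.pairwise_lt_finRange n).filter _).imp fun h => h
  · exact List.sortedLT_range' _ _ one_ne_zero
  · intro x
    simp only [List.mem_map, List.mem_filter, List.mem_finRange, true_and, decide_eq_true_eq, h,
      List.mem_range'_1]
    constructor
    · rintro ⟨y, hy, rfl⟩
      exact hy
    · exact fun hx => ⟨⟨x, by omega⟩, hx, rfl⟩

theorem Y_eq_dunkl (κ q : ℂˣ) (i : Fin (n + 1)) :
    Y κ q i = dunkl (extendOne (TPol κ)) (piOp q) n i := by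
  have h1 : (((List.finRange n).filter fun k => i ≤ k.castSucc).map (TPol κ)) =
      (List.range' i (n - i)).map (extendOne (TPol κ)) := by
    rw [← map_extendOne_val, map_val_filter_finRange (a := i) (k := n - i) (by omega)]
    intro x
    simp only [Fin.le_def, Fin.val_castSucc]
    omega
  have h2 : (((List.finRange n).filter fun k => k.castSucc < i).map fun k => (TPol κ k)⁻¹) =
      (List.range' 0 i).map fun j => (extendOne (TPol κ) j)⁻¹ := by
    have e : (fun j => (extendOne (TPol κ) j)⁻¹) = extendOne (fun k => (TPol (n := n) κ k)⁻¹) := by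
      funext j
      unfold extendOne
      split_ifs <;> simp
    rw [← map_extendOne_val, map_val_filter_finRange (a := 0) (k := i) (by omega), e]
    intro x
    simp only [Fin.lt_def, Fin.val_castSucc]
    omega
  rw [Y, h1, h2, dunkl]
  rfl

/-! ### The spin operators -/

theorem update_update_self (σ : Fin (n + 1) → Fin 2) {i : Fin n} {a b : Fin 2}
    (ha : σ i.castSucc = a) (hb : σ i.succ = b) :
    Function.update (Function.update σ i.castSucc a) i.succ b = σ := by
  subst ha hb; simp

theorem update_update_swap (σ : Fin (n + 1) → Fin 2) {i : Fin n} {a b : Fin 2}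
    (ha : σ i.succ = a) (hb : σ i.castSucc = b) :
    Function.update (Function.update σ i.castSucc a) i.succ b = σ ∘ simple i := by
  subst ha hb
  funext k
  by_cases hk : k = i.succ
  · subst hk; simp [simple_succ]
  · by_cases hk' : k = i.castSucc
    · subst hk'; simp [simple_castSucc, castSucc_ne_succ]
    · simp [hk, hk', simple_of_ne]

/-- A weight-preserving two-site operator. -/
theorem pairOp_apply (i : Fin n) (a b c d e f : RatFn n) (Ψ : Vec n) (σ : Fin (n + 1) → Fin 2) :
    pairOp i !![a, 0, 0, 0; 0, b, c, 0; 0, d, e, 0; 0, 0, 0, f] Ψ σ =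
      if σ i.castSucc = σ i.succ then (if σ i.castSucc = 0 then a else f) * Ψ σ
      else if σ i.castSucc = 0 then b * Ψ σ + c * Ψ (σ ∘ simple i)
      else e * Ψ σ + d * Ψ (σ ∘ simple i) := by
  have p00 : pairIdx (0, 0) = 0 := rfl
  have p01 : pairIdx (0, 1) = 1 := rfl
  have p10 : pairIdx (1, 0) = 2 := rfl
  have p11 : pairIdx (1, 1) = 3 := rfl
  have two : ∀ x : Fin 2, x = 0 ∨ x = 1 := by decide
  simp only [pairOp, LinearMap.coe_mk, AddHom.coe_mk, Fintype.sum_prod_type, Fin.sum_univ_two]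
  rcases two (σ i.castSucc) with h1 | h1 <;> rcases two (σ i.succ) with h2 | h2
  · rw [update_update_self σ h1 h2, h1, h2]
    simp [p00, p01, p10, p11]
  · rw [update_update_self σ h1 h2, update_update_swap σ h2 h1, h1, h2]
    simp [p00, p01, p10, p11]
  · rw [update_update_self σ h1 h2, update_update_swap σ h2 h1, h1, h2]
    simp [p00, p01, p10, p11]
    ring
  · rw [update_update_self σ h1 h2, h1, h2]
    simp [p00, p01, p10, p11]

theorem TSp_apply (κ : ℂˣ) (i : Fin n) (Ψ : Vec n) (σ : Fin (n + 1) → Fin 2) :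
    TSp κ i Ψ σ =
      if σ i.castSucc = σ i.succ then cst n κ * Ψ σ
      else (if σ i.castSucc = 0 then (cst n κ - (cst n κ)⁻¹) * Ψ σ else 0)
        + Ψ (σ ∘ simple i) := by
  rw [TSp, pairOp_apply]
  split_ifs <;> simp

theorem RMat_eq (κ : ℂˣ) {i j : Fin (n + 1)} (h : i ≠ j) : RMat κ (z i / z j : RatFn n) =
    !![1, 0, 0, 0;
       0, (cst n κ ^ 2 - 1) * z i / (cst n κ ^ 2 * z i - z j),
         cst n κ * (z i - z j) / (cst n κ ^ 2 * z i - z j), 0;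
       0, cst n κ * (z i - z j) / (cst n κ ^ 2 * z i - z j),
         (cst n κ ^ 2 - 1) * z j / (cst n κ ^ 2 * z i - z j), 0;
       0, 0, 0, 1] := by
  have h1 := t_z_sub_ne κ h
  have h2 := z_ne_zero i
  have h4 := z_ne_zero j
  have h3 := cst_unit_ne (n := n) κ
  have d1 : cst n κ * (z i / z j) - (cst n κ)⁻¹ = (cst n κ ^ 2 * z i - z j) / (cst n κ * z j) := by
    field_simp
  have hf : fFun κ (z i / z j : RatFn n) = cst n κ * (z i - z j) / (cst n κ ^ 2 * z i - z j) := by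
    rw [fFun, d1]; field_simp
  have hg : gFun κ (z i / z j : RatFn n) = (cst n κ ^ 2 - 1) * z j / (cst n κ ^ 2 * z i - z j) := by
    rw [gFun, d1]; field_simp
  have hug : z i / z j * gFun κ (z i / z j : RatFn n) =
      (cst n κ ^ 2 - 1) * z i / (cst n κ ^ 2 * z i - z j) := by
    rw [hg]; field_simp
  rw [RMat, hf, hug, hg]

theorem RGen_apply (κ : ℂˣ) (i : Fin n) (Ψ : Vec n) (σ : Fin (n + 1) → Fin 2) :
    RGen κ i Ψ σ =
      if σ i.castSucc = σ i.succ then Ψ σ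
      else ((cst n κ ^ 2 - 1) * (if σ i.castSucc = 0 then z i.castSucc else z i.succ) * Ψ σ
        + cst n κ * (z i.castSucc - z i.succ) * Ψ (σ ∘ simple i)) /
          (cst n κ ^ 2 * z i.castSucc - z i.succ) := by
  change pairOp i (RMat κ (z i.castSucc / z i.succ)) Ψ σ = _
  rw [RMat_eq κ (castSucc_ne_succ i), pairOp_apply]
  split_ifs <;> first | simp | ring

theorem sTotGen_apply (κ : ℂˣ) (i : Fin n) (Ψ : Vec n) (σ : Fin (n + 1) → Fin 2) :
    sTotGen κ i Ψ σ =
      if σ i.castSucc = σ i.succ then substRat (simple i) 1 (Ψ σ)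
      else ((cst n κ ^ 2 - 1) * (if σ i.castSucc = 0 then z i.succ else z i.castSucc) *
        substRat (simple i) 1 (Ψ σ)
        + cst n κ * (z i.succ - z i.castSucc) * substRat (simple i) 1 (Ψ (σ ∘ simple i))) /
          (cst n κ ^ 2 * z i.succ - z i.castSucc) := by
  change substRat (simple i) 1 (RGen κ i Ψ σ) = _
  rw [RGen_apply]
  have h1 := substRat_simple_castSucc i
  have h2 := substRat_simple_succ i
  split_ifs <;> simp only [map_div₀, map_add, map_mul, map_sub, map_pow, map_one, substRat_cst,
    h1, h2]

theorem comp_simple_simple (σ : Fin (n + 1) → Fin 2) (i : Fin n) :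
    (σ ∘ simple i) ∘ simple i = σ := by
  funext k
  have := congrArg (fun w : Equiv.Perm (Fin (n + 1)) => σ (w k)) (simple_mul_self i)
  simpa using this

theorem sTotGen_mul_self (κ : ℂˣ) (i : Fin n) : sTotGen κ i * sTotGen κ i = 1 := by
  have h1 := t_z_sub_ne κ (castSucc_ne_succ i)
  have h2 := t_z_sub_ne κ (castSucc_ne_succ i).symm
  have hx := substRat_simple_castSucc i
  have hy := substRat_simple_succ i
  have two : ∀ x : Fin 2, x = 0 ∨ x = 1 := by decide
  refine LinearEquiv.ext fun Ψ => funext fun σ => ?_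
  simp only [LinearEquiv.mul_apply, sTotGen_apply, Function.comp_apply, simple_castSucc,
    simple_succ, comp_simple_simple, LinearEquiv.coe_one, id_eq]
  rcases two (σ i.castSucc) with h3 | h3 <;> rcases two (σ i.succ) with h4 | h4 <;>
    simp only [h3, h4, if_true, zero_ne_one, one_ne_zero, if_false, map_div₀, map_add, map_mul,
      map_sub, map_pow, map_one, substRat_cst, hx, hy, substRat_simple_simple]
  all_goals
    generalize cst n (κ : ℂ) = k at *
    generalize (z i.castSucc : RatFn n) = x at *
    generalize (z i.succ : RatFn n) = y at *
    field_simp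
    ring

/-- Invariance under `s_i^tot` is the coincidence of the two Hecke actions. -/
theorem TPol_sub_TSp (κ : ℂˣ) (i : Fin n) (Ψ : Vec n) (σ : Fin (n + 1) → Fin 2) :
    TPol κ i Ψ σ - TSp κ i Ψ σ =
      aCoeff κ i.castSucc i.succ * (substRat (simple i) 1 (Ψ σ) - RGen κ i Ψ σ) := by
  have h1 := t_z_sub_ne κ (castSucc_ne_succ i)
  have h2 := z_sub_ne (castSucc_ne_succ i)
  have h3 := cst_unit_ne (n := n) κ
  rw [TPol_apply, TSp_apply, RGen_apply, aCoeff_eq κ (castSucc_ne_succ i)]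
  split_ifs
  all_goals
    generalize cst n (κ : ℂ) = k at *
    generalize (z i.castSucc : RatFn n) = x at *
    generalize (z i.succ : RatFn n) = y at *
    field_simp
    ring

set_option maxHeartbeats 1600000 in
/-- The Yang–Baxter equation, in its braid form. -/
theorem sTotGen_braid (κ : ℂˣ) {i j : Fin n} (h : (i : ℕ) + 1 = j) :
    sTotGen κ i * sTotGen κ j * sTotGen κ i = sTotGen κ j * sTotGen κ i * sTotGen κ j := by
  have e : j.castSucc = i.succ := Fin.ext (by simpa using h.symm)
  have h1 : (i.castSucc : Fin (n + 1)) ≠ j.succ := by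
    intro h'; have := congrArg Fin.val h'; simp at this; omega
  have h2 := castSucc_ne_succ i
  have h3 := castSucc_ne_succ j
  have hj1 := substRat_simple_castSucc j
  have hj2 := substRat_simple_succ j
  have s1 := simple_castSucc i
  have s2 := simple_succ i
  have s3 := simple_castSucc j
  have s4 := simple_succ j
  rw [e] at h3 hj1 hj2 s3 s4
  have hi1 := substRat_simple_castSucc i
  have hi2 := substRat_simple_succ i
  have hi3 := substRat_simple_of_ne h1.symm h3.symm
  have hj3 := substRat_simple_of_ne (i := j) (by rw [e]; exact h2) h1
  have s5 : simple j i.castSucc = i.castSucc := simple_of_ne (by rw [e]; exact h2) h1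
  have s6 : simple i j.succ = j.succ := simple_of_ne h1.symm h3.symm
  have hb := substRat_braid h
  have d1 := t_z_sub_ne κ h2.symm
  have d2 := t_z_sub_ne κ h3.symm
  have d3 := t_z_sub_ne κ h1.symm
  have two : ∀ x : Fin 2, x = 0 ∨ x = 1 := by decide
  refine LinearEquiv.ext fun Ψ => funext fun σ => ?_
  rcases two (σ i.castSucc) with ha | ha <;> rcases two (σ i.succ) with hb' | hb' <;>
    rcases two (σ j.succ) with hc | hc
  all_goals
    simp only [LinearEquiv.mul_apply, sTotGen_apply, e, Function.comp_apply, s1, s2, s3, s4, s5, s6,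
      ha, hb', hc, comp_simple_simple, if_true, zero_ne_one, one_ne_zero, if_false, map_div₀,
      map_add, map_mul, map_sub, map_pow, map_one, substRat_cst, hi1, hi2, hi3, hj1, hj2, hj3, hb]
  -- In each spin configuration both sides are now linear in the images, under the reversal of the
  -- three coordinates, of the values of Ψ at rearranged spins. These images become independent
  -- symbols, leaving identities of rational functions.
  all_goals
    try generalize substRat (simple i) 1 (substRat (simple j) 1 (substRat (simple i) 1 (Ψ σ))) = F₀
    try generalize substRat (simple i) 1 (substRat (simple j) 1 (substRat (simple i) 1
      (Ψ (σ ∘ simple i)))) = F₁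
    try generalize substRat (simple i) 1 (substRat (simple j) 1 (substRat (simple i) 1
      (Ψ (σ ∘ simple j)))) = F₂
    try generalize substRat (simple i) 1 (substRat (simple j) 1 (substRat (simple i) 1
      (Ψ ((σ ∘ simple i) ∘ simple j)))) = F₃
    try generalize substRat (simple i) 1 (substRat (simple j) 1 (substRat (simple i) 1
      (Ψ ((σ ∘ simple j) ∘ simple i)))) = F₄
    generalize cst n (κ : ℂ) = k at *
    generalize (z i.castSucc : RatFn n) = x at *
    generalize (z i.succ : RatFn n) = y at *
    generalize (z j.succ : RatFn n) = w at *
    try field_simp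
    try ring

theorem sTotGen_comm (κ : ℂˣ) {i j : Fin n} (h : (i : ℕ) + 2 ≤ j) :
    Commute (sTotGen κ i) (sTotGen κ j) := by
  have h1 : (j.castSucc : Fin (n + 1)) ≠ i.castSucc := by simp [Fin.ext_iff]; omega
  have h2 : (j.castSucc : Fin (n + 1)) ≠ i.succ := by simp [Fin.ext_iff]; omega
  have h3 : (j.succ : Fin (n + 1)) ≠ i.castSucc := by simp [Fin.ext_iff]; omega
  have h4 : (j.succ : Fin (n + 1)) ≠ i.succ := by simp [Fin.ext_iff]; omega
  have hs : ∀ F : RatFn n, substRat (simple i) 1 (substRat (simple j) 1 F) =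
      substRat (simple j) 1 (substRat (simple i) 1 F) := fun F => by
    rw [← substRat_mul, ← substRat_mul, (simple_comm h).eq]
  have hσ : ∀ σ : Fin (n + 1) → Fin 2, (σ ∘ simple i) ∘ simple j = (σ ∘ simple j) ∘ simple i := by
    intro σ
    funext k
    exact congrArg (fun w : Equiv.Perm (Fin (n + 1)) => σ (w k)) (simple_comm h).eq
  have i3 := substRat_simple_of_ne h1 h2
  have i4 := substRat_simple_of_ne h3 h4
  have j3 := substRat_simple_of_ne h1.symm h3.symm
  have j4 := substRat_simple_of_ne h2.symm h4.symm
  have d1 := t_z_sub_ne κ (castSucc_ne_succ i).symm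
  have d2 := t_z_sub_ne κ (castSucc_ne_succ j).symm
  refine LinearEquiv.ext fun Ψ => funext fun σ => ?_
  by_cases ha : σ i.castSucc = σ i.succ <;> by_cases hb : σ j.castSucc = σ j.succ <;>
    simp only [LinearEquiv.mul_apply, sTotGen_apply, Function.comp_apply, simple_of_ne h1 h2,
      simple_of_ne h3 h4, simple_of_ne h1.symm h3.symm, simple_of_ne h2.symm h4.symm, ha, hb,
      if_true, if_false, map_div₀, apply_ite (substRat (simple i) 1),
      apply_ite (substRat (simple j) 1), map_add, map_mul, map_sub, map_pow, map_one, substRat_cst,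
      i3, i4, j3, j4, hs, hσ]
  generalize cst n (κ : ℂ) = k at *
  field_simp
  ring

theorem isBraid_sTotGen (κ : ℂˣ) : IsBraid (extendOne (sTotGen (n := n) κ)) n :=
  isBraid_extendOne (fun _ _ => sTotGen_braid κ) fun _ _ => sTotGen_comm κ

/-! ### The representation of the symmetric group by total permutations. -/

theorem sTot_eq_prod (κ : ℂˣ) {w : Equiv.Perm (Fin (n + 1))} {l : List (Fin n)}
    (h : (l.map simple).prod = w) : sTot κ w = (l.map (sTotGen κ)).prod :=
  prod_eq_of_simple (isBraid_sTotGen κ) (sTotGen_mul_self κ)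
    ((exists_isReducedWord w).choose_spec.1.trans h.symm)

theorem sTot_simple (κ : ℂˣ) (i : Fin n) : sTot κ (simple i) = sTotGen κ i := by
  rw [sTot_eq_prod κ (l := [i]) (by simp)]
  simp

theorem sTot_one (κ : ℂˣ) : sTot κ (1 : Equiv.Perm (Fin (n + 1))) = 1 :=
  sTot_eq_prod κ (l := []) rfl

theorem sTot_mul (κ : ℂˣ) (v w : Equiv.Perm (Fin (n + 1))) :
    sTot κ (v * w) = sTot κ v * sTot κ w := by
  obtain ⟨l, hl, -⟩ := exists_isReducedWord v
  obtain ⟨m, hm, -⟩ := exists_isReducedWord w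
  rw [sTot_eq_prod κ hl, sTot_eq_prod κ hm, sTot_eq_prod κ (l := l ++ m) (by simp [hl, hm])]
  simp

theorem sTot_inv (κ : ℂˣ) (w : Equiv.Perm (Fin (n + 1))) : sTot κ w⁻¹ = (sTot κ w)⁻¹ := by
  rw [eq_inv_iff_mul_eq_one, ← sTot_mul, inv_mul_cancel, sTot_one]

theorem sTot_eq_perm_mul (κ : ℂˣ) (w : Equiv.Perm (Fin (n + 1))) :
    sTot κ w = perm w * RCheck κ w := by
  rw [RCheck, perm_inv, mul_inv_cancel_left]

theorem RCheck_inv (κ : ℂˣ) (w : Equiv.Perm (Fin (n + 1))) :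
    (RCheck κ w⁻¹)⁻¹ = sTot κ w * (perm w)⁻¹ := by
  rw [RCheck, inv_inv, sTot_inv, mul_inv_rev, inv_inv]

/-! ### Semilinear operators -/

/-- Operators that are semilinear for an automorphism `θ` of the field of rational functions. -/
def IsSemi (θ : RatFn n → RatFn n) (A : Module.End ℂ (Vec n)) : Prop :=
  ∀ (h : RatFn n) (Ψ : Vec n), A (h • Ψ) = θ h • A Ψ

theorem IsSemi.mul {θ η : RatFn n → RatFn n} {A B : Module.End ℂ (Vec n)} (hA : IsSemi θ A)
    (hB : IsSemi η B) : IsSemi (θ ∘ η) (A * B) := fun h Ψ => by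
  rw [Module.End.mul_apply, hB, hA, Module.End.mul_apply]; rfl

theorem IsSemi.add {θ : RatFn n → RatFn n} {A B : Module.End ℂ (Vec n)} (hA : IsSemi θ A)
    (hB : IsSemi θ B) : IsSemi θ (A + B) := fun h Ψ => by
  rw [LinearMap.add_apply, hA, hB, LinearMap.add_apply, smul_add]

theorem isSemi_subst (w : Equiv.Perm (Fin (n + 1))) (c : Fin (n + 1) → ℂˣ) :
    IsSemi (substRat w c) (subst w c).toEnd := fun h Ψ => by
  funext σ
  exact map_mul (substRat w c) h (Ψ σ)

theorem isSemi_mulOp (a : RatFn n) : IsSemi id (mulOp a) := fun h Ψ => smul_comm a h Ψ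

theorem isSemi_pairOp (i : Fin n) (M : Matrix (Fin 4) (Fin 4) (RatFn n)) :
    IsSemi id (pairOp i M) := fun h Ψ => by
  funext σ
  simp only [pairOp, LinearMap.coe_mk, AddHom.coe_mk, Pi.smul_apply, smul_eq_mul, id,
    Finset.mul_sum]
  exact Finset.sum_congr rfl fun τ _ => by ring

theorem toEnd_mul (g h : GLVec n) : (g * h).toEnd = g.toEnd * h.toEnd := rfl

theorem toEnd_apply (g : GLVec n) (Ψ : Vec n) : g.toEnd Ψ = g Ψ := rfl

theorem isSemi_sTotGen (κ : ℂˣ) (i : Fin n) :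
    IsSemi (substRat (simple i) 1) (sTotGen κ i).toEnd :=
  IsSemi.mul (B := (RGen κ i).toEnd) (isSemi_subst (simple i) 1) (isSemi_pairOp i _)

theorem isSemi_sTot (κ : ℂˣ) (w : Equiv.Perm (Fin (n + 1))) :
    IsSemi (substRat w 1) (sTot κ w).toEnd := by
  obtain ⟨l, rfl, -⟩ := exists_isReducedWord w
  rw [sTot_eq_prod κ rfl]
  induction l with
  | nil => exact fun h Ψ => congrArg (· • Ψ) (substRat_one h).symm
  | cons i l ih =>
    intro h Ψ
    rw [List.map_cons, List.prod_cons, List.map_cons, List.prod_cons, substRat_mul]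
    exact (isSemi_sTotGen κ i).mul ih h Ψ

/-! ### The invariant vectors -/

/-- The space of (not necessarily polynomial) vectors invariant under all `s^tot_w`. -/
def IsInvariant (κ : ℂˣ) (Ψ : Vec n) : Prop := ∀ i : Fin n, TSp κ i Ψ = TPol κ i Ψ

/-- By `TPol_sub_TSp` and a_{i,i+1} ≠ 0 the Hecke condition is Ř_{i,i+1} Ψ = s_i Ψ; applying the
involution s_i gives s_i^tot Ψ = Ψ. -/
theorem isInvariant_iff_gen {κ : ℂˣ} {Ψ : Vec n} :
    IsInvariant κ Ψ ↔ ∀ i : Fin n, sTotGen κ i Ψ = Ψ := by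
  refine forall_congr' fun i => ?_
  have ha := aCoeff_ne κ (castSucc_ne_succ i)
  constructor
  · intro h
    have h' : RGen κ i Ψ = perm (simple i) Ψ := by
      funext σ
      have := TPol_sub_TSp κ i Ψ σ
      rw [h, sub_self, zero_eq_mul, or_iff_right ha, sub_eq_zero] at this
      exact this.symm
    change perm (simple i) (RGen κ i Ψ) = Ψ
    rw [h', ← LinearEquiv.mul_apply, ← perm_mul, simple_mul_self, perm_one]
    rfl
  · intro h
    have h' : RGen κ i Ψ = perm (simple i) Ψ := by
      conv_rhs => rw [← h]
      change _ = perm (simple i) (perm (simple i) (RGen κ i Ψ))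
      rw [← LinearEquiv.mul_apply, ← perm_mul, simple_mul_self, perm_one]
      rfl
    funext σ
    have := TPol_sub_TSp κ i Ψ σ
    rw [h', show substRat (simple i) 1 (Ψ σ) = perm (simple i) Ψ σ from rfl, sub_self, mul_zero,
      sub_eq_zero] at this
    exact this.symm

theorem isInvariant_iff {κ : ℂˣ} {Ψ : Vec n} :
    IsInvariant κ Ψ ↔ ∀ w : Equiv.Perm (Fin (n + 1)), sTot κ w Ψ = Ψ := by
  rw [isInvariant_iff_gen]
  constructor
  · intro h w
    obtain ⟨l, rfl, -⟩ := exists_isReducedWord w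
    rw [sTot_eq_prod κ rfl]
    induction l with
    | nil => rfl
    | cons i l ih => rw [List.map_cons, List.prod_cons, LinearEquiv.mul_apply, ih, h]
  · exact fun h i => by rw [← sTot_simple, h]

theorem mem_physical {κ : ℂˣ} {Ψ : Vec n} :
    Ψ ∈ physical κ ↔ Ψ ∈ polyVec n ∧ IsInvariant κ Ψ := by
  simp only [physical, Submodule.mem_inf, Submodule.mem_iInf, LinearMap.mem_ker,
    LinearMap.sub_apply, sub_eq_zero]
  rfl

/-- Symmetrization produces invariant vectors. -/
theorem isInvariant_sum (κ : ℂˣ) (Ψ : Vec n) :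
    IsInvariant κ (∑ w : Equiv.Perm (Fin (n + 1)), sTot κ w Ψ) := by
  rw [isInvariant_iff]
  intro v
  rw [map_sum, ← Equiv.sum_comp (Equiv.mulLeft v) fun w => sTot κ w Ψ]
  exact Finset.sum_congr rfl fun w _ => by rw [Equiv.coe_mulLeft, sTot_mul]; rfl

/-! ### Products and elementary symmetric functions of the Dunkl operators -/

/-- The ordered product of a family over a finite set of labels. -/
def sortedProd (X : Fin (n + 1) → GLVec n) (J : Finset (Fin (n + 1))) : GLVec n :=
  ((J.sort (· ≤ ·)).map X).prod

theorem elemSymm_eq (X : Fin (n + 1) → GLVec n) (r : ℕ) :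
    elemSymm X r = ∑ J ∈ Finset.powersetCard r Finset.univ, (sortedProd X J).toEnd := rfl

/-- A commuting family is the image of a family in an abelian group. -/
theorem exists_commGroup {X : Fin (n + 1) → GLVec n} (h : ∀ i j, Commute (X i) (X j)) :
    ∃ (H : Type) (_ : CommGroup H) (f : H →* GLVec n) (x : Fin (n + 1) → H),
      ∀ i, f (x i) = X i := by
  have : IsMulCommutative (Subgroup.closure (Set.range X)) := by
    apply Subgroup.isMulCommutative_closure
    rintro _ ⟨i, rfl⟩ _ ⟨j, rfl⟩
    exact h i j
  exact ⟨Subgroup.closure (Set.range X), { (inferInstance : Group (Subgroup.closure (Set.range X))) with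
    mul_comm := fun a b => this.is_comm.comm a b },
    (Subgroup.closure (Set.range X)).subtype, fun i => ⟨X i, Subgroup.subset_closure ⟨i, rfl⟩⟩,
    fun i => rfl⟩

theorem sortedProd_eq_map {H : Type} [CommGroup H] {f : H →* GLVec n} {x : Fin (n + 1) → H}
    {X : Fin (n + 1) → GLVec n} (h : ∀ i, f (x i) = X i) (J : Finset (Fin (n + 1))) :
    sortedProd X J = f (∏ j ∈ J, x j) := by
  have e : ∏ j ∈ J, x j = ((J.sort (· ≤ ·)).map x).prod := by
    have := congrArg (fun s => (Multiset.map x s).prod) (Finset.sort_eq J (· ≤ ·))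
    rw [Multiset.map_coe, Multiset.prod_coe] at this
    exact this.symm
  rw [e, map_list_prod, List.map_map, sortedProd]
  congr 2
  funext i
  exact (h i).symm

theorem sortedProd_insert {X : Fin (n + 1) → GLVec n} (h : ∀ i j, Commute (X i) (X j))
    {i : Fin (n + 1)} {J : Finset (Fin (n + 1))} (hi : i ∉ J) :
    sortedProd X (insert i J) = X i * sortedProd X J := by
  obtain ⟨H, _, f, x, hx⟩ := exists_commGroup h
  rw [sortedProd_eq_map hx, sortedProd_eq_map hx, Finset.prod_insert hi, map_mul, hx]

theorem sortedProd_commute {X : Fin (n + 1) → GLVec n} {g : GLVec n}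
    {J : Finset (Fin (n + 1))} (h : ∀ j ∈ J, Commute g (X j)) : Commute g (sortedProd X J) := by
  apply Commute.list_prod_right
  intro y hy
  obtain ⟨j, hj, rfl⟩ := List.mem_map.mp hy
  exact h j ((Finset.mem_sort _).mp hj)

theorem sortedProd_mem {X : Fin (n + 1) → GLVec n} {S : Subgroup (GLVec n)} (h : ∀ j, X j ∈ S)
    (J : Finset (Fin (n + 1))) : sortedProd X J ∈ S := by
  apply Subgroup.list_prod_mem
  intro y hy
  obtain ⟨j, -, rfl⟩ := List.mem_map.mp hy
  exact h j

theorem commute_toEnd {g h : GLVec n} (c : Commute g h) : Commute g.toEnd h.toEnd :=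
  congrArg GLVec.toEnd c.eq

theorem elemSymm_commute {X Z : Fin (n + 1) → GLVec n} (h : ∀ i j, Commute (X i) (Z j))
    (r s : ℕ) : Commute (elemSymm X r) (elemSymm Z s) :=
  Commute.sum_left _ _ _ fun _ _ => Commute.sum_right _ _ _ fun _ _ =>
    commute_toEnd (sortedProd_commute fun j _ =>
      (sortedProd_commute fun i _ => (h i j).symm).symm)

theorem elemSymm_eq_zero (X : Fin (n + 1) → GLVec n) {r : ℕ} (hr : n + 1 < r) :
    elemSymm X r = 0 := by
  rw [elemSymm, Finset.powersetCard_eq_empty.mpr (by simpa using hr), Finset.sum_empty]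

/-- `e_{N-r}(X) = X_1 ⋯ X_N e_r(X⁻¹)`. -/
theorem elemSymm_compl {X : Fin (n + 1) → GLVec n} (h : ∀ i j, Commute (X i) (X j)) {r : ℕ}
    (hr : r ≤ n + 1) : elemSymm X (n + 1 - r) =
      (sortedProd X Finset.univ).toEnd * elemSymm (fun i => (X i)⁻¹) r := by
  obtain ⟨H, _, f, x, hx⟩ := exists_commGroup h
  rw [elemSymm_eq, elemSymm_eq, Finset.mul_sum]
  refine Finset.sum_nbij' (fun J => Jᶜ) (fun J => Jᶜ) ?_ ?_ (fun J _ => compl_compl J)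
    (fun J _ => compl_compl J) ?_
  · intro J hJ
    simp only [Finset.mem_powersetCard_univ] at hJ ⊢
    rw [Finset.card_compl, hJ, Fintype.card_fin]
    omega
  · intro J hJ
    simp only [Finset.mem_powersetCard_univ] at hJ ⊢
    rw [Finset.card_compl, hJ, Fintype.card_fin]
  · intro J _
    have hx' : ∀ i, f (x i)⁻¹ = (X i)⁻¹ := fun i => by rw [map_inv, hx]
    rw [← toEnd_mul, sortedProd_eq_map hx, sortedProd_eq_map hx, sortedProd_eq_map hx', ← map_mul,
      ← Finset.prod_mul_prod_compl J x, Finset.prod_inv_distrib, mul_inv_cancel_right]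

section Dunkl

variable (κ q : ℂˣ)

theorem Y_commute (i j : Fin (n + 1)) : Commute (Y κ q i) (Y κ q j) := by
  rw [Y_eq_dunkl, Y_eq_dunkl]
  exact (isAffineBraid κ q).commute_dunkl (by omega) (by omega)

theorem Y_castSucc (i : Fin n) : Y κ q i.castSucc = TPol κ i * Y κ q i.succ * TPol κ i := by
  rw [Y_eq_dunkl, Y_eq_dunkl, Fin.val_castSucc, Fin.val_succ, dunkl_eq _ _ i.2,
    extendOne_val]

theorem TPol_commute_Y {i : Fin n} {j : Fin (n + 1)} (h1 : j ≠ i.castSucc) (h2 : j ≠ i.succ) :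
    Commute (TPol κ i) (Y κ q j) := by
  rw [Y_eq_dunkl, ← extendOne_val (TPol κ) i]
  have h1' : (j : ℕ) ≠ i := fun h => h1 (Fin.ext h)
  have h2' : (j : ℕ) ≠ i + 1 := fun h => h2 (Fin.ext h)
  rcases lt_or_gt_of_ne h1' with h | h
  · exact (isAffineBraid κ q).comm_dunkl_right h i.2
  · exact (isAffineBraid κ q).comm_dunkl_left (by omega) (by omega)

/-- With B = Y_{i+1} and Y_i = T B T, the relation [Y_i, Y_{i+1}] = 0 reads T B T B = B T B T, which
is the claim after multiplying by T on the left. -/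
theorem TPol_commute_Y_mul_Y (i : Fin n) :
    Commute (TPol κ i) (Y κ q i.castSucc * Y κ q i.succ) := by
  have h := (Y_commute κ q i.castSucc i.succ).eq
  rw [Y_castSucc] at h ⊢
  rw [commute_iff_eq]
  generalize TPol κ i = T at *
  generalize Y κ q i.succ = B at *
  calc T * (T * B * T * B) = T * (B * (T * B * T)) := by rw [h]
    _ = _ := by simp only [mul_assoc]

/-- In T (T B T) and (T B T) T the quadratic relation yields the same multiple of T B T, plus B T
and T B respectively; these cross with the contributions of B itself. -/
theorem TPol_hecke_sum (i : Fin n) :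
    Commute (TPol κ i).toEnd ((Y κ q i.castSucc).toEnd + (Y κ q i.succ).toEnd) := by
  have hh : (TPol κ i).toEnd * (TPol κ i).toEnd =
      ((κ : ℂ) - (κ : ℂ)⁻¹) • (TPol κ i).toEnd + 1 := TPolEnd_hecke κ i
  rw [Y_castSucc, toEnd_mul, toEnd_mul]
  generalize (TPol κ i).toEnd = T at *
  generalize (Y κ q i.succ).toEnd = B
  rw [commute_iff_eq, mul_add, add_mul]
  have e1 : T * (T * B * T) = ((κ : ℂ) - (κ : ℂ)⁻¹) • (T * B * T) + B * T := by
    rw [← mul_assoc, ← mul_assoc, hh, add_mul, add_mul, one_mul, smul_mul_assoc, smul_mul_assoc]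
  have e2 : T * B * T * T = ((κ : ℂ) - (κ : ℂ)⁻¹) • (T * B * T) + T * B := by
    rw [mul_assoc (T * B), hh, mul_add, mul_one, mul_smul_comm]
  rw [e1, e2]
  abel

theorem simple_smul_eq_self {i : Fin n} {J : Finset (Fin (n + 1))}
    (h : i.castSucc ∈ J ↔ i.succ ∈ J) : simple i • J = J := by
  ext x
  rw [← Finset.inv_smul_mem_iff, simple, Equiv.swap_inv, Equiv.Perm.smul_def]
  by_cases h1 : x = i.castSucc
  · subst h1; rw [Equiv.swap_apply_left, h]
  · by_cases h2 : x = i.succ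
    · subst h2; rw [Equiv.swap_apply_right, h]
    · rw [Equiv.swap_apply_of_ne_of_ne h1 h2]

theorem simple_smul_insert {i : Fin n} {K : Finset (Fin (n + 1))} (h1 : i.castSucc ∉ K)
    (h2 : i.succ ∉ K) : simple i • insert i.castSucc K = insert i.succ K := by
  rw [Finset.smul_finset_insert, simple_smul_eq_self (by tauto), Equiv.Perm.smul_def,
    simple_castSucc]

theorem simple_smul_smul (i : Fin n) (J : Finset (Fin (n + 1))) :
    simple i • simple i • J = J := by
  rw [← mul_smul, simple_mul_self, one_smul]

/-- Symmetric functions of the Dunkl operators commute with the Hecke generators. -/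
theorem TPol_commute_elemSymm (i : Fin n) (r : ℕ) :
    Commute (TPol κ i).toEnd (elemSymm (Y κ q) r) := by
  have hK : ∀ K : Finset (Fin (n + 1)), i.castSucc ∉ K → i.succ ∉ K →
      Commute (TPol κ i) (sortedProd (Y κ q) K) := fun K h1 h2 =>
    sortedProd_commute fun j hj => TPol_commute_Y κ q (fun h => h1 (h ▸ hj)) fun h => h2 (h ▸ hj)
  have hfix : ∀ J : Finset (Fin (n + 1)), (i.castSucc ∈ J ↔ i.succ ∈ J) →
      Commute (TPol κ i) (sortedProd (Y κ q) J) := by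
    intro J hJ
    by_cases h1 : i.castSucc ∈ J
    · have h2 := hJ.mp h1
      have e : insert i.castSucc (insert i.succ ((J.erase i.succ).erase i.castSucc)) = J := by
        rw [Finset.insert_comm, Finset.insert_erase (Finset.mem_erase.mpr ⟨castSucc_ne_succ i, h1⟩),
          Finset.insert_erase h2]
      rw [← e, sortedProd_insert (Y_commute κ q) (by simp [castSucc_ne_succ]),
        sortedProd_insert (Y_commute κ q) (by simp), ← mul_assoc]
      exact (TPol_commute_Y_mul_Y κ q i).mul_right (hK _ (by simp) (by simp))
    · exact hK J h1 fun h => h1 (hJ.mpr h)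
  have hpair : ∀ J : Finset (Fin (n + 1)), i.castSucc ∈ J → i.succ ∉ J →
      Commute (TPol κ i).toEnd ((sortedProd (Y κ q) J).toEnd
        + (sortedProd (Y κ q) (simple i • J)).toEnd) := by
    intro J h1 h2
    have h3 : i.succ ∉ J.erase i.castSucc := fun h => h2 (Finset.mem_of_mem_erase h)
    have h4 := Finset.notMem_erase i.castSucc J
    rw [← Finset.insert_erase h1, simple_smul_insert h4 h3, sortedProd_insert (Y_commute κ q) h4,
      sortedProd_insert (Y_commute κ q) h3, toEnd_mul, toEnd_mul, ← add_mul]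
    exact (TPol_hecke_sum κ q i).mul_right (commute_toEnd (hK _ h4 h3))
  rw [commute_iff_eq, ← sub_eq_zero, elemSymm_eq, Finset.mul_sum, Finset.sum_mul,
    ← Finset.sum_sub_distrib]
  -- The commutator is summed over J paired with s_i J. Sets containing both or neither of i, i+1
  -- are fixed and contribute zero; a pair of distinct sets contributes a multiple of Y_i + Y_{i+1},
  -- which commutes with T_i.
  refine Finset.sum_involution (fun J _ => simple i • J) ?_ ?_ ?_ ?_
  · intro J _
    by_cases hJ : i.castSucc ∈ J ↔ i.succ ∈ J
    · rw [simple_smul_eq_self hJ, (commute_toEnd (hfix J hJ)).eq]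
      simp
    · rw [sub_add_sub_comm, ← mul_add, ← add_mul, sub_eq_zero]
      by_cases h1 : i.castSucc ∈ J
      · exact hpair J h1 fun h => hJ (by tauto)
      · have h2 : i.succ ∈ J := by tauto
        have := hpair (simple i • J)
          (by rw [← Finset.inv_smul_mem_iff, simple, Equiv.swap_inv, Equiv.Perm.smul_def,
                Equiv.swap_apply_left]; exact h2)
          (by rw [← Finset.inv_smul_mem_iff, simple, Equiv.swap_inv, Equiv.Perm.smul_def,
                Equiv.swap_apply_right]; exact h1)
        rw [simple_smul_smul] at this
        rw [add_comm (sortedProd (Y κ q) J).toEnd]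
        exact this
  · intro J _ hne heq
    apply hne
    have hJ : i.castSucc ∈ J ↔ i.succ ∈ J := by
      conv_lhs => rw [← heq, ← Finset.inv_smul_mem_iff, simple, Equiv.swap_inv,
        Equiv.Perm.smul_def, Equiv.swap_apply_left]
    rw [(commute_toEnd (hfix J hJ)).eq, sub_self]
  · intro J hJ
    simpa using hJ
  · intro J _
    exact simple_smul_smul i J

theorem sortedProd_Y (J : Finset (Fin (n + 1))) : sortedProd (Y κ q) J =
    (((J.sort (· ≤ ·)).map Fin.val).map (dunkl (extendOne (TPol κ)) (piOp q) n)).prod := by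
  rw [sortedProd, List.map_map]
  congr 2
  funext i
  exact Y_eq_dunkl κ q i

theorem sort_initial {r : ℕ} (hr : r ≤ n + 1) :
    ((initial n r).sort (· ≤ ·)).map Fin.val = List.range r := by
  apply List.SortedLT.eq_of_mem_iff
  · refine List.Pairwise.sortedLT (List.pairwise_map.mpr ?_)
    exact (Finset.sortedLT_sort _).pairwise.imp fun h => h
  · exact List.sortedLT_range _
  · intro x
    simp only [List.mem_map, Finset.mem_sort, mem_initial, List.mem_range]
    constructor
    · rintro ⟨y, hy, rfl⟩
      exact hy
    · exact fun hx => ⟨⟨x, by omega⟩, hx, rfl⟩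

theorem initial_full : initial n (n + 1) = Finset.univ := by
  ext x; simp [Nat.lt_succ_of_le x.is_le]

/-- For all N labels the rows are empty, so the product is π^N; a full turn is the trivial rotation
and scales every coordinate once. -/
theorem sortedProd_Y_univ : sortedProd (Y κ q) Finset.univ = qShift (n := n) q Finset.univ := by
  rw [sortedProd_Y, ← initial_full, sort_initial le_rfl,
    (isAffineBraid κ q).prod_dunkl_range le_rfl, piOp_pow q le_rfl, Nat.sub_self]
  have h1 : rows (extendOne (TPol (n := n) κ)) (n + 1) 0 = 1 := by
    have : ∀ r, rowsWord r 0 = [] := fun r => by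
      induction r with
      | zero => rfl
      | succ r ih => rw [rowsWord, ih]; rfl
    rw [rows, this]; rfl
  have h2 : (finRotate (n + 1))⁻¹ ^ (n + 1) = (1 : Equiv.Perm (Fin (n + 1))) := by
    ext x
    rw [finRotate_inv_pow_val _ le_rfl, if_pos x.2]
    simp
  rw [h1, h2, one_mul]
  rfl

theorem elemSymm_Y_compl {r : ℕ} (hr : r ≤ n + 1) : elemSymm (Y (n := n) κ q) (n + 1 - r) =
    (qShift q Finset.univ).toEnd * elemSymm (fun i => (Y κ q i)⁻¹) r := by
  rw [elemSymm_compl (Y_commute κ q) hr, sortedProd_Y_univ]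

theorem TPol_commute_qShift_univ (i : Fin n) :
    Commute (TPol κ i) (qShift q Finset.univ) :=
  (subst_mul_TPol κ (w := 1) (c := fun j => if j ∈ Finset.univ then q else 1) rfl rfl (by simp)).symm

theorem toEnd_inv_mul (g : GLVec n) : g⁻¹.toEnd * g.toEnd = 1 := by
  rw [← toEnd_mul, inv_mul_cancel]; rfl

/-- By complementation e_r(Y⁻¹) is the inverse of the total shift times e_{N-r}(Y), and both factors
commute with T_i. For r > N the sum is empty. -/
theorem TPol_commute_elemSymm_inv (i : Fin n) (r : ℕ) :
    Commute (TPol κ i).toEnd (elemSymm (fun i => (Y κ q i)⁻¹) r) := by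
  rcases le_or_gt r (n + 1) with hr | hr
  · have e : elemSymm (fun i => (Y κ q i)⁻¹) r =
        (qShift q Finset.univ)⁻¹.toEnd * elemSymm (Y (n := n) κ q) (n + 1 - r) := by
      rw [elemSymm_Y_compl κ q hr, ← mul_assoc, toEnd_inv_mul, one_mul]
    rw [e]
    exact (commute_toEnd (TPol_commute_qShift_univ κ q i).inv_right).mul_right
      (TPol_commute_elemSymm κ q i _)
  · rw [elemSymm_eq_zero _ hr]
    exact Commute.zero_right _

/-! ### Operators acting on the spins only -/

/-- Operators on the spins with constant coefficients. -/
structure IsSpin (A : Module.End ℂ (Vec n)) : Prop where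
  semi : IsSemi id A
  comm : ∀ w c, Commute A (subst w c).toEnd

theorem IsSpin.mul {A B : Module.End ℂ (Vec n)} (hA : IsSpin A) (hB : IsSpin B) :
    IsSpin (A * B) :=
  ⟨hA.semi.mul hB.semi, fun w c => (hA.comm w c).mul_left (hB.comm w c)⟩

theorem isSpin_one : IsSpin (1 : Module.End ℂ (Vec n)) :=
  ⟨fun _ _ => rfl, fun _ _ => Commute.one_left _⟩

theorem IsSpin.sub_smul {A : Module.End ℂ (Vec n)} (hA : IsSpin A) (c : ℂ) :
    IsSpin (A - c • 1) :=
  ⟨fun h Ψ => by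
    simp only [LinearMap.sub_apply, LinearMap.smul_apply, Module.End.one_apply, hA.semi h Ψ, id,
      smul_sub, smul_comm c h Ψ],
    fun w c' => (hA.comm w c').sub_left ((Commute.one_left _).smul_left c)⟩

theorem isSpin_TSp (i : Fin n) : IsSpin (TSp (n := n) κ i) := by
  refine ⟨isSemi_pairOp i _, fun w c => LinearMap.ext fun Ψ => funext fun σ => ?_⟩
  simp only [Module.End.mul_apply, toEnd_apply, subst_apply, TSp_apply]
  split_ifs <;> simp [substRat_cst]

theorem TPol_eq (i : Fin n) : (TPol κ i).toEnd = mulOp (aCoeff κ i.castSucc i.succ) *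
    (perm (simple i)).toEnd + mulOp (cst n κ - aCoeff κ i.castSucc i.succ) :=
  LinearMap.ext fun Ψ => funext fun σ => TPol_apply κ i Ψ σ

theorem IsSpin.commute_mulOp {A : Module.End ℂ (Vec n)} (hA : IsSpin A) (a : RatFn n) :
    Commute A (mulOp a) := LinearMap.ext fun Ψ => hA.semi a Ψ

theorem IsSpin.commute_TPol {A : Module.End ℂ (Vec n)} (hA : IsSpin A) (i : Fin n) :
    Commute A (TPol κ i).toEnd := by
  rw [TPol_eq]
  exact ((hA.commute_mulOp _).mul_right (hA.comm _ _)).add_right (hA.commute_mulOp _)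

/-- The invertible operators that commute with a given endomorphism. -/
def commutant (A : Module.End ℂ (Vec n)) : Subgroup (GLVec n) where
  carrier := {g | Commute A g.toEnd}
  mul_mem' hg hh := hg.mul_right hh
  one_mem' := Commute.one_right A
  inv_mem' {g} hg := by
    have h1 := toEnd_inv_mul g
    have h2 : g.toEnd * g⁻¹.toEnd = 1 := by rw [← toEnd_mul, mul_inv_cancel]; rfl
    change A * g⁻¹.toEnd = g⁻¹.toEnd * A
    calc A * g⁻¹.toEnd = (g⁻¹.toEnd * g.toEnd) * A * g⁻¹.toEnd := by rw [h1, one_mul]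
      _ = g⁻¹.toEnd * (A * g.toEnd) * g⁻¹.toEnd := by rw [mul_assoc g⁻¹.toEnd, ← hg.eq]
      _ = _ := by rw [mul_assoc, mul_assoc A, h2, mul_one]

theorem mem_commutant {A : Module.End ℂ (Vec n)} {g : GLVec n} :
    g ∈ commutant A ↔ Commute A g.toEnd := Iff.rfl

/-- Used for two subgroups: the commutant of a spin operator and the stabilizer of the polynomial
vectors. -/
theorem Y_mem {S : Subgroup (GLVec n)} (hT : ∀ i, TPol κ i ∈ S) (hp : piOp q ∈ S)
    (i : Fin (n + 1)) : Y κ q i ∈ S := by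
  refine S.mul_mem (S.mul_mem (S.list_prod_mem ?_) hp) (S.list_prod_mem ?_)
  · intro x hx
    obtain ⟨j, -, rfl⟩ := List.mem_map.mp hx
    exact hT j
  · intro x hx
    obtain ⟨j, -, rfl⟩ := List.mem_map.mp hx
    exact S.inv_mem (hT j)

theorem IsSpin.commute_elemSymm {A : Module.End ℂ (Vec n)} (hA : IsSpin A) (r : ℕ) :
    Commute A (elemSymm (Y κ q) r) ∧ Commute A (elemSymm (fun i => (Y κ q i)⁻¹) r) := by
  have hY : ∀ i, Y κ q i ∈ commutant A :=
    Y_mem κ q (fun i => hA.commute_TPol κ i) (hA.comm _ _)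
  exact ⟨Commute.sum_right _ _ _ fun J _ => sortedProd_mem hY J,
    Commute.sum_right _ _ _ fun J _ => sortedProd_mem (fun i => (commutant A).inv_mem (hY i)) J⟩

theorem spinMacdonald_natCast (r : ℕ) : spinMacdonald (n := n) κ q r = elemSymm (Y κ q) r := rfl

theorem elemSymm_zero (X : Fin (n + 1) → GLVec n) : elemSymm X 0 = 1 := by
  rw [elemSymm, Finset.powersetCard_zero, Finset.sum_singleton, Finset.sort_empty]
  rfl

theorem spinMacdonald_neg (r : ℕ) :
    spinMacdonald (n := n) κ q (-r) = elemSymm (fun i => (Y κ q i)⁻¹) r := by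
  cases r with
  | zero => rw [elemSymm_zero, ← elemSymm_zero (Y κ q)]; rfl
  | succ r => rfl

theorem spinMacdonald_commute (r s : ℤ) :
    Commute (spinMacdonald (n := n) κ q r) (spinMacdonald κ q s) := by
  have h := Y_commute (n := n) κ q
  cases r <;> cases s
  · exact elemSymm_commute h _ _
  · exact elemSymm_commute (fun i j => (h i j).inv_right) _ _
  · exact elemSymm_commute (fun i j => (h i j).inv_left) _ _
  · exact elemSymm_commute (fun i j => (h i j).inv_inv) _ _

/-- The operator commutes with each of the two Hecke actions separately, hence preserves the locus
where they agree. -/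
theorem spinMacdonald_invariant (r : ℤ) {Ψ : Vec n} (hΨ : IsInvariant κ Ψ) :
    IsInvariant κ (spinMacdonald κ q r Ψ) := by
  intro i
  have h1 : Commute (TSp κ i) (spinMacdonald (n := n) κ q r) := by
    cases r
    · exact ((isSpin_TSp κ i).commute_elemSymm κ q _).1
    · exact ((isSpin_TSp κ i).commute_elemSymm κ q _).2
  have h2 : Commute (TPol κ i).toEnd (spinMacdonald (n := n) κ q r) := by
    cases r
    · exact TPol_commute_elemSymm κ q i _
    · exact TPol_commute_elemSymm_inv κ q i _
  calc TSp κ i (spinMacdonald κ q r Ψ) = spinMacdonald κ q r (TSp κ i Ψ) :=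
        LinearMap.congr_fun h1.eq Ψ
    _ = spinMacdonald κ q r ((TPol κ i).toEnd Ψ) := by rw [hΨ i]; rfl
    _ = (TPol κ i).toEnd (spinMacdonald κ q r Ψ) := (LinearMap.congr_fun h2.eq Ψ).symm

/-! ### Polynomial vectors -/

/-- The invertible operators preserving the polynomial vectors, together with their inverses. -/
def polyStabilizer (n : ℕ) : Subgroup (GLVec n) where
  carrier := {g | ∀ Ψ, g Ψ ∈ polyVec n ↔ Ψ ∈ polyVec n}
  mul_mem' hg hh Ψ := (hg _).trans (hh Ψ)
  one_mem' _ := Iff.rfl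
  inv_mem' {g} hg Ψ := by
    rw [← hg, ← LinearEquiv.mul_apply, mul_inv_cancel]
    rfl

theorem subst_mem_polyVec (w : Equiv.Perm (Fin (n + 1))) (c : Fin (n + 1) → ℂˣ) {Ψ : Vec n}
    (h : Ψ ∈ polyVec n) : subst w c Ψ ∈ polyVec n := by
  intro σ
  obtain ⟨p, hp⟩ := h σ
  refine ⟨substPoly w c p, ?_⟩
  rw [subst_apply, ← hp, substRat, IsFractionRing.fieldEquivOfAlgEquiv_algebraMap]

theorem subst_inv (w : Equiv.Perm (Fin (n + 1))) (c : Fin (n + 1) → ℂˣ) :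
    (subst w c)⁻¹ = subst w⁻¹ fun i => (c (w⁻¹ i))⁻¹ := by
  rw [inv_eq_iff_mul_eq_one, subst_mul, mul_inv_cancel, ← subst_one]
  congr 1
  funext i
  simp

theorem subst_mem_polyStabilizer (w : Equiv.Perm (Fin (n + 1))) (c : Fin (n + 1) → ℂˣ) :
    subst w c ∈ polyStabilizer n := by
  intro Ψ
  refine ⟨fun h => ?_, subst_mem_polyVec w c⟩
  have := subst_mem_polyVec w⁻¹ (fun i => (c (w⁻¹ i))⁻¹) h
  rw [← subst_inv, ← LinearEquiv.mul_apply, inv_mul_cancel] at this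
  exact this

/-- Modulo z_i - z_{i+1} the swap becomes the identity, since the two algebra maps to the quotient
agree on the coordinates. -/
theorem dvd_sub_swap (i : Fin n) (p : Poly n) :
    (MvPolynomial.X i.castSucc - MvPolynomial.X i.succ : Poly n) ∣
      p - substPoly (simple i) 1 p := by
  rw [← Ideal.mem_span_singleton, ← Ideal.Quotient.mk_eq_mk_iff_sub_mem]
  set I : Ideal (Poly n) := Ideal.span {MvPolynomial.X i.castSucc - MvPolynomial.X i.succ}
  have hI : Ideal.Quotient.mk I (MvPolynomial.X i.castSucc) =
      Ideal.Quotient.mk I (MvPolynomial.X i.succ) :=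
    (Ideal.Quotient.mk_eq_mk_iff_sub_mem _ _).mpr (Ideal.mem_span_singleton_self _)
  have h : Ideal.Quotient.mkₐ ℂ I = (Ideal.Quotient.mkₐ ℂ I).comp
      (substPoly (simple i) 1 : Poly n →ₐ[ℂ] Poly n) := by
    apply MvPolynomial.algHom_ext
    intro k
    have e : substPoly (simple i) 1 (MvPolynomial.X k) = (MvPolynomial.X (simple i k) : Poly n) := by
      simp [substPoly]
    simp only [AlgHom.comp_apply, AlgEquiv.coe_toAlgHom, e, Ideal.Quotient.mkₐ_eq_mk]
    by_cases h1 : k = i.castSucc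
    · subst h1; rw [simple_castSucc, hI]
    · by_cases h2 : k = i.succ
      · subst h2; rw [simple_succ, hI]
      · rw [simple_of_ne h1 h2]
  exact DFunLike.congr_fun h p

theorem TPol_mem_polyVec (i : Fin n) {Ψ : Vec n} (h : Ψ ∈ polyVec n) :
    TPol κ i Ψ ∈ polyVec n := by
  intro σ
  obtain ⟨p, hp⟩ := h σ
  obtain ⟨d, hd⟩ := dvd_sub_swap i p
  have hs : substRat (simple i) 1 (Ψ σ) =
      algebraMap (Poly n) (RatFn n) (substPoly (simple i) 1 p) := by
    rw [← hp, substRat, IsFractionRing.fieldEquivOfAlgEquiv_algebraMap]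
  have hd' : Ψ σ - substRat (simple i) 1 (Ψ σ) =
      (z i.castSucc - z i.succ) * algebraMap (Poly n) (RatFn n) d := by
    rw [hs, ← hp, ← map_sub, hd, map_mul, map_sub]; rfl
  have hC : ∀ c, cst n c = algebraMap (Poly n) (RatFn n) (MvPolynomial.C c) := fun c => by
    rw [cst, IsScalarTower.algebraMap_apply ℂ (Poly n) (RatFn n), MvPolynomial.algebraMap_eq]
  refine ⟨-(MvPolynomial.C ((κ : ℂ)⁻¹) * (MvPolynomial.C ((κ : ℂ) ^ 2) *
    MvPolynomial.X i.castSucc - MvPolynomial.X i.succ) * d) + MvPolynomial.C (κ : ℂ) * p, ?_⟩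
  change _ = TPolEnd κ i Ψ σ
  rw [TPolEnd_apply, hd', inv_mul_cancel_left₀ (z_sub_ne (castSucc_ne_succ i))]
  simp only [map_add, map_neg, map_mul, map_sub, hC, hp]
  rfl

theorem TPol_mem_polyStabilizer (i : Fin n) : TPol κ i ∈ polyStabilizer n := by
  intro Ψ
  refine ⟨fun h => ?_, TPol_mem_polyVec κ i⟩
  -- The quadratic relation recovers Ψ from T_i Ψ by operations that preserve polynomials.
  have e : Ψ = TPol κ i (TPol κ i Ψ) - ((κ : ℂ) - (κ : ℂ)⁻¹) • TPol κ i Ψ := by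
    have := LinearMap.congr_fun (TPolEnd_hecke κ i) Ψ
    simp only [Module.End.mul_apply, LinearMap.add_apply, LinearMap.smul_apply,
      Module.End.one_apply] at this
    exact eq_sub_of_add_eq' this.symm
  rw [e]
  exact (polyVec n).sub_mem (TPol_mem_polyVec κ i h) ((polyVec n).smul_mem _ h)

theorem elemSymm_mem_polyVec {X : Fin (n + 1) → GLVec n} (hX : ∀ i, X i ∈ polyStabilizer n)
    (r : ℕ) {Ψ : Vec n} (h : Ψ ∈ polyVec n) : elemSymm X r Ψ ∈ polyVec n := by
  rw [elemSymm_eq, LinearMap.sum_apply]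
  exact Submodule.sum_mem _ fun J _ => (sortedProd_mem hX J Ψ).mpr h

theorem spinMacdonald_mem_polyVec (r : ℤ) {Ψ : Vec n} (h : Ψ ∈ polyVec n) :
    spinMacdonald κ q r Ψ ∈ polyVec n := by
  have hY : ∀ i, Y κ q i ∈ polyStabilizer n :=
    Y_mem κ q (TPol_mem_polyStabilizer κ) (subst_mem_polyStabilizer _ _)
  cases r
  · exact elemSymm_mem_polyVec hY _ h
  · exact elemSymm_mem_polyVec (fun i => (polyStabilizer n).inv_mem (hY i)) _ h

end Dunkl

/-! ### Grassmannian permutations -/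

theorem prod_fix {α : Type*} {l : List (Equiv.Perm α)} {x : α} (h : ∀ g ∈ l, g x = x) :
    l.prod x = x := by
  induction l with
  | nil => rfl
  | cons g l ih =>
    rw [List.prod_cons, Equiv.Perm.mul_apply, ih fun g hg => h g (List.mem_cons_of_mem _ hg),
      h g List.mem_cons_self]

/-- Follows one point through a product of cycles: the factors to the right of the m-th leave x
alone, the m-th moves it to b, and those to the left leave b alone. -/
theorem prod_ofFn_apply {α : Type*} {r : ℕ} (g : Fin r → Equiv.Perm α) (m : Fin r) {x b : α}
    (h1 : g m x = b) (h2 : ∀ k, m < k → g k x = x) (h3 : ∀ k < m, g k b = b) :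
    (List.ofFn g).prod x = b := by
  induction r with
  | zero => exact m.elim0
  | succ r ih =>
    rw [List.ofFn_succ, List.prod_cons, Equiv.Perm.mul_apply]
    induction m using Fin.cases with
    | zero =>
      rw [prod_fix, h1]
      intro f hf
      obtain ⟨k, rfl⟩ := (List.mem_ofFn' _ _).mp hf
      exact h2 _ (Fin.succ_pos k)
    | succ m =>
      rw [ih (fun k => g k.succ) m h1 (fun k hk => h2 _ (Fin.succ_lt_succ_iff.mpr hk))
        fun k hk => h3 _ (Fin.succ_lt_succ_iff.mpr hk), h3 0 (Fin.succ_pos m)]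

theorem prod_ofFn_reverse_apply {α : Type*} {r : ℕ} (g : Fin r → Equiv.Perm α) (m : Fin r)
    {x b : α} (h1 : g m x = b) (h2 : ∀ k < m, g k x = x) (h3 : ∀ k, m < k → g k b = b) :
    (List.ofFn g).reverse.prod x = b := by
  have e : (List.ofFn g).reverse.prod = ((List.ofFn fun k => (g k)⁻¹).prod)⁻¹ := by
    rw [List.prod_inv_reverse, List.map_ofFn]
    congr 3
  rw [e, Equiv.Perm.inv_eq_iff_eq]
  refine (prod_ofFn_apply _ m ?_ (fun k hk => ?_) fun k hk => ?_).symm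
  · rw [Equiv.Perm.inv_eq_iff_eq, h1]
  · rw [Equiv.Perm.inv_eq_iff_eq, h3 k hk]
  · rw [Equiv.Perm.inv_eq_iff_eq, h2 k hk]

theorem descCycle_apply_left {i j : Fin (n + 1)} (h : i ≤ j) : descCycle j i i = j := by
  rw [descCycle, Equiv.Perm.inv_eq_iff_eq, Fin.cycleIcc_of_last h]

theorem descCycle_of_lt {i j k : Fin (n + 1)} (h : k < i) : descCycle j i k = k := by
  rw [descCycle, Equiv.Perm.inv_eq_iff_eq, Fin.cycleIcc_of_lt h]

theorem descCycle_of_gt {i j k : Fin (n + 1)} (h : j < k) : descCycle j i k = k := by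
  rw [descCycle, Equiv.Perm.inv_eq_iff_eq, Fin.cycleIcc_of_gt h]

theorem strictMono_add_sub_le {r : ℕ} {f : Fin r → ℕ} (hf : StrictMono f) (a : Fin r) (d : ℕ)
    (h : (a : ℕ) + d < r) : f a + d ≤ f ⟨a + d, h⟩ := by
  induction d with
  | zero => rfl
  | succ d ih =>
    have h1 := ih (by omega)
    have h2 : f ⟨a + d, by omega⟩ < f ⟨a + (d + 1), h⟩ := hf (by rw [Fin.lt_def]; simp)
    omega

theorem le_orderEmbOfFin (J : Finset (Fin (n + 1))) (m : Fin J.card) :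
    (m : ℕ) ≤ J.orderEmbOfFin rfl m := by
  have := strictMono_add_sub_le (f := fun m => (J.orderEmbOfFin rfl m : ℕ))
    (fun a b h => (J.orderEmbOfFin rfl).strictMono h) ⟨0, m.pos⟩ m (by simp)
  simp only [zero_add] at this
  exact le_of_add_le_right this

theorem orderEmbOfFin_le (J : Finset (Fin (n + 1))) (m : Fin J.card) :
    (J.orderEmbOfFin rfl m : ℕ) + J.card ≤ n + 1 + m := by
  have := strictMono_add_sub_le (f := fun m => (J.orderEmbOfFin rfl m : ℕ))
    (fun a b h => (J.orderEmbOfFin rfl).strictMono h) m (J.card - 1 - m) (by omega)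
  have h2 := (J.orderEmbOfFin rfl ⟨m + (J.card - 1 - m), by omega⟩).is_le
  omega

theorem grass_apply (J : Finset (Fin (n + 1))) (m : Fin J.card) (x : Fin (n + 1))
    (hx : (x : ℕ) = m) : grass J x = J.orderEmbOfFin rfl m := by
  obtain rfl : x = m.castLE (by simpa using J.card_le_univ) := Fin.ext hx
  refine prod_ofFn_apply _ m (descCycle_apply_left ?_) (fun k hk => descCycle_of_lt hk)
    fun k hk => descCycle_of_gt ?_
  · exact le_orderEmbOfFin J m
  · exact (J.orderEmbOfFin rfl).strictMono hk

theorem smul_eq_of_forall_mem {w : Equiv.Perm (Fin (n + 1))} {I J : Finset (Fin (n + 1))}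
    (hc : I.card = J.card) (h : ∀ x ∈ I, w x ∈ J) : w • I = J := by
  apply Finset.eq_of_subset_of_card_le
  · intro y hy
    obtain ⟨x, hx, rfl⟩ := Finset.mem_smul_finset.mp hy
    exact h x hx
  · rw [Finset.card_smul_finset, hc]

theorem card_initial {r : ℕ} (hr : r ≤ n + 1) : (initial n r).card = r := by
  have := congrArg List.length (sort_initial (n := n) hr)
  simpa using this

theorem card_le_succ (J : Finset (Fin (n + 1))) : J.card ≤ n + 1 := by
  simpa using J.card_le_univ

/-- The one property of the Grassmannian permutation used from here on; by `dressedShift_eq` any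
other permutation with this property gives the same operator. -/
theorem grass_smul_initial (J : Finset (Fin (n + 1))) : grass J • initial n J.card = J := by
  apply smul_eq_of_forall_mem (card_initial (card_le_succ J))
  intro x hx
  rw [grass_apply J ⟨x, mem_initial.mp hx⟩ x rfl]
  exact Finset.orderEmbOfFin_mem J rfl _

theorem grassNeg_apply (J : Finset (Fin (n + 1))) (m : Fin J.card) (x : Fin (n + 1))
    (hx : (x : ℕ) = n + 1 - J.card + m) : grassNeg J x = J.orderEmbOfFin rfl m := by
  have hc := card_le_succ J
  refine prod_ofFn_reverse_apply _ m ?_ (fun k hk => Fin.cycleIcc_of_gt ?_)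
    fun k hk => Fin.cycleIcc_of_lt ?_
  · rw [show x = ⟨n + 1 - J.card + m, by omega⟩ from Fin.ext hx]
    apply Fin.cycleIcc_of_last
    rw [Fin.le_def]
    have := orderEmbOfFin_le J m
    simp only
    omega
  · rw [Fin.lt_def] at hk ⊢
    simp only [hx]
    omega
  · exact (J.orderEmbOfFin rfl).strictMono hk

/-- The last labels go to J, so the first ones go to its complement. The statement takes this form
because the formula in negative degree is obtained from the positive formula at complementary sets.
-/
theorem grassNeg_smul (J : Finset (Fin (n + 1))) :
    grassNeg J • initial n (n + 1 - J.card) = Jᶜ := by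
  have hc := card_le_succ J
  have h : grassNeg J • (initial n (n + 1 - J.card))ᶜ = J := by
    apply smul_eq_of_forall_mem
    · rw [Finset.card_compl, card_initial (by omega), Fintype.card_fin]
      omega
    · intro x hx
      rw [Finset.mem_compl, mem_initial, not_lt] at hx
      rw [grassNeg_apply J ⟨x - (n + 1 - J.card), by omega⟩ x (by simp; omega)]
      exact Finset.orderEmbOfFin_mem J rfl _
  ext y
  rw [Finset.mem_compl, ← Finset.inv_smul_mem_iff]
  conv_rhs => rw [← h, ← Finset.inv_smul_mem_iff, Finset.mem_compl, not_not]

/-! ### Induction on descents -/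

theorem perm_eq_one_of_strictMono {w : Equiv.Perm (Fin (n + 1))} (h : StrictMono w) : w = 1 := by
  have e := Subsingleton.elim (h.orderIsoOfSurjective _ w.surjective) (OrderIso.refl _)
  ext x
  exact congrArg Fin.val (DFunLike.congr_fun e x)

/-- Undoing a descent makes the sequence of values lexicographically smaller, which is well founded;
a permutation without descents is increasing and hence trivial. -/
theorem perm_descent_induction {P : Equiv.Perm (Fin (n + 1)) → Prop} (one : P 1)
    (step : ∀ v i, v (Fin.succ i) < v (Fin.castSucc i) → P (v * simple i) → P v)
    (v : Equiv.Perm (Fin (n + 1))) : P v := by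
  induction v using (InvImage.wf (fun v : Equiv.Perm (Fin (n + 1)) => toLex (v : _ → _))
    (wellFounded_lt (α := Lex (Fin (n + 1) → Fin (n + 1))))).induction with
  | _ v ih =>
    by_cases h : ∃ i : Fin n, v i.succ < v i.castSucc
    · obtain ⟨i, hi⟩ := h
      refine step v i hi (ih _ ⟨i.castSucc, fun j hj => ?_, ?_⟩)
      · change v (simple i j) = v j
        rw [simple_of_ne hj.ne (hj.trans Fin.castSucc_lt_succ).ne]
      · change v (simple i i.castSucc) < v i.castSucc
        rwa [simple_castSucc]
    · push Not at h
      have hm : StrictMono v := by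
        rw [Fin.strictMono_iff_lt_succ]
        exact fun i => lt_of_le_of_ne (h i) fun he => castSucc_ne_succ i (v.injective he)
      rw [perm_eq_one_of_strictMono hm]
      exact one

/-! ### The dressed shifts -/

theorem qShift_apply (q : ℂˣ) (J : Finset (Fin (n + 1))) (Ψ : Vec n)
    (σ : Fin (n + 1) → Fin 2) :
    qShift q J Ψ σ = substRat 1 (fun j => if j ∈ J then q else 1) (Ψ σ) := rfl

/-- The `R`-matrix sees only the ratio z_i / z_{i+1}, which is unchanged when both coordinates or
neither are scaled. -/
theorem sTotGen_commute_qShift (κ q : ℂˣ) {i : Fin n} {J : Finset (Fin (n + 1))}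
    (h : i.castSucc ∈ J ↔ i.succ ∈ J) : Commute (sTotGen κ i) (qShift q J) := by
  set c : Fin (n + 1) → ℂˣ := fun j => if j ∈ J then q else 1 with hc
  have hcc : c i.castSucc = c i.succ := by simp only [hc, h]
  have d1 := t_z_sub_ne κ (castSucc_ne_succ i).symm
  have d2 := cst_unit_ne (n := n) (c i.succ)
  have hs : ∀ F : RatFn n, substRat (simple i) 1 (substRat 1 c F) =
      substRat 1 c (substRat (simple i) 1 F) := fun F => by
    rw [substRat_substRat, substRat_substRat, one_mul, mul_one]
    congr 2
    funext k
    by_cases hk : k = i.castSucc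
    · subst hk; simp [simple_castSucc, hcc]
    · by_cases hk' : k = i.succ
      · subst hk'; simp [simple_succ, hcc]
      · simp [simple_of_ne hk hk']
  refine LinearEquiv.ext fun Ψ => funext fun σ => ?_
  have hx : substRat 1 c (z i.castSucc) = cst n (c i.succ) * z i.castSucc := by
    rw [substRat_z, hcc]; rfl
  have hy : substRat 1 c (z i.succ) = cst n (c i.succ) * z i.succ := substRat_z _ _ _
  simp only [LinearEquiv.mul_apply, sTotGen_apply, qShift_apply, ← hc]
  generalize cst n (c i.succ : ℂ) = e at *
  have d3 : cst n (κ : ℂ) ^ 2 * (e * z i.succ) - e * z i.castSucc =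
      e * (cst n κ ^ 2 * z i.succ - z i.castSucc) := by ring
  split_ifs <;> simp only [hs, map_div₀, map_add, map_mul, map_sub, map_pow, map_one, substRat_cst,
    hx, hy, d3] <;> field_simp

/-- A permutation preserving the first r labels has no descent across the boundary, so descent
induction stays inside the Young subgroup, whose generators commute with the shift. -/
theorem sTot_commute_qShift (κ q : ℂˣ) {r : ℕ} (v : Equiv.Perm (Fin (n + 1)))
    (hv : v • initial n r = initial n r) : Commute (sTot κ v) (qShift q (initial n r)) := by
  induction v using perm_descent_induction with
  | one => rw [sTot_one]; exact Commute.one_left _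
  | step v i hi ih =>
    have hmem : ∀ x, x ∈ initial n r ↔ v x ∈ initial n r := fun x => by
      conv_rhs => rw [← hv, ← Equiv.Perm.smul_def, Finset.smul_mem_smul_finset_iff]
    have hiff : i.castSucc ∈ initial n r ↔ i.succ ∈ initial n r := by
      constructor
      · intro h
        rw [hmem, mem_initial] at h ⊢
        exact (Fin.lt_def.mp hi).trans h
      · simp only [mem_initial, Fin.val_castSucc, Fin.val_succ]
        omega
    have h1 := ih (by rw [mul_smul, simple_smul_eq_self hiff, hv])
    have h2 := sTotGen_commute_qShift κ q hiff
    have e : v = v * simple i * simple i := by rw [mul_assoc, simple_mul_self, mul_one]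
    rw [e, sTot_mul, sTot_simple]
    exact h1.mul_left h2

/-- The shift `q̂_I` dressed by `R`-matrices. -/
def dressedShift (κ q : ℂˣ) (I : Finset (Fin (n + 1))) : GLVec n :=
  sTot κ (grass I) * qShift q (initial n I.card) * (sTot κ (grass I))⁻¹

/-- Two permutations with the same image of the initial set differ on the right by an element of its
stabilizer, and that element commutes with the bare shift. -/
theorem dressedShift_eq (κ q : ℂˣ) (w : Equiv.Perm (Fin (n + 1))) {r : ℕ} (hr : r ≤ n + 1) :
    sTot κ w * qShift q (initial n r) * (sTot κ w)⁻¹ = dressedShift κ q (w • initial n r) := by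
  set I := w • initial n r with hI
  have hcard : I.card = r := by rw [hI, Finset.card_smul_finset, card_initial hr]
  have hg := grass_smul_initial I
  rw [hcard] at hg
  have hc := sTot_commute_qShift κ q (r := r) ((grass I)⁻¹ * w) (by
    rw [mul_smul, ← hI, inv_smul_eq_iff, hg])
  rw [sTot_mul, sTot_inv] at hc
  rw [dressedShift, hcard, mul_inv_eq_iff_eq_mul]
  calc _ = sTot κ (grass I) * ((sTot κ (grass I))⁻¹ * sTot κ w * qShift q (initial n r)) := by
        group
    _ = _ := by rw [hc.eq]; group

theorem sTot_mul_dressedShift (κ q : ℂˣ) (v : Equiv.Perm (Fin (n + 1)))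
    (I : Finset (Fin (n + 1))) :
    sTot κ v * dressedShift κ q I = dressedShift κ q (v • I) * sTot κ v := by
  have h := dressedShift_eq κ q (v * grass I) (card_le_succ I)
  rw [mul_smul, grass_smul_initial, sTot_mul] at h
  rw [← h, dressedShift]
  group

theorem perm_conj_qShift (q : ℂˣ) (w : Equiv.Perm (Fin (n + 1))) (J : Finset (Fin (n + 1))) :
    (perm w)⁻¹ * qShift q (w • J) * perm w = qShift q J := by
  rw [← perm_inv, perm, perm, qShift, subst_mul, subst_mul, qShift]
  congr 1
  · simp
  · funext i
    have : w i ∈ w • J ↔ i ∈ J := Finset.smul_mem_smul_finset_iff w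
    simp [this]

/-- The dressed shift in terms of `Ř`. -/
theorem RCheck_conj (κ q : ℂˣ) (w : Equiv.Perm (Fin (n + 1))) {r : ℕ} (hr : r ≤ n + 1) :
    (RCheck κ w⁻¹)⁻¹ * qShift q (w • initial n r) * RCheck κ w⁻¹ =
      dressedShift κ q (w • initial n r) := by
  have h1 := perm_conj_qShift q w (initial n r)
  rw [RCheck_inv, ← dressedShift_eq κ q w hr, ← h1, RCheck, inv_inv, sTot_inv]
  group

/-- On scalars s^tot_w acts as s_w, and conjugation by s_w carries the shift of the initial set to
the shift of I. -/
theorem dressedShift_semi (κ q : ℂˣ) (I : Finset (Fin (n + 1))) :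
    IsSemi (substRat 1 fun j => if j ∈ I then q else 1) (dressedShift κ q I).toEnd := by
  have h1 := isSemi_sTot κ (grass I)
  have h2 := isSemi_subst 1 fun j : Fin (n + 1) => if j ∈ initial n I.card then q else 1
  have h3 := isSemi_sTot κ (grass I)⁻¹
  have h := (h1.mul h2).mul h3
  have e : dressedShift κ q I = sTot κ (grass I) * subst 1 (fun j => if j ∈ initial n I.card then q
      else 1) * sTot κ (grass I)⁻¹ := by rw [sTot_inv]; rfl
  have hθ : ∀ x : RatFn n, substRat (grass I) 1 (substRat 1 (fun j => if j ∈ initial n I.card then q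
      else 1) (substRat (grass I)⁻¹ 1 x)) = substRat 1 (fun j => if j ∈ I then q else 1) x := by
    intro x
    rw [substRat_substRat, substRat_substRat]
    congr 2
    · simp
    · funext j
      have : (grass I)⁻¹ j ∈ initial n I.card ↔ j ∈ I := by
        conv_rhs => rw [← grass_smul_initial I, ← Finset.inv_smul_mem_iff, Equiv.Perm.smul_def]
      simp only [Pi.one_apply, one_mul, mul_one]
      exact if_congr this rfl rfl
  intro x Ψ
  rw [e, ← hθ]
  exact h x Ψ

theorem sTot_dressedShift_apply {κ : ℂˣ} (q : ℂˣ) {Ψ : Vec n} (hΨ : IsInvariant κ Ψ)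
    (v : Equiv.Perm (Fin (n + 1))) (I : Finset (Fin (n + 1))) :
    sTot κ v (dressedShift κ q I Ψ) = dressedShift κ q (v • I) Ψ := by
  have := LinearEquiv.congr_fun (sTot_mul_dressedShift κ q v I) Ψ
  rwa [LinearEquiv.mul_apply, LinearEquiv.mul_apply, isInvariant_iff.mp hΨ] at this

/-! ### Expansions in the dressed shifts -/

/-- Families of coefficients of the dressed shifts. -/
abbrev Coeffs (n : ℕ) : Type := Finset (Fin (n + 1)) → Module.End ℂ (Vec n)

/-- The combination of dressed shifts with given coefficients. -/
def evalC (κ q : ℂˣ) (C : Coeffs n) (Ψ : Vec n) : Vec n := ∑ I, C I (dressedShift κ q I Ψ)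

/-- The operator `a s_i` with `a = a_{i,i+1}`. -/
def aS (κ : ℂˣ) (i : Fin n) : Module.End ℂ (Vec n) :=
  mulOp (aCoeff κ i.castSucc i.succ) * (perm (simple i)).toEnd

/-- The action of the Demazure–Lusztig operators on coefficients. -/
def TCoeffs (κ : ℂˣ) (i : Fin n) (C : Coeffs n) : Coeffs n := fun I =>
  aS κ i * C (simple i • I) * (sTotGen κ i).toEnd
    + mulOp (cst n κ - aCoeff κ i.castSucc i.succ) * C I

/-- In the leading part reindex by I ↦ s_i I and use D_{s_i I} Ψ = s_i^tot D_I Ψ. The inserted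
s_i^tot compensates s_i on scalars, so the new coefficients are again linear over the rational
functions, and they do not involve q. -/
theorem TPol_evalC {κ : ℂˣ} (q : ℂˣ) (i : Fin n) (C : Coeffs n) {Ψ : Vec n}
    (hΨ : IsInvariant κ Ψ) : TPol κ i (evalC κ q C Ψ) = evalC κ q (TCoeffs κ i C) Ψ := by
  have h1 : ∀ I, sTotGen κ i (dressedShift κ q I Ψ) = dressedShift κ q (simple i • I) Ψ := fun I => by
    rw [← sTot_simple, sTot_dressedShift_apply q hΨ]
  have h2 : ∑ I, aS κ i (C I (dressedShift κ q I Ψ)) =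
      ∑ I, aS κ i (C (simple i • I) (dressedShift κ q (simple i • I) Ψ)) :=
    (Equiv.sum_comp (MulAction.toPerm (simple i)) fun I => aS κ i (C I (dressedShift κ q I Ψ))).symm
  rw [← toEnd_apply, TPol_eq, ← aS, LinearMap.add_apply, evalC, map_sum, map_sum, h2,
    ← Finset.sum_add_distrib, evalC]
  refine Finset.sum_congr rfl fun I _ => ?_
  rw [TCoeffs, LinearMap.add_apply, Module.End.mul_apply, Module.End.mul_apply,
    Module.End.mul_apply, toEnd_apply, h1]

/-- The action of a word. -/
def wordCoeffs (κ : ℂˣ) (l : List (Fin n)) (C : Coeffs n) : Coeffs n := l.foldr (TCoeffs κ) C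

theorem word_evalC {κ : ℂˣ} (q : ℂˣ) (l : List (Fin n)) (C : Coeffs n) {Ψ : Vec n}
    (hΨ : IsInvariant κ Ψ) :
    (l.map (TPol κ)).prod (evalC κ q C Ψ) = evalC κ q (wordCoeffs κ l C) Ψ := by
  induction l with
  | nil => rfl
  | cons i l ih =>
    rw [List.map_cons, List.prod_cons, LinearEquiv.mul_apply, ih, TPol_evalC q i _ hΨ]
    rfl

theorem TCoeffs_semi (κ : ℂˣ) (i : Fin n) {C : Coeffs n} (hC : ∀ I, IsSemi id (C I))
    (I : Finset (Fin (n + 1))) : IsSemi id (TCoeffs κ i C I) := by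
  have h1 : IsSemi (substRat (simple i) 1) (aS κ i) :=
    (isSemi_mulOp _).mul (isSemi_subst (simple i) 1)
  have h2 := (h1.mul (hC (simple i • I))).mul (isSemi_sTotGen κ i)
  have h3 : IsSemi id (aS κ i * C (simple i • I) * (sTotGen κ i).toEnd) := by
    intro h Ψ
    rw [h2 h Ψ]
    simp only [Function.comp_apply, id, substRat_simple_simple]
  exact h3.add ((isSemi_mulOp _).mul (hC I))

theorem wordCoeffs_semi (κ : ℂˣ) (l : List (Fin n)) {C : Coeffs n} (hC : ∀ I, IsSemi id (C I))
    (I : Finset (Fin (n + 1))) : IsSemi id (wordCoeffs κ l C I) := by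
  induction l generalizing I with
  | nil => exact hC I
  | cons i l ih => exact TCoeffs_semi κ i ih I

/-- The cyclic permutation underlying `π^r`. -/
def rot (n r : ℕ) : Equiv.Perm (Fin (n + 1)) := (finRotate (n + 1))⁻¹ ^ r

/-- The coefficients of `π^r`. -/
def piCoeffs (κ : ℂˣ) (r : ℕ) : Coeffs n := fun I =>
  if I = rot n r • initial n r then (perm (rot n r)).toEnd * (sTot κ (rot n r)⁻¹).toEnd else 0

/-- Factor π^r as a rotation times the shift of the first r labels, and rewrite that shift on Ψ
through the dressed shift at the rotated set, namely the last r labels. This again makes the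
coefficient linear over the rational functions. -/
theorem piOp_pow_evalC {κ : ℂˣ} (q : ℂˣ) {r : ℕ} (hr : r ≤ n + 1) {Ψ : Vec n}
    (hΨ : IsInvariant κ Ψ) : (piOp q ^ r) Ψ = evalC κ q (piCoeffs κ r) Ψ := by
  have e1 : piOp (n := n) q ^ r = perm (rot n r) * qShift q (initial n r) := by
    rw [piOp_pow q hr, perm, qShift, subst_mul, mul_one]
    congr 1
    funext j
    simp
  have e2 : qShift q (initial n r) Ψ =
      sTot κ (rot n r)⁻¹ (dressedShift κ q (rot n r • initial n r) Ψ) := by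
    rw [sTot_dressedShift_apply q hΨ, inv_smul_smul]
    have := dressedShift_eq κ q (1 : Equiv.Perm (Fin (n + 1))) hr
    rw [one_smul, sTot_one, one_mul, inv_one, mul_one] at this
    rw [this]
  rw [e1, LinearEquiv.mul_apply, e2, evalC,
    Finset.sum_eq_single (rot n r • initial n r) (fun I _ hI => by rw [piCoeffs, if_neg hI]; rfl)
      (fun h => absurd (Finset.mem_univ _) h), piCoeffs, if_pos rfl]
  rfl

theorem piCoeffs_semi (κ : ℂˣ) (r : ℕ) (I : Finset (Fin (n + 1))) :
    IsSemi id (piCoeffs κ r I) := by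
  rw [piCoeffs]
  split_ifs
  · have h := (isSemi_subst (rot n r) 1).mul (isSemi_sTot κ (rot n r)⁻¹)
    intro x Ψ
    refine (h x Ψ).trans ?_
    rw [Function.comp_apply, ← substRat_mul, mul_inv_cancel, substRat_one]
    rfl
  · exact fun x Ψ => (smul_zero _).symm

/-! ### Weights and leading coefficients -/

/-- The sum of the labels in a set. -/
def wt (I : Finset (Fin (n + 1))) : ℕ := ∑ x ∈ I, (x : ℕ)

theorem wt_simple_smul (i : Fin n) (I : Finset (Fin (n + 1))) :
    wt (simple i • I) ≤ wt I + 1 := by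
  have key : wt (simple i • I) = ∑ x ∈ I, ((simple i x : Fin (n + 1)) : ℕ) := by
    rw [wt, Finset.smul_finset_def, Finset.sum_image (fun x _ y _ h => MulAction.injective _ h)]
    rfl
  rw [key, wt]
  by_cases h : i.castSucc ∈ I
  · rw [← Finset.add_sum_erase _ _ h, ← Finset.add_sum_erase (a := i.castSucc) _ _ h,
      simple_castSucc, Fin.val_succ, Fin.val_castSucc, add_right_comm]
    gcongr with x hx
    have hne : (x : ℕ) ≠ i := fun h' => (Finset.mem_erase.mp hx).1 (Fin.ext h')
    rw [simple_val, if_neg hne]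
    split_ifs <;> omega
  · refine le_trans (Finset.sum_le_sum fun x hx => ?_) (Nat.le_succ _)
    have hne : (x : ℕ) ≠ i := fun h' => h (by rwa [← show x = i.castSucc from Fin.ext h'])
    rw [simple_val, if_neg hne]
    split_ifs <;> omega

theorem wt_le_word_smul (l : List (Fin n)) (I : Finset (Fin (n + 1))) :
    wt I ≤ wt ((l.map simple).prod • I) + l.length := by
  induction l with
  | nil => simp
  | cons i l ih =>
    have := wt_simple_smul i (simple i • (l.map simple).prod • I)
    rw [simple_smul_smul] at this
    rw [List.map_cons, List.prod_cons, mul_smul, List.length_cons]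
    omega

/-- Each letter either keeps the set or applies s_i, which changes the weight by at most one; the
start is the set of the last r labels. -/
theorem wordCoeffs_support {κ : ℂˣ} {r : ℕ} (hr : r ≤ n + 1) (l : List (Fin n))
    {I : Finset (Fin (n + 1))} (hI : wordCoeffs κ l (piCoeffs κ r) I ≠ 0) :
    I.card = r ∧ wt (rot n r • initial n r) ≤ wt I + l.length := by
  induction l generalizing I with
  | nil =>
    change piCoeffs κ r I ≠ 0 at hI
    have : I = rot n r • initial n r := by
      by_contra h
      exact hI (if_neg h)
    subst this
    exact ⟨by rw [Finset.card_smul_finset, card_initial hr], le_rfl⟩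
  | cons i l ih =>
    change TCoeffs κ i (wordCoeffs κ l (piCoeffs κ r)) I ≠ 0 at hI
    rw [List.length_cons]
    by_cases h : wordCoeffs κ l (piCoeffs κ r) I = 0
    · have h' : wordCoeffs κ l (piCoeffs κ r) (simple i • I) ≠ 0 := by
        intro h'
        apply hI
        rw [TCoeffs, h, h', mul_zero, zero_mul, mul_zero, add_zero]
      have h1 := ih h'
      rw [Finset.card_smul_finset] at h1
      have h2 := wt_simple_smul i I
      exact ⟨h1.1, by omega⟩
    · have h1 := ih h
      exact ⟨h1.1, by omega⟩

/-- If a word moves the set `{N-r+1, …, N}` down at every step, the coefficient at the final set is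
the product of the leading terms. -/
theorem wordCoeffs_leading {κ : ℂˣ} {r : ℕ} (hr : r ≤ n + 1) (l : List (Fin n))
    (h : wt (((l.map simple).prod * rot n r) • initial n r) + l.length
      = wt (rot n r • initial n r)) :
    wordCoeffs κ l (piCoeffs κ r) (((l.map simple).prod * rot n r) • initial n r) =
      (l.map (aS κ)).prod * (perm (rot n r)).toEnd *
        (sTot κ ((l.map simple).prod * rot n r)⁻¹).toEnd := by
  induction l with
  | nil =>
    rw [List.map_nil, List.prod_nil, List.map_nil, List.prod_nil, one_mul, one_mul]
    exact if_pos rfl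
  | cons i l ih =>
    set v := (l.map simple).prod * rot n r with hv
    have hv' : ((i :: l).map simple).prod * rot n r = simple i * v := by
      rw [List.map_cons, List.prod_cons, mul_assoc]
    rw [hv', mul_smul, List.length_cons] at h
    -- The final set is one unit lighter than the remaining letters can reach, so the diagonal part
    -- of T_i contributes nothing.
    have h0 : wordCoeffs κ l (piCoeffs κ r) (simple i • v • initial n r) = 0 := by
      by_contra h'
      have := (wordCoeffs_support hr l h').2
      omega
    have h1 := wt_simple_smul i (simple i • v • initial n r)
    rw [simple_smul_smul] at h1
    have h2 : wt (v • initial n r) + l.length = wt (rot n r • initial n r) := by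
      apply le_antisymm
      · omega
      · rw [hv, mul_smul]
        exact wt_le_word_smul l _
    rw [hv', mul_smul]
    change TCoeffs κ i (wordCoeffs κ l (piCoeffs κ r)) _ = _
    have e : sTot κ (simple i * v)⁻¹ = sTot κ v⁻¹ * sTotGen κ i := by
      rw [mul_inv_rev, sTot_mul, sTot_inv κ (simple i), sTot_simple,
        inv_eq_of_mul_eq_one_left (sTotGen_mul_self κ i)]
    rw [TCoeffs, h0, mul_zero, add_zero, simple_smul_smul, ih h2, List.map_cons,
      List.prod_cons, e, toEnd_mul]
    simp only [mul_assoc]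

/-! ### The leading term of `Y_1 ⋯ Y_r` -/

theorem rows_simple_val {r L : ℕ} (h : r + L ≤ n + 1) (x : Fin (n + 1)) :
    ((rows (extendOne simple) r L x : Fin (n + 1)) : ℕ) =
      if (x : ℕ) < L then x + r else if (x : ℕ) < r + L then x - L else x := by
  induction r with
  | zero =>
    change (x : ℕ) = _
    split_ifs <;> omega
  | succ r ih =>
    rw [rows_succ, Equiv.Perm.mul_apply, seg_simple_val (by omega), ih (by omega)]
    split_ifs <;> omega

theorem rows_simple_mul_rot {r : ℕ} (hr : r ≤ n + 1) :
    rows (extendOne simple) r (n + 1 - r) * rot n r = 1 := by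
  ext x
  rw [Equiv.Perm.mul_apply, rows_simple_val (by omega), rot, finRotate_inv_pow_val r hr,
    Equiv.Perm.one_apply]
  have := x.2
  split_ifs <;> omega

/-- The function `a_{ij}` with indices in `ℕ`. -/
def aNat (n : ℕ) (κ : ℂˣ) (i j : ℕ) : RatFn n :=
  if h : i < n + 1 ∧ j < n + 1 then aCoeff κ ⟨i, h.1⟩ ⟨j, h.2⟩ else 1

theorem substRat_aNat (κ : ℂˣ) (w : Equiv.Perm (Fin (n + 1))) {i j i' j' : ℕ} (hi : i < n + 1)
    (hj : j < n + 1) (h1 : (w ⟨i, hi⟩ : ℕ) = i') (h2 : (w ⟨j, hj⟩ : ℕ) = j') :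
    substRat w 1 (aNat n κ i j) = aNat n κ i' j' := by
  subst h1 h2
  rw [aNat, dif_pos ⟨hi, hj⟩, substRat_aCoeff κ (by rfl), aNat, dif_pos ⟨Fin.is_lt _, Fin.is_lt _⟩]

theorem mulOp_mul (a b : RatFn n) : mulOp a * mulOp b = mulOp (a * b) :=
  (map_mul (Algebra.lsmul ℂ ℂ (Vec n)) a b).symm

theorem mulOp_one : mulOp (1 : RatFn n) = 1 := map_one (Algebra.lsmul ℂ ℂ (Vec n))

theorem perm_mul_mulOp (w : Equiv.Perm (Fin (n + 1))) (a : RatFn n) :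
    (perm w).toEnd * mulOp a = mulOp (substRat w 1 a) * (perm w).toEnd :=
  LinearMap.ext fun Ψ => isSemi_subst w 1 a Ψ

theorem mulOp_perm_mul (a b : RatFn n) (v w : Equiv.Perm (Fin (n + 1))) :
    (mulOp a * (perm v).toEnd) * (mulOp b * (perm w).toEnd) =
      mulOp (a * substRat v 1 b) * (perm (v * w)).toEnd := by
  rw [perm_mul, toEnd_mul, ← mulOp_mul, mul_assoc, ← mul_assoc (perm v).toEnd, perm_mul_mulOp]
  simp only [mul_assoc]

theorem aS_eq (κ : ℂˣ) {i : ℕ} (hi : i < n) : extendOne (aS κ) i =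
    mulOp (aNat n κ i (i + 1)) * (perm (extendOne simple i)).toEnd := by
  rw [extendOne_of_lt _ hi, extendOne_of_lt _ hi, aNat, dif_pos ⟨by omega, by omega⟩]
  rfl

theorem seg_aS (κ : ℂˣ) {a k : ℕ} (h : a + k ≤ n) :
    ((List.range' a k).map (extendOne (aS κ))).prod =
      mulOp (∏ j ∈ Finset.range k, aNat n κ a (a + 1 + j)) *
        (perm (seg (extendOne simple) a k)).toEnd := by
  induction k generalizing a with
  | zero =>
    rw [Finset.range_zero, Finset.prod_empty, seg_zero, perm_one, mulOp_one]
    rfl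
  | succ k ih =>
    have e : substRat (extendOne (simple (n := n)) a) 1
        (∏ j ∈ Finset.range k, aNat n κ (a + 1) (a + 1 + 1 + j)) =
        ∏ j ∈ Finset.range k, aNat n κ a (a + 1 + (j + 1)) := by
      rw [map_prod]
      refine Finset.prod_congr rfl fun j hj => ?_
      rw [Finset.mem_range] at hj
      apply substRat_aNat κ _ (by omega) (by omega)
      · rw [extendOne_simple_val (by omega)]; simp
      · rw [extendOne_simple_val (by omega)]
        simp only
        split_ifs <;> omega
    rw [List.range'_succ, List.map_cons, List.prod_cons, ih (by omega), aS_eq κ (by omega),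
      mulOp_perm_mul, e, seg_succ, Finset.prod_range_succ', mul_comm (∏ j ∈ Finset.range k, _)]

/-- A new row contributes the factors a_{r,·}; moving its permutation past the earlier factors
a_{i,r+j} fixes the first index and raises the second by one. -/
theorem rows_aS (κ : ℂˣ) {r L : ℕ} (h : r + L ≤ n + 1) :
    ((rowsWord r L).map (extendOne (aS κ))).prod =
      mulOp (∏ i ∈ Finset.range r, ∏ j ∈ Finset.range L, aNat n κ i (r + j)) *
        (perm (rows (extendOne simple) r L)).toEnd := by
  induction r with
  | zero =>
    rw [Finset.range_zero, Finset.prod_empty, show rows (extendOne (simple (n := n))) 0 L = 1 from rfl,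
      perm_one, mulOp_one]
    rfl
  | succ r ih =>
    have e : substRat (seg (extendOne (simple (n := n))) r L) 1
        (∏ i ∈ Finset.range r, ∏ j ∈ Finset.range L, aNat n κ i (r + j)) =
        ∏ i ∈ Finset.range r, ∏ j ∈ Finset.range L, aNat n κ i (r + 1 + j) := by
      rw [map_prod]
      refine Finset.prod_congr rfl fun i hi => ?_
      rw [map_prod]
      refine Finset.prod_congr rfl fun j hj => ?_
      rw [Finset.mem_range] at hi hj
      apply substRat_aNat κ _ (by omega) (by omega)
      · rw [seg_simple_val (by omega)]
        simp only
        split_ifs <;> omega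
      · rw [seg_simple_val (by omega)]
        simp only
        split_ifs <;> omega
    rw [rowsWord, List.map_append, List.prod_append, ih (by omega), seg_aS κ (by omega),
      mulOp_perm_mul, e, rows_succ, Finset.prod_range_succ _ r, mul_comm]

theorem ACoeff_initial (κ : ℂˣ) {r : ℕ} (hr : r ≤ n + 1) : ACoeff κ (initial n r) =
    ∏ i ∈ Finset.range r, ∏ j ∈ Finset.range (n + 1 - r), aNat n κ i (r + j) := by
  rw [ACoeff]
  refine Finset.prod_bij (fun x _ => (x : ℕ)) (fun x hx => by simpa using hx)
    (fun x _ y _ h => Fin.ext h)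
    (fun i hi => ⟨⟨i, by have := Finset.mem_range.mp hi; omega⟩, by simpa using hi, rfl⟩)
    fun x _ => ?_
  refine Finset.prod_bij (fun y _ => (y : ℕ) - r) ?_ ?_ ?_ ?_
  · intro y hy
    rw [Finset.mem_compl, mem_initial] at hy
    have := y.2
    rw [Finset.mem_range]; omega
  · intro y hy y' hy' h
    rw [Finset.mem_compl, mem_initial] at hy hy'
    apply Fin.ext
    omega
  · intro j hj
    rw [Finset.mem_range] at hj
    refine ⟨⟨r + j, by omega⟩, by simp, by simp⟩
  · intro y hy
    rw [Finset.mem_compl, mem_initial] at hy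
    have e : r + ((y : ℕ) - r) = y := by omega
    rw [e, aNat, dif_pos ⟨x.2, y.2⟩]

theorem wt_smul (w : Equiv.Perm (Fin (n + 1))) (I : Finset (Fin (n + 1))) :
    wt (w • I) = ∑ x ∈ I, (w x : ℕ) := by
  rw [wt, Finset.smul_finset_def, Finset.sum_image (fun x _ y _ h => MulAction.injective _ h)]
  rfl

theorem wt_rot {r : ℕ} (hr : r ≤ n + 1) :
    wt (rot n r • initial n r) = wt (initial n r) + r * (n + 1 - r) := by
  rw [wt_smul, wt, ← card_initial hr, card_initial hr, ← smul_eq_mul]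
  nth_rewrite 4 [← card_initial hr]
  rw [← Finset.sum_const, ← Finset.sum_add_distrib]
  refine Finset.sum_congr rfl fun x hx => ?_
  rw [mem_initial] at hx
  rw [rot, finRotate_inv_pow_val r hr, if_pos hx]
  omega

theorem wt_initial {r : ℕ} (hr : r ≤ n + 1) :
    wt (initial n r) = ∑ i ∈ Finset.range r, i :=
  Finset.sum_bij (fun x _ => (x : ℕ)) (fun x hx => by simpa using hx)
    (fun x _ y _ h => Fin.ext h)
    (fun i hi => ⟨⟨i, by have := Finset.mem_range.mp hi; omega⟩, by simpa using hi, rfl⟩)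
    fun x _ => rfl

theorem wt_rot_eq_sum {r : ℕ} (hr : r ≤ n + 1) :
    wt (rot n r • initial n r) = ∑ i ∈ Finset.range r, (n - i) := by
  rw [wt_rot hr, wt_initial hr, ← Finset.sum_range_reflect (fun i => n - i) r]
  nth_rewrite 2 [← Finset.card_range r]
  rw [← smul_eq_mul, ← Finset.sum_const, ← Finset.sum_add_distrib]
  refine Finset.sum_congr rfl fun i hi => ?_
  rw [Finset.mem_range] at hi
  omega

theorem length_rowsWord (r L : ℕ) : (rowsWord r L).length = r * L := by
  induction r with
  | zero => simp [rowsWord]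
  | succ r ih => rw [rowsWord, List.length_append, List.length_range', ih]; ring

/-- The right-hand side is the weight of the last labels, as many as `l` has entries. So the left
word of Y_J is exactly long enough to descend to weight `wt J`, and no lower. -/
theorem length_leftWord {l : List ℕ} (hl : l.Pairwise (· < ·)) (hn : ∀ j ∈ l, j ≤ n) :
    (leftWord n l).length + l.sum = ∑ i ∈ Finset.range l.length, (n - i) := by
  induction l with
  | nil => rfl
  | cons j l ih =>
    have := length_add_le hl hn
    have := ih (List.pairwise_cons.mp hl).2 fun i hi => hn i (List.mem_cons_of_mem _ hi)
    rw [leftWord, List.length_append, List.length_range', List.sum_cons, List.length_cons,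
      Finset.sum_range_succ]
    omega

/-- Exchange argument: the labels of the initial set missing from J are below r, and the equally
many labels of J outside it are at least r. -/
theorem wt_initial_lt {r : ℕ} (hr : r ≤ n + 1) {J : Finset (Fin (n + 1))} (hJ : J.card = r)
    (hne : J ≠ initial n r) : wt (initial n r) < wt J := by
  have hc : (initial n r \ J).card = (J \ initial n r).card := by
    rw [Finset.card_sdiff_comm]
    rw [card_initial hr, hJ]
  have hnon : (initial n r \ J).Nonempty := by
    rw [Finset.sdiff_nonempty]
    intro h
    exact hne (Finset.eq_of_subset_of_card_le h (by rw [card_initial hr, hJ])).symm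
  have h1 : ∑ x ∈ initial n r \ J, (x : ℕ) < ∑ x ∈ initial n r \ J, r :=
    Finset.sum_lt_sum_of_nonempty hnon fun x hx => by
      simpa using (Finset.mem_sdiff.mp hx).1
  have h2 : ∑ x ∈ J \ initial n r, r ≤ ∑ x ∈ J \ initial n r, (x : ℕ) :=
    Finset.sum_le_sum fun x hx => by
      simpa using (Finset.mem_sdiff.mp hx).2
  rw [Finset.sum_const, hc, ← Finset.sum_const] at h1
  exact Finset.sum_sdiff_lt_sum_sdiff.mp (h1.trans_le h2)

/-- The leading coefficient of `Y_1 ⋯ Y_r`. -/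
theorem rows_leading (κ : ℂˣ) {r : ℕ} (hr : r ≤ n + 1) {l : List (Fin n)}
    (hl : l.map Fin.val = rowsWord r (n + 1 - r)) :
    wordCoeffs κ l (piCoeffs κ r) (initial n r) = mulOp (ACoeff κ (initial n r)) := by
  have h1 : (l.map simple).prod * rot n r = 1 := by
    rw [← map_extendOne_val, hl]
    exact rows_simple_mul_rot hr
  have h2 : (l.map (aS κ)).prod = mulOp (ACoeff κ (initial n r)) *
      (perm (rows (extendOne simple) r (n + 1 - r))).toEnd := by
    rw [← map_extendOne_val, hl, rows_aS κ (by omega), ACoeff_initial κ hr]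
  have h3 : l.length = r * (n + 1 - r) := by
    rw [← length_rowsWord, ← hl, List.length_map]
  have h := wordCoeffs_leading (κ := κ) hr l (by rw [h1, one_smul, h3, wt_rot hr])
  rw [h1, one_smul] at h
  rw [h, h2, mul_assoc, mul_assoc, ← mul_assoc (perm _).toEnd, ← toEnd_mul, ← perm_mul,
    rows_simple_mul_rot hr, perm_one, inv_one, sTot_one]
  rfl

/-! ### Replacing the right factor by a spin operator -/

theorem TPol_inv_apply (κ : ℂˣ) (i : Fin n) (Ψ : Vec n) :
    (TPol κ i)⁻¹ Ψ = TPol κ i Ψ - ((κ : ℂ) - (κ : ℂ)⁻¹) • Ψ := rfl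

theorem IsSpin.commute_of_mem {κ : ℂˣ} {Z : Module.End ℂ (Vec n)} (hZ : IsSpin Z) {g : GLVec n}
    (hg : g ∈ Subgroup.closure (Set.range (TPol (n := n) κ))) (Ψ : Vec n) : Z (g Ψ) = g (Z Ψ) := by
  have h : Subgroup.closure (Set.range (TPol (n := n) κ)) ≤ commutant Z := by
    rw [Subgroup.closure_le]
    rintro _ ⟨i, rfl⟩
    exact hZ.commute_TPol κ i
  exact LinearMap.congr_fun (mem_commutant.mp (h hg)).eq Ψ

/-- On invariant vectors the polynomial action of the Hecke algebra is given by spin operators. -/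
theorem exists_isSpin {κ : ℂˣ} {g : GLVec n}
    (hg : g ∈ Subgroup.closure (Set.range (TPol (n := n) κ))) :
    ∃ Z : Module.End ℂ (Vec n), IsSpin Z ∧ ∀ Ψ, IsInvariant κ Ψ → g Ψ = Z Ψ := by
  induction hg using Subgroup.closure_induction'' with
  | mem x hx =>
    obtain ⟨i, rfl⟩ := hx
    exact ⟨TSp κ i, isSpin_TSp κ i, fun Ψ hΨ => (hΨ i).symm⟩
  | inv_mem x hx =>
    obtain ⟨i, rfl⟩ := hx
    refine ⟨TSp κ i - ((κ : ℂ) - (κ : ℂ)⁻¹) • 1, (isSpin_TSp κ i).sub_smul _, fun Ψ hΨ => ?_⟩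
    rw [TPol_inv_apply, ← hΨ i]
    rfl
  | one => exact ⟨1, isSpin_one, fun Ψ _ => rfl⟩
  | mul x y hx hy ihx ihy =>
    obtain ⟨A, hA, hA'⟩ := ihx
    obtain ⟨B, hB, hB'⟩ := ihy
    -- The order is reversed: B Ψ need not be invariant, so B is first moved to the left of x, and
    -- only then is x replaced by A on Ψ.
    refine ⟨B * A, hB.mul hA, fun Ψ hΨ => ?_⟩
    rw [LinearEquiv.mul_apply, hB' Ψ hΨ, ← hB.commute_of_mem hx, hA' Ψ hΨ]
    rfl

theorem extendOne_mem {G : Type*} [Group G] (f : Fin n → G) (i : ℕ) :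
    extendOne f i ∈ Subgroup.closure (Set.range f) := by
  rw [extendOne]
  split_ifs
  · exact Subgroup.subset_closure ⟨_, rfl⟩
  · exact Subgroup.one_mem _

theorem seg_mem {G : Type*} [Group G] {T : ℕ → G} {S : Subgroup G} (h : ∀ i, T i ∈ S) (a k : ℕ) :
    seg T a k ∈ S := by
  apply S.list_prod_mem
  intro x hx
  obtain ⟨j, -, rfl⟩ := List.mem_map.mp hx
  exact h j

theorem rightFactor_mem {G : Type*} [Group G] {T : ℕ → G} {S : Subgroup G} (h : ∀ i, T i ∈ S)
    (l : List ℕ) : rightFactor T l ∈ S := by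
  induction l with
  | nil => exact S.one_mem
  | cons j l ih =>
    exact S.mul_mem (S.mul_mem (seg_mem h _ _) (seg_mem (fun i => S.inv_mem (h i)) _ _)) ih

/-! ### Expansion of products of Dunkl operators -/

theorem IsSpin.apply_subst {Z : Module.End ℂ (Vec n)} (hZ : IsSpin Z)
    (w : Equiv.Perm (Fin (n + 1))) (c : Fin (n + 1) → ℂˣ) (Φ : Vec n) :
    subst w c (Z Φ) = Z (subst w c Φ) := (LinearMap.congr_fun (hZ.comm w c).eq Φ).symm

theorem mul_evalC {κ : ℂˣ} (q : ℂˣ) (Z : Module.End ℂ (Vec n)) (C : Coeffs n) (Ψ : Vec n) :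
    Z (evalC κ q C Ψ) = evalC κ q (fun I => Z * C I) Ψ := by
  rw [evalC, map_sum]
  rfl

/-- The coefficients are chosen before q; this uniformity later allows them to be identified at a
single value of q. -/
theorem exists_coeffs_initial (κ : ℂˣ) {r : ℕ} (hr : r ≤ n + 1) :
    ∃ C : Coeffs n, (∀ I, IsSemi id (C I)) ∧ (∀ I, C I ≠ 0 → I.card = r) ∧
      (∀ q Ψ, IsInvariant κ Ψ → sortedProd (Y κ q) (initial n r) Ψ = evalC κ q C Ψ) ∧
      C (initial n r) = mulOp (ACoeff κ (initial n r)) := by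
  obtain ⟨l, hl⟩ := exists_fin_word (n := n) (l := rowsWord r (n + 1 - r)) fun i hi => by
    have := mem_rowsWord hi
    omega
  refine ⟨wordCoeffs κ l (piCoeffs κ r), wordCoeffs_semi κ l (piCoeffs_semi κ r),
    fun I hI => (wordCoeffs_support hr l hI).1, fun q Ψ hΨ => ?_, rows_leading κ hr hl⟩
  rw [sortedProd_Y, sort_initial hr, (isAffineBraid κ q).prod_dunkl_range hr, rows, ← hl,
    map_extendOne_val, LinearEquiv.mul_apply, piOp_pow_evalC q hr hΨ, word_evalC q l _ hΨ]

/-- The right factor acts on invariant vectors as a spin operator `Z`, which commutes with π^r and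
the left word and so multiplies the coefficients from the left. The left word descends only to
weight `wt J`, above the minimum attained by the initial set. -/
theorem exists_coeffs_of_ne (κ : ℂˣ) {r : ℕ} (hr : r ≤ n + 1) {J : Finset (Fin (n + 1))}
    (hJ : J.card = r) (hne : J ≠ initial n r) :
    ∃ C : Coeffs n, (∀ I, IsSemi id (C I)) ∧ (∀ I, C I ≠ 0 → I.card = r) ∧
      (∀ q Ψ, IsInvariant κ Ψ → sortedProd (Y κ q) J Ψ = evalC κ q C Ψ) ∧
      C (initial n r) = 0 := by
  set s := (J.sort (· ≤ ·)).map Fin.val with hs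
  have hlt : s.Pairwise (· < ·) :=
    List.pairwise_map.mpr ((Finset.sortedLT_sort _).pairwise.imp fun h => h)
  have hle : ∀ j ∈ s, j ≤ n := by
    intro j hj
    obtain ⟨x, -, rfl⟩ := List.mem_map.mp hj
    omega
  have hlen : s.length = r := by rw [hs, List.length_map, Finset.length_sort, hJ]
  have hsum : s.sum = wt J := by
    have := congrArg (fun m => (Multiset.map Fin.val m).sum) (Finset.sort_eq J (· ≤ ·))
    rw [Multiset.map_coe, Multiset.sum_coe] at this
    exact this
  obtain ⟨l, hl⟩ := exists_fin_word (n := n) (l := leftWord n s) fun i hi =>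
    (mem_leftWord (b := 0) (fun _ _ => Nat.zero_le _) hi).2
  obtain ⟨Z, hZ, hZ'⟩ := exists_isSpin (κ := κ)
    (rightFactor_mem (extendOne_mem (TPol (n := n) κ)) s)
  refine ⟨fun I => Z * wordCoeffs κ l (piCoeffs κ r) I,
    fun I => hZ.semi.mul (wordCoeffs_semi κ l (piCoeffs_semi κ r) I), fun I hI => ?_,
    fun q Ψ hΨ => ?_, ?_⟩
  · refine (wordCoeffs_support (κ := κ) hr l fun h => hI ?_).1
    simp only [h, mul_zero]
  · have hp : ∀ Φ, (piOp q ^ r) (Z Φ) = Z ((piOp q ^ r) Φ) := by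
      intro Φ
      rw [piOp_pow q hr, hZ.apply_subst]
    have hw : ∀ Φ, (l.map (TPol κ)).prod (Z Φ) = Z ((l.map (TPol κ)).prod Φ) := by
      intro Φ
      refine (hZ.commute_of_mem (κ := κ) (Subgroup.list_prod_mem _ fun x hx => ?_) Φ).symm
      obtain ⟨i, -, rfl⟩ := List.mem_map.mp hx
      exact Subgroup.subset_closure ⟨i, rfl⟩
    rw [sortedProd_Y, ← hs, (isAffineBraid κ q).prod_dunkl s hlt hle, ← hl, map_extendOne_val, hlen,
      LinearEquiv.mul_apply, LinearEquiv.mul_apply, hZ' Ψ hΨ, hp, hw, piOp_pow_evalC q hr hΨ,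
      word_evalC q l _ hΨ, mul_evalC]
  · by_contra h
    have h1 := (wordCoeffs_support (κ := κ) hr l (I := initial n r)
      fun h' => h (by simp only [h', mul_zero])).2
    have h2 := length_leftWord hlt hle
    rw [hlen, ← wt_rot_eq_sum hr, hsum, ← hl, List.length_map] at h2
    have h3 := wt_initial_lt hr hJ hne
    omega

theorem evalC_sum {ι : Type*} (κ q : ℂˣ) (s : Finset ι) (C : ι → Coeffs n) (Ψ : Vec n) :
    ∑ j ∈ s, evalC κ q (C j) Ψ = evalC κ q (fun I => ∑ j ∈ s, C j I) Ψ := by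
  simp only [evalC, LinearMap.sum_apply]
  exact Finset.sum_comm

theorem isSemi_sum {ι : Type*} {θ : RatFn n → RatFn n} (s : Finset ι)
    {A : ι → Module.End ℂ (Vec n)} (h : ∀ j ∈ s, IsSemi θ (A j)) : IsSemi θ (∑ j ∈ s, A j) := by
  intro x Ψ
  rw [LinearMap.sum_apply, LinearMap.sum_apply, Finset.smul_sum]
  exact Finset.sum_congr rfl fun j hj => h j hj x Ψ

theorem exists_coeffs_elemSymm (κ : ℂˣ) {r : ℕ} (hr : r ≤ n + 1) :
    ∃ C : Coeffs n, (∀ I, IsSemi id (C I)) ∧ (∀ I, I.card ≠ r → C I = 0) ∧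
      (∀ q Ψ, IsInvariant κ Ψ → elemSymm (Y κ q) r Ψ = evalC κ q C Ψ) ∧
      C (initial n r) = mulOp (ACoeff κ (initial n r)) := by
  have key : ∀ J : Finset (Fin (n + 1)), ∃ C : Coeffs n, J.card = r →
      (∀ I, IsSemi id (C I)) ∧ (∀ I, C I ≠ 0 → I.card = r) ∧
      (∀ q Ψ, IsInvariant κ Ψ → sortedProd (Y κ q) J Ψ = evalC κ q C Ψ) ∧
      C (initial n r) = if J = initial n r then mulOp (ACoeff κ (initial n r)) else 0 := by
    intro J
    by_cases h : J = initial n r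
    · obtain ⟨C, hC⟩ := exists_coeffs_initial κ hr
      exact ⟨C, fun _ => by rwa [h, if_pos rfl]⟩
    · by_cases hJ : J.card = r
      · obtain ⟨C, hC⟩ := exists_coeffs_of_ne κ hr hJ h
        exact ⟨C, fun _ => by rwa [if_neg h]⟩
      · exact ⟨0, fun h' => absurd h' hJ⟩
  choose C hC using key
  have hmem : ∀ {J : Finset (Fin (n + 1))}, J ∈ Finset.powersetCard r Finset.univ → J.card = r :=
    fun h => Finset.mem_powersetCard_univ.mp h
  refine ⟨fun I => ∑ J ∈ Finset.powersetCard r Finset.univ, C J I,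
    fun I => isSemi_sum _ fun J hJ => (hC J (hmem hJ)).1 I, fun I hI => ?_, fun q Ψ hΨ => ?_, ?_⟩
  · refine Finset.sum_eq_zero fun J hJ => ?_
    by_contra h
    exact hI ((hC J (hmem hJ)).2.1 I h)
  · rw [elemSymm_eq, LinearMap.sum_apply, ← evalC_sum]
    exact Finset.sum_congr rfl fun J hJ => (hC J (hmem hJ)).2.2.1 q Ψ hΨ
  · refine (Finset.sum_congr rfl fun J hJ => (hC J (hmem hJ)).2.2.2).trans ?_
    rw [ Finset.sum_ite_eq', if_pos]
    exact Finset.mem_powersetCard_univ.mpr (card_initial hr)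

/-! ### Independence of the dressed shifts -/

/-- The automorphisms `q̂_I s_w` of the rational functions. -/
def shiftHom (q : ℂˣ) (p : Finset (Fin (n + 1)) × Equiv.Perm (Fin (n + 1))) : RatFn n →* RatFn n :=
  ((substRat 1 fun j => if j ∈ p.1 then q else 1).toRingEquiv.toMonoidHom).comp
    (substRat p.2 1).toRingEquiv.toMonoidHom

theorem shiftHom_apply (q : ℂˣ) (p : Finset (Fin (n + 1)) × Equiv.Perm (Fin (n + 1)))
    (F : RatFn n) : shiftHom q p F =
      substRat 1 (fun j => if j ∈ p.1 then q else 1) (substRat p.2 1 F) := rfl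

theorem shiftHom_z (q : ℂˣ) (I : Finset (Fin (n + 1))) (w : Equiv.Perm (Fin (n + 1)))
    (i : Fin (n + 1)) : shiftHom q (I, w) (z i) =
      cst n (if w i ∈ I then q else 1 : ℂˣ) * z (w i) := by
  rw [shiftHom_apply, substRat_z, map_mul, substRat_cst, substRat_z]
  simp [cst]

/-- The image of z_i is a scalar multiple of z_{w(i)}, which determines w; the scalar is q or 1
according to membership in I. Since each coordinate is shifted at most once, q ≠ 1 suffices and
roots of unity are allowed. -/
theorem shiftHom_injective {q : ℂˣ} (hq : q ≠ 1) : Function.Injective (shiftHom (n := n) q) := by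
  rintro ⟨I, v⟩ ⟨J, w⟩ h
  have hz : ∀ i, cst n (if v i ∈ I then q else 1 : ℂˣ) * z (v i) =
      cst n (if w i ∈ J then q else 1 : ℂˣ) * z (w i) := fun i => by
    rw [← shiftHom_z, ← shiftHom_z, h]
  have hvw : v = w := by
    ext1 i
    by_contra hne
    exact lin_ne_zero _ _ (Units.ne_zero _) hne (sub_eq_zero.mpr (hz i))
  subst hvw
  refine Prod.ext (Finset.ext fun x => ?_) rfl
  have h1 := mul_right_cancel₀ (z_ne_zero _) (hz (v⁻¹ x))
  rw [← Equiv.Perm.mul_apply, mul_inv_cancel, Equiv.Perm.one_apply] at h1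
  have h2 := Units.ext ((algebraMap ℂ (RatFn n)).injective h1)
  by_cases h3 : x ∈ I <;> by_cases h4 : x ∈ J <;> simp_all

/-- The dressed shifts are linearly independent over the rational functions on invariant
vectors. -/
theorem coeffs_eq_zero {κ q : ℂˣ} (hq : q ≠ 1) {C : Coeffs n} (hC : ∀ I, IsSemi id (C I))
    (h : ∀ Ψ, IsInvariant κ Ψ → evalC κ q C Ψ = 0) (I : Finset (Fin (n + 1))) : C I = 0 := by
  -- Dedekind independence of characters. Applied to the symmetrization of x F, the hypothesis
  -- becomes ∑ (q̂_J s_w x) C_J D_J s^tot_w F = 0 for every rational function x, so each coefficient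
  -- vanishes; the one at w = 1 is the one wanted.
  have hli := (linearIndependent_monoidHom (RatFn n) (RatFn n)).comp _ (shiftHom_injective (n := n) hq)
  rw [Fintype.linearIndependent_iff] at hli
  have key : ∀ F : Vec n, C I (dressedShift κ q I F) = 0 := by
    intro F
    funext σ
    have h0 := hli (fun p => C p.1 (dressedShift κ q p.1 (sTot κ p.2 F)) σ) ?_ (I, 1)
    · rw [sTot_one] at h0
      exact h0
    funext x
    have h1 : evalC κ q C (∑ w, sTot κ w (x • F)) σ = 0 := by
      rw [h _ (isInvariant_sum κ _)]; rfl
    refine Eq.trans ?_ h1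
    rw [evalC, Fintype.sum_prod_type, Finset.sum_apply, Finset.sum_apply]
    simp only [Finset.sum_apply]
    refine Finset.sum_congr rfl fun J _ => ?_
    rw [map_sum, map_sum, Finset.sum_apply]
    refine Finset.sum_congr rfl fun w _ => ?_
    have e1 := isSemi_sTot κ w x F
    have e2 := dressedShift_semi κ q J (substRat w 1 x) (sTot κ w F)
    have e3 := hC J (shiftHom q (J, w) x) (dressedShift κ q J (sTot κ w F))
    rw [toEnd_apply, toEnd_apply] at e1 e2
    rw [e1, e2]
    rw [shiftHom_apply] at e3
    rw [e3, Pi.smul_apply, Pi.smul_apply, smul_eq_mul, smul_eq_mul, mul_comm]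
    rfl
  refine LinearMap.ext fun F => ?_
  have := key ((dressedShift κ q I)⁻¹ F)
  rwa [← LinearEquiv.mul_apply, mul_inv_cancel] at this

/-! ### The explicit formulas -/

theorem substRat_ACoeff (κ : ℂˣ) (w : Equiv.Perm (Fin (n + 1))) (J : Finset (Fin (n + 1))) :
    substRat w 1 (ACoeff κ J) = ACoeff κ (w • J) := by
  have e : (w • J)ᶜ = w • Jᶜ := by
    ext x
    simp only [Finset.mem_compl, ← Finset.inv_smul_mem_iff]
  rw [ACoeff, ACoeff, e, map_prod, Finset.smul_finset_def (s := J),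
    Finset.prod_image fun x _ y _ h => MulAction.injective _ h]
  refine Finset.prod_congr rfl fun x _ => ?_
  rw [map_prod, Finset.smul_finset_def (s := Jᶜ),
    Finset.prod_image fun x _ y _ h => MulAction.injective _ h]
  exact Finset.prod_congr rfl fun y _ => substRat_aCoeff κ (by rfl)

/-- A symmetric combination of dressed shifts has equivariant coefficients. -/
theorem coeffs_smul {κ q : ℂˣ} (hq : q ≠ 1) {C : Coeffs n} (hC : ∀ I, IsSemi id (C I))
    (h : ∀ Ψ, IsInvariant κ Ψ → IsInvariant κ (evalC κ q C Ψ)) (v : Equiv.Perm (Fin (n + 1)))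
    (I : Finset (Fin (n + 1))) :
    C (v • I) = (sTot κ v).toEnd * C I * (sTot κ v⁻¹).toEnd := by
  have hD : ∀ J, IsSemi id
      ((sTot κ v).toEnd * C (v⁻¹ • J) * (sTot κ v⁻¹).toEnd - C J) := by
    intro J x Ψ
    have h1 := (((isSemi_sTot κ v).mul (hC (v⁻¹ • J))).mul (isSemi_sTot κ v⁻¹)) x Ψ
    simp only [Function.comp_apply, id, ← substRat_mul, mul_inv_cancel, substRat_one] at h1
    rw [LinearMap.sub_apply, LinearMap.sub_apply, h1, hC J x Ψ, id, smul_sub]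
  -- Applying s^tot_v to the combination conjugates and relabels the coefficients; by invariance the
  -- value is unchanged, so the difference of the two families vanishes.
  have h0 := coeffs_eq_zero (κ := κ) hq hD (fun Ψ hΨ => ?_) (v • I)
  · rw [sub_eq_zero, inv_smul_smul] at h0
    exact h0.symm
  · have h2 := isInvariant_iff.mp (h Ψ hΨ) v
    have h3 : evalC κ q (fun J => (sTot κ v).toEnd * C (v⁻¹ • J) * (sTot κ v⁻¹).toEnd) Ψ =
        sTot κ v (evalC κ q C Ψ) := by
      rw [evalC, evalC, map_sum,
        ← Equiv.sum_comp (MulAction.toPerm v⁻¹) fun I => sTot κ v (C I (dressedShift κ q I Ψ))]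
      refine Finset.sum_congr rfl fun J _ => ?_
      rw [Module.End.mul_apply, Module.End.mul_apply, toEnd_apply, toEnd_apply,
        sTot_dressedShift_apply q hΨ]
      rfl
    have h4 : evalC κ q (fun J => (sTot κ v).toEnd * C (v⁻¹ • J) * (sTot κ v⁻¹).toEnd - C J) Ψ =
        evalC κ q (fun J => (sTot κ v).toEnd * C (v⁻¹ • J) * (sTot κ v⁻¹).toEnd) Ψ
          - evalC κ q C Ψ := by
      simp only [evalC, LinearMap.sub_apply, Finset.sum_sub_distrib]
    rw [h4, h3, h2, sub_self]

theorem exists_unit_ne_one : ∃ q : ℂˣ, q ≠ 1 :=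
  ⟨Units.mk0 2 two_ne_zero, fun h => by
    have := congrArg Units.val h
    norm_num at this⟩

/-- The expansion of `e_r(Y)` in the dressed shifts, on invariant vectors. -/
theorem elemSymm_Y_apply (κ q : ℂˣ) {r : ℕ} (hr : r ≤ n + 1) {Ψ : Vec n} (hΨ : IsInvariant κ Ψ) :
    elemSymm (Y κ q) r Ψ =
      ∑ J ∈ Finset.powersetCard r Finset.univ, ACoeff κ J • dressedShift κ q J Ψ := by
  obtain ⟨C, hC, hsupp, heval, hlead⟩ := exists_coeffs_elemSymm (n := n) κ hr
  have hval : ∀ J : Finset (Fin (n + 1)), J.card = r → C J = mulOp (ACoeff κ J) := by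
    intro J hJ
    -- The family `C` serves all q at once, so its equivariance may be proved at an auxiliary q' ≠
    -- 1; this covers q = 1 as well.
    obtain ⟨q', hq'⟩ := exists_unit_ne_one
    have h1 := coeffs_smul hq' hC (fun Ψ hΨ => by
      rw [← heval q' Ψ hΨ]
      exact spinMacdonald_invariant κ q' r hΨ) (grass J) (initial n r)
    have h2 := grass_smul_initial J
    rw [hJ] at h2
    rw [h2, hlead] at h1
    rw [h1]
    -- Semilinearity of s^tot turns conjugation of multiplication by A of the initial set into
    -- multiplication by A_J, leaving no matrix part.
    have h3 : (sTot κ (grass J)).toEnd * mulOp (ACoeff κ (initial n r)) =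
        mulOp (ACoeff κ J) * (sTot κ (grass J)).toEnd := by
      rw [← h2, ← substRat_ACoeff]
      rw [h2]
      exact LinearMap.ext fun Ψ => isSemi_sTot κ (grass J) _ Ψ
    rw [h3, mul_assoc, ← toEnd_mul, ← sTot_mul, mul_inv_cancel, sTot_one]
    rfl
  rw [heval q Ψ hΨ, evalC, ← Finset.sum_subset (Finset.subset_univ (Finset.powersetCard r
    Finset.univ))]
  · refine Finset.sum_congr rfl fun J hJ => ?_
    rw [hval J (Finset.mem_powersetCard_univ.mp hJ)]
    rfl
  · intro J _ hJ
    rw [hsupp J fun h => hJ (Finset.mem_powersetCard_univ.mpr h)]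
    rfl

theorem elemSymm_Y_RCheck (κ q : ℂˣ) {r : ℕ} (hr : r ≤ n + 1) {Ψ : Vec n}
    (hΨ : IsInvariant κ Ψ) : elemSymm (Y κ q) r Ψ =
      ∑ J ∈ Finset.powersetCard r Finset.univ,
        ACoeff κ J • ((RCheck κ ((grass J)⁻¹))⁻¹ * qShift q J * RCheck κ ((grass J)⁻¹)) Ψ := by
  rw [elemSymm_Y_apply κ q hr hΨ]
  refine Finset.sum_congr rfl fun J _ => ?_
  have h := RCheck_conj κ q (grass J) (card_le_succ J)
  rw [grass_smul_initial] at h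
  rw [h]

/-! ### Negative degrees -/

theorem qShift_univ_commute_sTot (κ q : ℂˣ) (w : Equiv.Perm (Fin (n + 1))) :
    Commute (sTot κ w) (qShift q Finset.univ) := by
  obtain ⟨l, hl, -⟩ := exists_isReducedWord w
  rw [sTot_eq_prod κ hl]
  apply Commute.list_prod_left
  intro x hx
  obtain ⟨i, -, rfl⟩ := List.mem_map.mp hx
  exact sTotGen_commute_qShift κ q (by simp)

theorem qShift_univ_commute_RCheck (κ q : ℂˣ) (w : Equiv.Perm (Fin (n + 1))) :
    Commute (RCheck κ w) (qShift q Finset.univ) := by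
  refine Commute.mul_left ?_ (qShift_univ_commute_sTot κ q w)
  rw [commute_iff_eq, perm, qShift, subst_mul, subst_mul]
  congr 1
  funext i
  simp

theorem qShift_univ_eq (q : ℂˣ) (I : Finset (Fin (n + 1))) :
    qShift q Finset.univ = qShift q Iᶜ * qShift q I := by
  rw [qShift, qShift, qShift, subst_mul]
  congr 1
  funext i
  by_cases h : i ∈ I <;> simp [h]

/-- The inverse shift of I is the inverse total shift times the shift of the complement, and the
total shift commutes with Ř because it preserves all ratios of coordinates. -/
theorem RCheck_conj_inv (κ q : ℂˣ) {w : Equiv.Perm (Fin (n + 1))} {r : ℕ} (hr : r ≤ n + 1)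
    {I : Finset (Fin (n + 1))} (h : w • initial n r = Iᶜ) :
    (RCheck κ w⁻¹)⁻¹ * (qShift q I)⁻¹ * RCheck κ w⁻¹ =
      (qShift q Finset.univ)⁻¹ * dressedShift κ q Iᶜ := by
  have e : (qShift q I)⁻¹ = (qShift q Finset.univ)⁻¹ * qShift q Iᶜ := by
    rw [qShift_univ_eq q I, mul_inv_rev, mul_assoc, inv_mul_cancel, mul_one]
  have hc := (qShift_univ_commute_RCheck κ q w⁻¹).inv_inv
  rw [← h, ← RCheck_conj κ q w hr, h, e, ← mul_assoc, hc.eq]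
  simp only [mul_assoc]

theorem ACoeff_compl (κ : ℂˣ) (I : Finset (Fin (n + 1))) : ACoeff κ Iᶜ = ACoeffNeg κ I := by
  rw [ACoeff, ACoeffNeg, compl_compl, Finset.prod_comm]

/-- The coefficient A_J is homogeneous of degree zero, hence unaffected by a common scaling. -/
theorem qShift_univ_inv_smul (κ q : ℂˣ) (J : Finset (Fin (n + 1))) (Ψ : Vec n) :
    (qShift q Finset.univ)⁻¹ (ACoeff κ J • Ψ) =
      ACoeff κ J • (qShift q Finset.univ)⁻¹ Ψ := by
  rw [qShift, subst_inv]
  refine (isSemi_subst _ _ (ACoeff κ J) Ψ).trans ?_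
  congr 1
  rw [ACoeff, map_prod]
  refine Finset.prod_congr rfl fun x _ => ?_
  rw [map_prod]
  refine Finset.prod_congr rfl fun y _ => ?_
  rw [substRat_aCoeff κ (by simp)]
  simp

theorem elemSymm_Y_inv_apply (κ q : ℂˣ) {r : ℕ} (hr : r ≤ n + 1) {Ψ : Vec n}
    (hΨ : IsInvariant κ Ψ) : elemSymm (fun i => (Y κ q i)⁻¹) r Ψ =
      ∑ I ∈ Finset.powersetCard r Finset.univ,
        ACoeffNeg κ I • ((qShift q Finset.univ)⁻¹ * dressedShift κ q Iᶜ : GLVec n) Ψ := by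
  have e : elemSymm (fun i => (Y κ q i)⁻¹) r =
      (qShift q Finset.univ)⁻¹.toEnd * elemSymm (Y (n := n) κ q) (n + 1 - r) := by
    rw [elemSymm_Y_compl κ q hr, ← mul_assoc, toEnd_inv_mul, one_mul]
  rw [e, Module.End.mul_apply, elemSymm_Y_apply κ q (by omega) hΨ, map_sum]
  refine Finset.sum_nbij' (fun J => Jᶜ) (fun J => Jᶜ) ?_ ?_ (fun J _ => compl_compl J)
    (fun J _ => compl_compl J) ?_
  · intro J hJ
    simp only [Finset.mem_powersetCard_univ] at hJ ⊢
    rw [Finset.card_compl, hJ, Fintype.card_fin]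
    omega
  · intro J hJ
    simp only [Finset.mem_powersetCard_univ] at hJ ⊢
    rw [Finset.card_compl, hJ, Fintype.card_fin]
  · intro J _
    rw [toEnd_apply, qShift_univ_inv_smul, ← ACoeff_compl, compl_compl]
    rfl

theorem elemSymm_Y_inv_RCheck (κ q : ℂˣ) {r : ℕ} (hr : r ≤ n + 1) {Ψ : Vec n}
    (hΨ : IsInvariant κ Ψ) : elemSymm (fun i => (Y κ q i)⁻¹) r Ψ =
      ∑ I ∈ Finset.powersetCard r Finset.univ, ACoeffNeg κ I •
        ((RCheck κ ((grassNeg I)⁻¹))⁻¹ * (qShift q I)⁻¹ * RCheck κ ((grassNeg I)⁻¹)) Ψ := by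
  rw [elemSymm_Y_inv_apply κ q hr hΨ]
  refine Finset.sum_congr rfl fun I _ => ?_
  rw [RCheck_conj_inv κ q (Nat.sub_le _ _) (grassNeg_smul I)]

theorem cycleIcc_smul_initial (i : Fin (n + 1)) :
    Fin.cycleIcc i (Fin.last n) • initial n n = {i}ᶜ := by
  apply smul_eq_of_forall_mem
  · rw [card_initial (by omega), Finset.card_compl, Fintype.card_fin, Finset.card_singleton]
    omega
  · intro x hx
    rw [mem_initial] at hx
    rw [Finset.mem_compl, Finset.mem_singleton]
    intro h
    have := (Fin.cycleIcc i (Fin.last n)).injective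
      (h.trans (Fin.cycleIcc_of_last (Fin.le_last i)).symm)
    rw [this] at hx
    simp at hx

theorem elemSymm_Y_inv_one (κ q : ℂˣ) {Ψ : Vec n} (hΨ : IsInvariant κ Ψ) :
    elemSymm (fun i => (Y κ q i)⁻¹) 1 Ψ =
      ∑ i : Fin (n + 1), ACoeffNeg κ {i} •
        ((RCheck κ (descCycle (Fin.last n) i))⁻¹ * (qShift q {i})⁻¹ *
          RCheck κ (descCycle (Fin.last n) i)) Ψ := by
  rw [elemSymm_Y_inv_apply κ q (by omega) hΨ, Finset.powersetCard_one, Finset.sum_map]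
  refine Finset.sum_congr rfl fun i _ => ?_
  rw [descCycle, RCheck_conj_inv κ q (Nat.le_succ n) (cycleIcc_smul_initial i)]
  rfl

/-- The total shift is the product of all Dunkl operators, so it commutes with their inverses. -/
theorem elemSymm_Y_compl' (κ q : ℂˣ) {r : ℕ} (hr : r ≤ n + 1) :
    elemSymm (Y (n := n) κ q) (n + 1 - r) =
      elemSymm (fun i => (Y κ q i)⁻¹) r * (qShift q Finset.univ).toEnd := by
  rw [elemSymm_Y_compl κ q hr, ← sortedProd_Y_univ κ q]
  exact Commute.sum_right _ _ _ fun J _ => commute_toEnd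
    (sortedProd_commute fun j _ => (sortedProd_commute fun i _ =>
      ((Y_commute κ q i j).inv_right).symm).symm)

end SpinRuijsenaars

end

/-! ### The main theorem. -/

theorem theorem3p2 (n : ℕ) (κ q : ℂˣ) :
    -- `s^tot` is a representation of the symmetric group with `s_i ↦ s_i Ř_{i,i+1}(z_i / z_{i+1})`
    ((∀ i : Fin n, sTot κ (simple i) = sTotGen κ i) ∧
      sTot κ (1 : Equiv.Perm (Fin (n + 1))) = 1 ∧
      ∀ v w : Equiv.Perm (Fin (n + 1)), sTot κ (v * w) = sTot κ v * sTot κ w) ∧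
    -- `s^tot_w = Ř_{w⁻¹}⁻¹ s_w = s_w Ř_w`
    (∀ w : Equiv.Perm (Fin (n + 1)),
      sTot κ w = (RCheck κ (w⁻¹))⁻¹ * perm w ∧ sTot κ w = perm w * RCheck κ w) ∧
    -- the spin-Macdonald operators preserve the physical space and commute on it
    (∀ r : ℤ, ∀ Ψ ∈ physical (n := n) κ, spinMacdonald κ q r Ψ ∈ physical (n := n) κ) ∧
    (∀ r s : ℤ, ∀ Ψ ∈ physical (n := n) κ,
      spinMacdonald κ q r (spinMacdonald κ q s Ψ) =
        spinMacdonald κ q s (spinMacdonald κ q r Ψ)) ∧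
    -- the explicit form of `D̃_r = e_r(Y)`
    (∀ r : ℕ, r ≤ n + 1 → ∀ Ψ ∈ physical (n := n) κ,
      spinMacdonald κ q r Ψ =
        ∑ J ∈ Finset.powersetCard r (Finset.univ : Finset (Fin (n + 1))),
          ACoeff κ J •
            ((RCheck κ ((grass J)⁻¹))⁻¹ * qShift q J * RCheck κ ((grass J)⁻¹)) Ψ) ∧
    -- `D̃_{N-r} = q̂₁ ⋯ q̂_N D̃_{-r} = D̃_{-r} q̂₁ ⋯ q̂_N`
    (∀ r : ℕ, r ≤ n + 1 → ∀ Ψ ∈ physical (n := n) κ,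
      spinMacdonald κ q ((n + 1 : ℕ) - r) Ψ =
          qShift q Finset.univ (spinMacdonald κ q (-r) Ψ) ∧
      spinMacdonald κ q ((n + 1 : ℕ) - r) Ψ =
          spinMacdonald κ q (-r) (qShift q Finset.univ Ψ)) ∧
    -- the explicit form of `D̃_{-1}`
    (∀ Ψ ∈ physical (n := n) κ,
      spinMacdonald κ q (-1) Ψ =
        ∑ i : Fin (n + 1),
          ACoeffNeg κ {i} •
            ((RCheck κ (descCycle (Fin.last n) i))⁻¹ * (qShift q {i})⁻¹ *
              RCheck κ (descCycle (Fin.last n) i)) Ψ) ∧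
    -- the explicit form of `D̃_{-r}`
    (∀ r : ℕ, r ≤ n + 1 → ∀ Ψ ∈ physical (n := n) κ,
      spinMacdonald κ q (-r) Ψ =
        ∑ I ∈ Finset.powersetCard r (Finset.univ : Finset (Fin (n + 1))),
          ACoeffNeg κ I •
            ((RCheck κ ((grassNeg I)⁻¹))⁻¹ * (qShift q I)⁻¹ *
              RCheck κ ((grassNeg I)⁻¹)) Ψ) := by
  refine ⟨⟨sTot_simple κ, sTot_one κ, sTot_mul κ⟩, fun w => ⟨?_, sTot_eq_perm_mul κ w⟩,
    fun r Ψ hΨ => ?_, fun r s Ψ _ => LinearMap.congr_fun (spinMacdonald_commute κ q r s).eq Ψ,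
    fun r hr Ψ hΨ => elemSymm_Y_RCheck κ q hr (mem_physical.mp hΨ).2, fun r hr Ψ _ => ?_,
    fun Ψ hΨ => elemSymm_Y_inv_one κ q (mem_physical.mp hΨ).2, fun r hr Ψ hΨ => ?_⟩
  · rw [RCheck_inv, mul_assoc, inv_mul_cancel, mul_one]
  · obtain ⟨h1, h2⟩ := mem_physical.mp hΨ
    exact mem_physical.mpr ⟨spinMacdonald_mem_polyVec κ q r h1, spinMacdonald_invariant κ q r h2⟩
  · rw [← Nat.cast_sub hr, spinMacdonald_natCast, spinMacdonald_neg]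
    exact ⟨LinearMap.congr_fun (elemSymm_Y_compl κ q hr) Ψ,
      LinearMap.congr_fun (elemSymm_Y_compl' κ q hr) Ψ⟩
  · rw [spinMacdonald_neg]
    exact elemSymm_Y_inv_RCheck κ q hr (mem_physical.mp hΨ).2
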